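/- **Setting.** Let $\mathcal P=\mathbb C[z]$ and let $\mathcal P^*$ be its algebraic dual. For a lattice $x:\mathbb C\to\mathbb C$, either $x(s)=\mathfrak c_1q^{-s}+\mathfrak c_2q^s+\mathfrak c_3$ with $q>0$, $q\ne1$, $(\mathfrak c_1,\mathfrak c_2)\neq(0,0)$, or $x(s)=\mathfrak c_4s^2+\mathfrak c_5s+\mathfrak c_6$ with $(\mathfrak c_4,\mathfrak c_5)\ne(0,0)$, let $\mathrm D_x,\mathrm S_x$ be the linear operators on $\mathcal P$ determined by $$(\mathrm D_xf)(x(s))=\frac{f(x(s+\frac12))-f(x(s-\frac12))}{x(s+\frac12)-x(s-\frac12)},\qquad(\mathrm S_xf)(x(s))=\frac{f(x(s+\frac12))+f(x(s-\frac12))}2 .$$ For $\mathbf u\in\mathcal P^*$ and $g\in\mathcal P$ put $\langle g\mathbf u,f\rangle=\langle\mathbf u,gf\rangle$, $\langle\mathbf D_x\mathbf u,f\rangle=-\langle\mathbf u,\mathrm D_xf\rangle$, $\langle\mathbf S_x\mathbf u,f\rangle=\langle\mathbf u,\mathrm S_xf\rangle$. A sequence $(P_n)_{n\ge0}$ with $\deg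 P_n=n$ is an OPS with respect to $\mathbf u$ if $\langle\mathbf u,P_nP_k\rangle=h_n\delta_{n,k}$ with $h_n\ne0$ for all $n,k\ge0$; $\mathbf u$ is regular if it has an OPS. **(A) Askey–Wilson.** Let $x(s)=\mathfrak c_1q^{-s}+\mathfrak c_2q^s+\mathfrak c_3$ with $q>0$, $q\neq1$, $(\mathfrak c_1,\mathfrak c_2)\ne(0,0)$, let $a,b,c,d\in\mathbb C$, and let $r=\sqrt{\mathfrak c_1\mathfrak c_2}$ be a fixed (arbitrary) square root of $\mathfrak c_1\mathfrak c_2$. Set $$\begin{aligned}\phi(z)&=2(1+abcd)(z-\mathfrak c_3)^2-2r(a+b+c+d+abc+abd+acd+bcd)(z-\mathfrak c_3)\\&\quad+4\mathfrak c_1\mathfrak c_2(ab+ac+ad+bc+bd+cd-abcd-1),\\\psi(z)&=\frac{4q^{1/2}}{q-1}\Big((abcd-1)(z-\mathfrak c_3)+r(a+b+c+d-abc-abd-acd-bcd)\Big),\end{aligned}$$ and let $\mathbf u\in\mathcal P^*\setminus\{\mathbf 0\}$ satisfy $\mathbf D_x(\phi\mathbf u)=\mathbf S_x(\psi\mathbf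 u)$. Then: 1. For $n\ge0$ the number $d_n:=\frac12\gamma_n\phi''+\alpha_n\psi'$, where $\alpha_n=\frac{q^{n/2}+q^{-n/2}}2$ and $\gamma_n=\frac{q^{n/2}-q^{-n/2}}{q^{1/2}-q^{-1/2}}$, equals $-\frac4{q^{1/2}-q^{-1/2}}\,q^{-n/2}(1-abcd\,q^n)$. 2. $\mathbf u$ is regular if and only if, for all $n\ge0$, $$\mathfrak c_1\mathfrak c_2(1-abcdq^n)(1-abq^n)(1-acq^n)(1-adq^n)(1-bcq^n)(1-bdq^n)(1-cdq^n)\ne0 .$$ 3. If $\mathbf u$ is regular, every monic OPS $(P_n)$ with respect to $\mathbf u$ satisfies $P_{n+1}(z)=(z-B_n)P_n(z)-C_nP_{n-1}(z)$ $(n\ge0;\ P_{-1}=0,\ P_0=1)$, where $$\begin{aligned}B_n=\mathfrak c_3+r\Big[a+\frac1a&-\frac{(1-abq^n)(1-acq^n)(1-adq^n)(1-abcdq^{n-1})}{a(1-abcdq^{2n-1})(1-abcdq^{2n})}\\&-\frac{a(1-q^n)(1-bcq^{n-1})(1-bdq^{n-1})(1-cdq^{n-1})}{(1-abcdq^{2n-1})(1-abcdq^{2n-2})}\Big]\end{aligned}$$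 for $a\ne0$, while for $a=0$ the number $B_n$ is the limit of this expression as $a\to0$, and $$C_{n+1}=\mathfrak c_1\mathfrak c_2(1-q^{n+1})(1-abcdq^{n-1})\frac{(1-abq^n)(1-acq^n)(1-adq^n)(1-bcq^n)(1-bdq^n)(1-cdq^n)}{(1-abcdq^{2n-1})(1-abcdq^{2n})^2(1-abcdq^{2n+1})} .$$ For $n=0$ the common factor $1-abcdq^{-1}$ in $B_0$ and $C_1$ is cancelled and the last summand of $B_0$ is $0$. 4. If $\mathbf u$ is regular, then for the same $(P_n)$ and all $n\ge0$, $z\in\mathbb C$, $$P_n(z)=2^nr^n\,Q_n\Big(\frac{z-\mathfrak c_3}{2r};a,b,c,d\,\Big|\,q\Big),$$ where $Q_n$ is the monic Askey–Wilson polynomial: for $a\ne0$, $$Q_n(\cos\theta;a,b,c,d|q)=\frac{(ab,ac,ad;q)_n}{(2a)^n(abcdq^{n-1};q)_n}\sum_{k=0}^n\frac{(q^{-n},abcdq^{n-1},ae^{i\theta},ae^{-i\theta};q)_k}{(ab,ac,ad,q;q)_k}\,q^k,$$ and for $a=0$ it is the limit of this as $a\to0$. Here $(y;q)_k=\prod_{j<k}(1-yq^j)$,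 and $(ae^{i\theta},ae^{-i\theta};q)_k$ is read as the polynomial $\prod_{j<k}(1-2aq^jX+a^2q^{2j})$ in $X=\cos\theta$. **(B) Racah.** Let $a,b,c,d\in\mathbb C$, $x(s)=s(s+a+b+1)$, $$\begin{aligned}\phi(z)&=2z^2+[(a+b+2c+3)d+c(a-b+3)+2(a+b+ab+2)]z+(1+a)(1+d)(a+b+1)(b+c+1),\\\psi(z)&=2(d+c+2)z+2(1+a)(1+d)(b+c+1),\end{aligned}$$ and let $\mathbf u\in\mathcal P^*\setminus\{\mathbf 0\}$ satisfy $\mathbf D_x(\phi\mathbf u)=\mathbf S_x(\psi\mathbf u)$. Then $\mathbf u$ is regular if and only if $$\{a,\,c,\,d,\,d+c+1,\,b+c,\,c+d-a,\,d-b\}\cap\{-1,-2,-3,\dots\}=\emptyset .$$ If $\mathbf u$ is regular, every monic OPS $(P_n)$ with respect to $\mathbf u$ satisfies the recurrence of (A)3 with $$\begin{aligned}B_n&=-\frac{(n+a+1)(n+d+1)(n+b+c+1)(n+d+c+1)}{(2n+d+c+1)(2n+d+c+2)}-\frac{n(n+c)(n+d+c-a)(n+d-b)}{(2n+d+c)(2n+d+c+1)},\\C_{n+1}&=(n+1)(n+a+1)(n+c+1)(n+d+1)\\&\quad\times\frac{(n+d+c+1)(n+b+c+1)(n+c+d-a+1)(n+d-b+1)}{(2n+d+c+1)(2n+d+c+2)^2(2n+d+c+3)}\end{aligned}$$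 (for $n=0$ the common factor $d+c+1$ is cancelled and the last summand of $B_0$ is $0$), and $P_n(z)=R_n(z;d,c,a,b)$ for all $n\ge0$, where $R_n(\cdot;\alpha,\beta,\gamma,\delta)$ is the monic Racah polynomial $$R_n(X;\alpha,\beta,\gamma,\delta)=\frac{(\alpha+1)_n(\beta+\delta+1)_n(\gamma+1)_n}{(n+\alpha+\beta+1)_n}\sum_{k=0}^n\frac{(-n)_k(n+\alpha+\beta+1)_k\prod_{j<k}\big(j(j+\gamma+\delta+1)-X\big)}{(\alpha+1)_k(\beta+\delta+1)_k(\gamma+1)_k\,k!}$$ and $(y)_k=y(y+1)\cdots(y+k-1)$. (With $X=s(s+\gamma+\delta+1)$ the product over $j$ is $(-s)_k(s+\gamma+\delta+1)_k$.) -/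

import Mathlib

open Polynomial Filter Topology

/-! ### Lattices -/

/-- The lattice `x(s) = c₁ q^{-s} + c₂ q^s + c₃`. -/
noncomputable def qLattice (q : ℝ) (c₁ c₂ c₃ : ℂ) : ℂ → ℂ :=
  fun s => c₁ * (q : ℂ) ^ (-s) + c₂ * (q : ℂ) ^ s + c₃

/-- The lattice `x(s) = c₄ s² + c₅ s + c₆`. -/
def quadLattice (c₄ c₅ c₆ : ℂ) : ℂ → ℂ :=
  fun s => c₄ * s ^ 2 + c₅ * s + c₆

/-- The non-constant lattices: `q`-quadratic or `q`-linear ones (`q > 0`, `q ≠ 1`),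
and quadratic or linear ones (the case `q = 1`). -/
inductive IsLattice : (ℂ → ℂ) → Prop
  | exp (q : ℝ) (c₁ c₂ c₃ : ℂ) (hq : 0 < q) (hq1 : q ≠ 1) (hc : (c₁, c₂) ≠ (0, 0)) :
      IsLattice (qLattice q c₁ c₂ c₃)
  | quad (c₄ c₅ c₆ : ℂ) (hc : (c₄, c₅) ≠ (0, 0)) : IsLattice (quadLattice c₄ c₅ c₆)

/-! ### The `x`-derivative and the `x`-average on polynomials -/

/-- `D` is the divided difference operator of the lattice `x`:
`(D f)(x(s)) = (f(x(s+1/2)) - f(x(s-1/2))) / (x(s+1/2) - x(s-1/2))`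
wherever the denominator does not vanish. -/
def IsXDeriv (x : ℂ → ℂ) (D : ℂ[X] →ₗ[ℂ] ℂ[X]) : Prop :=
  ∀ (f : ℂ[X]) (s : ℂ), x (s + 1 / 2) ≠ x (s - 1 / 2) →
    (D f).eval (x s) =
      (f.eval (x (s + 1 / 2)) - f.eval (x (s - 1 / 2))) / (x (s + 1 / 2) - x (s - 1 / 2))

/-- `S` is the averaging operator of the lattice `x`:
`(S f)(x(s)) = (f(x(s+1/2)) + f(x(s-1/2))) / 2`. -/
def IsXAver (x : ℂ → ℂ) (S : ℂ[X] →ₗ[ℂ] ℂ[X]) : Prop :=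
  ∀ (f : ℂ[X]) (s : ℂ),
    (S f).eval (x s) = (f.eval (x (s + 1 / 2)) + f.eval (x (s - 1 / 2))) / 2

/-- Auxiliary recursion used to prove that the two operators exist. -/
noncomputable def latticeAux (α β : ℂ) (U : ℂ[X]) : ℕ → ℂ[X] × ℂ[X]
  | 0 => (0, 1)
  | n + 1 =>
      ((C α * X + C β) * (latticeAux α β U n).1 + (latticeAux α β U n).2,
        U * (latticeAux α β U n).1 + (C α * X + C β) * (latticeAux α β U n).2)

theorem exists_lattice_ops (x : ℂ → ℂ) (α β : ℂ) (U : ℂ[X])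
    (h1 : ∀ s, x (s + 1 / 2) + x (s - 1 / 2) = 2 * (α * x s + β))
    (h2 : ∀ s, (x (s + 1 / 2) - x (s - 1 / 2)) ^ 2 = 4 * U.eval (x s)) :
    ∃ D S : ℂ[X] →ₗ[ℂ] ℂ[X], IsXDeriv x D ∧ IsXAver x S := by
  have key : ∀ n s,
      ((latticeAux α β U n).1.eval (x s) * (x (s + 1 / 2) - x (s - 1 / 2)) =
        x (s + 1 / 2) ^ n - x (s - 1 / 2) ^ n) ∧
      ((latticeAux α β U n).2.eval (x s) = (x (s + 1 / 2) ^ n + x (s - 1 / 2) ^ n) / 2) := by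
    intro n
    induction n with
    | zero => intro s; simp [latticeAux]
    | succ n ih =>
      intro s
      obtain ⟨ha, hb⟩ := ih s
      have e1 := h1 s
      have e2 := h2 s
      simp only [latticeAux, eval_add, eval_mul, eval_C, eval_X]
      generalize x (s + 1 / 2) = p at *
      generalize x (s - 1 / 2) = m at *
      generalize x s = z at *
      generalize eval z (latticeAux α β U n).1 = d at *
      generalize eval z (latticeAux α β U n).2 = t at *
      generalize eval z U = w at *
      subst hb
      have e3 : α * z + β = (p + m) / 2 := by rw [e1]; ring
      have e4 : w = (p - m) ^ 2 / 4 := by rw [e2]; ring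
      rw [e3, e4]
      refine ⟨?_, ?_⟩
      · linear_combination ((p + m) / 2) * ha
      · linear_combination ((p - m) / 4) * ha
  refine ⟨(basisMonomials ℂ).constr ℂ (fun n => (latticeAux α β U n).1),
    (basisMonomials ℂ).constr ℂ (fun n => (latticeAux α β U n).2), ?_, ?_⟩
  · intro f s hs
    rw [eq_div_iff (sub_ne_zero.mpr hs)]
    induction f using Polynomial.induction_on' with
    | add p r hp hr => simp only [map_add, eval_add]; linear_combination hp + hr
    | monomial n a =>
      have : (monomial n a : ℂ[X]) = a • basisMonomials ℂ n := by
        simp [coe_basisMonomials, smul_monomial]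
      rw [this, map_smul, Module.Basis.constr_basis]
      simp only [eval_smul, coe_basisMonomials, eval_monomial, smul_eq_mul, one_mul]
      linear_combination a * (key n s).1
  · intro f s
    induction f using Polynomial.induction_on' with
    | add p r hp hr => simp only [map_add, eval_add]; linear_combination hp + hr
    | monomial n a =>
      have : (monomial n a : ℂ[X]) = a • basisMonomials ℂ n := by
        simp [coe_basisMonomials, smul_monomial]
      rw [this, map_smul, Module.Basis.constr_basis]
      simp only [eval_smul, coe_basisMonomials, eval_monomial, smul_eq_mul, one_mul]
      linear_combination a * (key n s).2

theorem finite_nat_roots (τ : ℕ → ℂ) (hτ : Function.Injective τ) (p : ℂ[X]) (hp : p ≠ 0) :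
    {n : ℕ | p.eval (τ n) = 0}.Finite := by
  have : {n : ℕ | p.eval (τ n) = 0} = τ ⁻¹' {z | p.IsRoot z} := rfl
  rw [this]
  exact (Polynomial.finite_setOfPred_isRoot hp).preimage hτ.injOn

theorem quad_poly_ne_zero {a b c : ℂ} (h : ¬ (a = 0 ∧ b = 0 ∧ c = 0)) :
    (C a * X ^ 2 + C b * X + C c : ℂ[X]) ≠ 0 := by
  intro h0
  apply h
  have e := fun k => congrArg (fun p : ℂ[X] => p.coeff k) h0
  have e2 := e 2
  have e1 := e 1
  have e0 := e 0
  simp [coeff_X, coeff_C] at e2 e1 e0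
  exact ⟨e2, e1, e0⟩

/-- On the good natural arguments a lattice takes each value finitely often, so a polynomial
is determined by its values along the lattice. -/
theorem IsLattice.poly_ext {x : ℂ → ℂ} (hx : IsLattice x) {f g : ℂ[X]}
    (h : ∀ s, x (s + 1 / 2) ≠ x (s - 1 / 2) → f.eval (x s) = g.eval (x s)) : f = g := by
  suffices hfin : {n : ℕ | x ((n : ℂ) + 1 / 2) = x ((n : ℂ) - 1 / 2)}.Finite ∧
      ∀ v : ℂ, {n : ℕ | x n = v}.Finite by
    obtain ⟨hb, hf⟩ := hfin
    by_contra hne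
    have hne' : f - g ≠ 0 := sub_ne_zero.mpr hne
    have hroots := Polynomial.finite_setOfPred_isRoot hne'
    have hu := hb.union (hroots.biUnion (fun v _ => hf v))
    refine Set.infinite_univ (hu.subset ?_)
    intro n _
    by_cases hn : x ((n : ℂ) + 1 / 2) = x ((n : ℂ) - 1 / 2)
    · exact Or.inl hn
    · refine Or.inr (Set.mem_biUnion (x := x n) ?_ rfl)
      simp [IsRoot, h n hn]
  cases hx with
  | exp q c₁ c₂ c₃ hq hq1 hc =>
    have hq0 : (q : ℂ) ≠ 0 := by exact_mod_cast hq.ne'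
    have hinj : Function.Injective (fun n : ℕ => (q : ℂ) ^ n) := by
      intro m n hmn
      have hmn' : (q : ℂ) ^ m = (q : ℂ) ^ n := hmn
      have : q ^ m = q ^ n := by exact_mod_cast hmn'
      exact pow_right_injective₀ hq hq1 this
    have hc' : ¬ (c₂ = 0 ∧ c₁ = 0) := fun hh => hc (by rw [hh.1, hh.2])
    refine ⟨?_, fun v => ?_⟩
    · refine (finite_nat_roots _ hinj (C c₂ * X ^ 2 + C 0 * X + C (-c₁))
        (quad_poly_ne_zero (by simpa using hc'))).subset ?_
      intro n hn
      simp only [Set.mem_ofPred_eq, qLattice, eval_add, eval_mul, eval_C, eval_pow, eval_X] at hn ⊢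
      set t := (q : ℂ) ^ (1 / 2 : ℂ) with ht
      have ht0 : t ≠ 0 := by rw [ht, Complex.cpow_def_of_ne_zero hq0]; exact Complex.exp_ne_zero _
      have htt : t ^ 2 = q := by
        rw [ht, pow_two, ← Complex.cpow_add _ _ hq0]; norm_num
      have e1 : (q : ℂ) ^ ((n : ℂ) + 1 / 2) = q ^ n * t := by
        rw [Complex.cpow_add _ _ hq0, Complex.cpow_natCast]
      have e2 : (q : ℂ) ^ ((n : ℂ) - 1 / 2) = q ^ n / t := by
        rw [Complex.cpow_sub _ _ hq0, Complex.cpow_natCast]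
      have hw : (q : ℂ) ^ n ≠ 0 := pow_ne_zero _ hq0
      rw [Complex.cpow_neg, Complex.cpow_neg, e1, e2] at hn
      generalize (q : ℂ) ^ n = w at *
      have ht1 : t ^ 2 - 1 ≠ 0 := by
        rw [htt, sub_ne_zero]; exact_mod_cast hq1
      field_simp at hn
      have : (t ^ 2 - 1) * (c₂ * w ^ 2 + 0 * w + -c₁) = 0 := by linear_combination hn
      exact (mul_eq_zero.mp this).resolve_left ht1
    · refine (finite_nat_roots _ hinj (C c₂ * X ^ 2 + C (c₃ - v) * X + C c₁)
        (quad_poly_ne_zero (fun hh => hc' ⟨hh.1, hh.2.2⟩))).subset ?_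
      intro n hn
      simp only [Set.mem_ofPred_eq, qLattice, eval_add, eval_mul, eval_C, eval_pow, eval_X,
        Complex.cpow_neg, Complex.cpow_natCast] at hn ⊢
      have hw : (q : ℂ) ^ n ≠ 0 := pow_ne_zero _ hq0
      generalize (q : ℂ) ^ n = w at *
      field_simp at hn
      linear_combination hn
  | quad c₄ c₅ c₆ hc =>
    have hc' : ¬ (c₄ = 0 ∧ c₅ = 0) := fun hh => hc (by rw [hh.1, hh.2])
    refine ⟨?_, fun v => ?_⟩
    · refine (finite_nat_roots _ Nat.cast_injective (C 0 * X ^ 2 + C (2 * c₄) * X + C c₅)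
        (quad_poly_ne_zero (by simpa using hc'))).subset ?_
      intro n hn
      simp only [Set.mem_ofPred_eq, quadLattice, eval_add, eval_mul, eval_C, eval_pow, eval_X]
        at hn ⊢
      linear_combination hn
    · refine (finite_nat_roots _ Nat.cast_injective (C c₄ * X ^ 2 + C c₅ * X + C (c₆ - v))
        (quad_poly_ne_zero (fun hh => hc' ⟨hh.1, hh.2.1⟩))).subset ?_
      intro n hn
      simp only [Set.mem_ofPred_eq, quadLattice, eval_add, eval_mul, eval_C, eval_pow, eval_X]
        at hn ⊢
      linear_combination hn

theorem IsLattice.exists_ops {x : ℂ → ℂ} (hx : IsLattice x) :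
    ∃ D S : ℂ[X] →ₗ[ℂ] ℂ[X], IsXDeriv x D ∧ IsXAver x S := by
  cases hx with
  | exp q c₁ c₂ c₃ hq hq1 hc =>
    have hq0 : (q : ℂ) ≠ 0 := by exact_mod_cast hq.ne'
    set t := (q : ℂ) ^ (1 / 2 : ℂ) with ht
    have ht0 : t ≠ 0 := by rw [ht, Complex.cpow_def_of_ne_zero hq0]; exact Complex.exp_ne_zero _
    have e1 : ∀ s : ℂ, (q : ℂ) ^ (s + 1 / 2) = (q : ℂ) ^ s * t := fun s => by
      rw [Complex.cpow_add _ _ hq0]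
    have e2 : ∀ s : ℂ, (q : ℂ) ^ (s - 1 / 2) = (q : ℂ) ^ s / t := fun s => by
      rw [Complex.cpow_sub _ _ hq0]
    have hw : ∀ s : ℂ, (q : ℂ) ^ s ≠ 0 := fun s => by
      rw [Complex.cpow_def_of_ne_zero hq0]; exact Complex.exp_ne_zero _
    refine exists_lattice_ops _ ((t + 1 / t) / 2) ((1 - (t + 1 / t) / 2) * c₃)
      (C (((t + 1 / t) / 2) ^ 2 - 1) * ((X - C c₃) ^ 2 - C (4 * c₁ * c₂))) ?_ ?_
    · intro s
      simp only [qLattice, Complex.cpow_neg, e1, e2]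
      have := hw s
      field_simp
      ring
    · intro s
      simp only [qLattice, Complex.cpow_neg, e1, e2, eval_mul, eval_sub, eval_pow, eval_C, eval_X]
      have := hw s
      field_simp
      ring
  | quad c₄ c₅ c₆ hc =>
    refine exists_lattice_ops _ 1 (c₄ / 4) (C c₄ * (X - C c₆) + C (c₅ ^ 2 / 4)) ?_ ?_
    · intro s
      simp only [quadLattice]
      ring
    · intro s
      simp only [quadLattice, eval_add, eval_mul, eval_sub, eval_C, eval_X]
      ring

theorem IsLattice.existsUnique_xDeriv {x : ℂ → ℂ} (hx : IsLattice x) :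
    ∃! D : ℂ[X] →ₗ[ℂ] ℂ[X], IsXDeriv x D := by
  obtain ⟨D, _, hD, _⟩ := hx.exists_ops
  refine ⟨D, hD, fun D' hD' => LinearMap.ext fun f => hx.poly_ext fun s hs => ?_⟩
  rw [hD f s hs, hD' f s hs]

theorem IsLattice.existsUnique_xAver {x : ℂ → ℂ} (hx : IsLattice x) :
    ∃! S : ℂ[X] →ₗ[ℂ] ℂ[X], IsXAver x S := by
  obtain ⟨_, S, _, hS⟩ := hx.exists_ops
  refine ⟨S, hS, fun S' hS' => LinearMap.ext fun f => hx.poly_ext fun s _ => ?_⟩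
  rw [hS f s, hS' f s]

/-- The `x`-derivative operator `D_x` on polynomials. -/
noncomputable def xDeriv {x : ℂ → ℂ} (hx : IsLattice x) : ℂ[X] →ₗ[ℂ] ℂ[X] :=
  hx.existsUnique_xDeriv.exists.choose

/-- The `x`-average operator `S_x` on polynomials. -/
noncomputable def xAver {x : ℂ → ℂ} (hx : IsLattice x) : ℂ[X] →ₗ[ℂ] ℂ[X] :=
  hx.existsUnique_xAver.exists.choose

theorem xDeriv_spec {x : ℂ → ℂ} (hx : IsLattice x) : IsXDeriv x (xDeriv hx) :=
  hx.existsUnique_xDeriv.exists.choose_spec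

theorem xAver_spec {x : ℂ → ℂ} (hx : IsLattice x) : IsXAver x (xAver hx) :=
  hx.existsUnique_xAver.exists.choose_spec

/-! ### Functionals on polynomials -/

/-- Left multiplication of a functional by a polynomial: `⟨g u, f⟩ = ⟨u, g f⟩`. -/
noncomputable def polyMul (g : ℂ[X]) (u : Module.Dual ℂ ℂ[X]) : Module.Dual ℂ ℂ[X] :=
  u ∘ₗ LinearMap.mulLeft ℂ g

/-- The `x`-derivative of a functional: `⟨D_x u, f⟩ = -⟨u, D_x f⟩`. -/
noncomputable def dualDeriv {x : ℂ → ℂ} (hx : IsLattice x) (u : Module.Dual ℂ ℂ[X]) :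
    Module.Dual ℂ ℂ[X] :=
  -(u ∘ₗ xDeriv hx)

/-- The `x`-average of a functional: `⟨S_x u, f⟩ = ⟨u, S_x f⟩`. -/
noncomputable def dualAver {x : ℂ → ℂ} (hx : IsLattice x) (u : Module.Dual ℂ ℂ[X]) :
    Module.Dual ℂ ℂ[X] :=
  u ∘ₗ xAver hx

/-- The functional equation `D_x(φ u) = S_x(ψ u)`. -/
def GPEquation {x : ℂ → ℂ} (hx : IsLattice x) (φ ψ : ℂ[X]) (u : Module.Dual ℂ ℂ[X]) : Prop :=
  dualDeriv hx (polyMul φ u) = dualAver hx (polyMul ψ u)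

/-- `(P_n)` is an orthogonal polynomial sequence with respect to `u`. -/
def IsOPS (u : Module.Dual ℂ ℂ[X]) (P : ℕ → ℂ[X]) : Prop :=
  (∀ n, (P n).degree = n) ∧
    ∃ h : ℕ → ℂ, (∀ n, h n ≠ 0) ∧ ∀ n k, u (P n * P k) = if n = k then h n else 0

/-- `(P_n)` is a monic orthogonal polynomial sequence with respect to `u`. -/
def IsMonicOPS (u : Module.Dual ℂ ℂ[X]) (P : ℕ → ℂ[X]) : Prop :=
  IsOPS u P ∧ ∀ n, (P n).Monic

/-- A functional is regular if it has an orthogonal polynomial sequence. -/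
def IsRegularFunctional (u : Module.Dual ℂ ℂ[X]) : Prop :=
  ∃ P : ℕ → ℂ[X], IsOPS u P

/-- The recurrence `P_{n+1}(z) = (z - B_n) P_n(z) - C_n P_{n-1}(z)` for `n ≥ 0`, with
`P_{-1} = 0` and `P_0 = 1`; the value `Csucc n` is the coefficient `C_{n+1}`. -/
def SatisfiesTTRR (P : ℕ → ℂ[X]) (B Csucc : ℕ → ℂ) : Prop :=
  P 0 = 1 ∧ P 1 = X - C (B 0) ∧
    ∀ n, P (n + 2) = (X - C (B (n + 1))) * P (n + 1) - C (Csucc n) * P n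

/-! ### Askey-Wilson data -/

/-- `α_n = (q^{n/2} + q^{-n/2}) / 2`. -/
noncomputable def latAlpha (q : ℝ) (n : ℕ) : ℝ :=
  (q ^ ((n : ℝ) / 2) + q ^ (-(n : ℝ) / 2)) / 2

/-- `γ_n = (q^{n/2} - q^{-n/2}) / (q^{1/2} - q^{-1/2})`, for `q ≠ 1`. -/
noncomputable def latGamma (q : ℝ) (n : ℕ) : ℝ :=
  (q ^ ((n : ℝ) / 2) - q ^ (-(n : ℝ) / 2)) / (q ^ (1 / 2 : ℝ) - q ^ (-1 / 2 : ℝ))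

/-- `d_n = γ_n φ''/2 + α_n ψ'`, where `φ = a z² + b z + c` and `ψ = d z + e`, so that
`φ''/2 = a` and `ψ' = d`. -/
noncomputable def admCoeff (q : ℝ) (φ ψ : ℂ[X]) (n : ℕ) : ℂ :=
  (latGamma q n : ℂ) * φ.coeff 2 + (latAlpha q n : ℂ) * ψ.coeff 1

/-- The polynomial `φ` of the Askey-Wilson functional equation; `r` is a square root of
`c₁ c₂`. -/
noncomputable def awPhi (r c₃ a b c d : ℂ) : ℂ[X] :=
  C (2 * (1 + a * b * c * d)) * (X - C c₃) ^ 2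
    - C (2 * r * (a + b + c + d + a * b * c + a * b * d + a * c * d + b * c * d)) * (X - C c₃)
    + C (4 * r ^ 2 * (a * b + a * c + a * d + b * c + b * d + c * d - a * b * c * d - 1))

/-- The polynomial `ψ` of the Askey-Wilson functional equation. -/
noncomputable def awPsi (q : ℝ) (r c₃ a b c d : ℂ) : ℂ[X] :=
  C (4 * ((q ^ (1 / 2 : ℝ) : ℝ) : ℂ) / ((q : ℂ) - 1)) *
    (C (a * b * c * d - 1) * (X - C c₃)
      + C (r * (a + b + c + d - a * b * c - a * b * d - a * c * d - b * c * d)))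

/-- The quotient `(1 - p q^{n-1}) / (1 - p q^{2n-1})`, whose equal numerator and denominator
are cancelled when `n = 0`. -/
noncomputable def awRatio (q p : ℂ) (n : ℕ) : ℂ :=
  if n = 0 then 1 else (1 - p * q ^ ((n : ℤ) - 1)) / (1 - p * q ^ (2 * (n : ℤ) - 1))

/-- The coefficient `B_n` (for `a ≠ 0`). The last summand is zero for `n = 0`. -/
noncomputable def awB (q r c₃ a b c d : ℂ) (n : ℕ) : ℂ :=
  c₃ + r * (a + 1 / a
    - (1 - a * b * q ^ n) * (1 - a * c * q ^ n) * (1 - a * d * q ^ n)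
        * awRatio q (a * b * c * d) n / (a * (1 - a * b * c * d * q ^ (2 * n)))
    - a * (1 - q ^ n) * (1 - b * c * q ^ ((n : ℤ) - 1)) * (1 - b * d * q ^ ((n : ℤ) - 1))
        * (1 - c * d * q ^ ((n : ℤ) - 1))
        / ((1 - a * b * c * d * q ^ (2 * (n : ℤ) - 1))
          * (1 - a * b * c * d * q ^ (2 * (n : ℤ) - 2))))

/-- The coefficient `C_{n+1}`, as a function of `n`; `m` stands for `c₁ c₂`. -/
noncomputable def awCsucc (q m a b c d : ℂ) (n : ℕ) : ℂ :=
  m * (1 - q ^ (n + 1)) * awRatio q (a * b * c * d) n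
    * ((1 - a * b * q ^ n) * (1 - a * c * q ^ n) * (1 - a * d * q ^ n)
      * (1 - b * c * q ^ n) * (1 - b * d * q ^ n) * (1 - c * d * q ^ n))
    / ((1 - a * b * c * d * q ^ (2 * n)) ^ 2 * (1 - a * b * c * d * q ^ (2 * n + 1)))

/-- The `q`-shifted factorial `(a; q)_n`. -/
def qPoch (a q : ℂ) (n : ℕ) : ℂ := ∏ k ∈ Finset.range n, (1 - a * q ^ k)

/-- `(a e^{iθ}, a e^{-iθ}; q)_k = ∏_{j<k} (1 - 2 a q^j X + a² q^{2j})` as a polynomial in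
`X = cos θ`. -/
noncomputable def awBasis (q a : ℂ) (k : ℕ) : ℂ[X] :=
  ∏ j ∈ Finset.range k, (1 - C (2 * a * q ^ j) * X + C (a ^ 2 * q ^ (2 * j)))

/-- The monic Askey-Wilson polynomial `Q_n(X; a, b, c, d | q)` (for `a ≠ 0`):
`(ab, ac, ad; q)_n / ((2a)^n (abcd q^{n-1}; q)_n)` times the terminating series
`₄φ₃(q^{-n}, abcd q^{n-1}, a e^{iθ}, a e^{-iθ}; ab, ac, ad; q, q)`, `X = cos θ`. -/
noncomputable def awMonic (q a b c d : ℂ) (n : ℕ) : ℂ[X] :=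
  C (qPoch (a * b) q n * qPoch (a * c) q n * qPoch (a * d) q n
      / ((2 * a) ^ n * qPoch (a * b * c * d * q ^ ((n : ℤ) - 1)) q n)) *
    ∑ k ∈ Finset.range (n + 1),
      C (qPoch (q ^ (-(n : ℤ))) q k * qPoch (a * b * c * d * q ^ ((n : ℤ) - 1)) q k * q ^ k
          / (qPoch (a * b) q k * qPoch (a * c) q k * qPoch (a * d) q k * qPoch q q k)) *
        awBasis q a k

/-! ### Racah data -/

/-- The lattice `x(s) = s (s + a + b + 1)`. -/
def racahLattice (a b : ℂ) : ℂ → ℂ := fun s => s * (s + a + b + 1)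

theorem isLattice_racah (a b : ℂ) : IsLattice (racahLattice a b) := by
  have : racahLattice a b = quadLattice 1 (a + b + 1) 0 := by
    funext s; simp only [racahLattice, quadLattice]; ring
  rw [this]
  exact IsLattice.quad _ _ _ (by simp)

/-- The polynomial `φ` of the Racah functional equation. -/
noncomputable def racahPhi (a b c d : ℂ) : ℂ[X] :=
  C 2 * X ^ 2
    + C ((a + b + 2 * c + 3) * d + c * (a - b + 3) + 2 * (a + b + a * b + 2)) * X
    + C ((1 + a) * (1 + d) * (a + b + 1) * (b + c + 1))

/-- The polynomial `ψ` of the Racah functional equation. -/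
noncomputable def racahPsi (a b c d : ℂ) : ℂ[X] :=
  C (2 * (d + c + 2)) * X + C (2 * (1 + a) * (1 + d) * (b + c + 1))

/-- The set `{-1, -2, -3, …}` of negative integers, in `ℂ`. -/
def negInts : Set ℂ := {z | ∃ m : ℕ, z = -((m : ℂ) + 1)}

/-- The quotient `(n + s + 1) / (2n + s + 1)`, whose equal numerator and denominator are
cancelled when `n = 0`. -/
noncomputable def racahRatio (s : ℂ) (n : ℕ) : ℂ :=
  if n = 0 then 1 else (n + s + 1) / (2 * n + s + 1)

/-- The coefficient `B_n`. The second summand is zero for `n = 0`. -/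
noncomputable def racahB (a b c d : ℂ) (n : ℕ) : ℂ :=
  -((n + a + 1) * (n + d + 1) * (n + b + c + 1) * racahRatio (d + c) n / (2 * n + d + c + 2))
    - n * (n + c) * (n + d + c - a) * (n + d - b) / ((2 * n + d + c) * (2 * n + d + c + 1))

/-- The coefficient `C_{n+1}`, as a function of `n`. -/
noncomputable def racahCsucc (a b c d : ℂ) (n : ℕ) : ℂ :=
  (n + 1) * (n + a + 1) * (n + c + 1) * (n + d + 1)
    * (racahRatio (d + c) n * (n + b + c + 1) * (n + c + d - a + 1) * (n + d - b + 1)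
      / ((2 * n + d + c + 2) ^ 2 * (2 * n + d + c + 3)))

/-- `(-x)_k (x + γ + δ + 1)_k = ∏_{j<k} (j (j + γ + δ + 1) - X)` as a polynomial in
`X = x (x + γ + δ + 1)`. -/
noncomputable def racahBasis (γ δ : ℂ) (k : ℕ) : ℂ[X] :=
  ∏ j ∈ Finset.range k, (C ((j : ℂ) * (j + γ + δ + 1)) - X)

/-- The Pochhammer symbol `(a)_n = a (a + 1) ⋯ (a + n - 1)`. -/
noncomputable def poch (a : ℂ) (n : ℕ) : ℂ := (ascPochhammer ℂ n).eval a

/-- The monic Racah polynomial `R_n(X; α, β, γ, δ)`: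
`(α+1)_n (β+δ+1)_n (γ+1)_n / (n+α+β+1)_n` times the terminating series
`₄F₃(-n, n+α+β+1, -x, x+γ+δ+1; α+1, β+δ+1, γ+1; 1)`, `X = x (x + γ + δ + 1)`. -/
noncomputable def racahMonic (α β γ δ : ℂ) (n : ℕ) : ℂ[X] :=
  C (poch (α + 1) n * poch (β + δ + 1) n * poch (γ + 1) n / poch (n + α + β + 1) n) *
    ∑ k ∈ Finset.range (n + 1),
      C (poch (-(n : ℂ)) k * poch (n + α + β + 1) k
          / (poch (α + 1) k * poch (β + δ + 1) k * poch (γ + 1) k * (k.factorial : ℂ))) *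
        racahBasis γ δ k

/-! ### Orthogonal polynomial sequences -/

/-! Put L f = φ D f + ψ S f (`pearsonOp`). The functional equation says exactly that `u` vanishes on
the range of L. The hypergeometric series are eigenfunctions of L ∘ D: the operator D turns a basis
product into a multiple of the product shifted by half a step, L turns that into a combination of
two neighbouring unshifted products, and the ratio of consecutive terms of the series makes the sum
telescope. When the eigenvalue is non-zero, the series of index n ≥ 1 lies in the range of L, so `u`
kills it.

This is enough for orthogonality. If polynomials satisfy a three-term recurrence and `u` kills all
those of positive index, then u(P_n P_m) is zero for n ≠ m and u(1) C_1 ⋯ C_n for n = m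
(`apply_ttrr_mul_ttrr`). Hence a non-zero `u` is regular exactly when no C_n vanishes, and by
uniqueness its monic OPS is the one given by the recurrence.

The series may have vanishing denominators (or a = 0), whereas the recurrence coefficients, after
cancellation, make sense under the sole condition d_n ≠ 0. So the argument runs on the polynomials
`ttrr`, defined by their coefficients. They are identified with the series for generic parameters,
and the vanishing of `u` on them is obtained by a limit in which D, S and `u` stay fixed
(`apply_ttrr_eq_zero_of_tendsto`).

That regularity forces d_n ≠ 0 is `LatticeRules.admissible_of_isOPS`: if d_N = 0 ≠ d_{N+1}, then L(D
P_{N+1}) = 0, and the symmetry of L ∘ D together with the surjectivity of D yields a second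
vanishing that contradicts a leading coefficient. In the Askey-Wilson case c₁c₂ ≠ 0 is also forced:
otherwise L maps (z - c₃)^n to d_n (z - c₃)^{n+1}, and `u` would kill every multiple of z - c₃. -/

theorem IsOPS.coeff_ne_zero {u : Module.Dual ℂ ℂ[X]} {P : ℕ → ℂ[X]} (hP : IsOPS u P) (n : ℕ) :
    (P n).coeff n ≠ 0 :=
  coeff_ne_zero_of_eq_degree (hP.1 n)

/-- Subtracting the right multiple of `P n` lowers the degree. -/
theorem IsOPS.degree_sub_lt {u : Module.Dual ℂ ℂ[X]} {P : ℕ → ℂ[X]} (hP : IsOPS u P) {n : ℕ}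
    {f : ℂ[X]} (hf : f.degree ≤ n) :
    (f - C (f.coeff n / (P n).coeff n) * P n).degree < n := by
  rw [degree_lt_iff_coeff_zero]
  intro m hm
  rcases hm.eq_or_lt with rfl | hm
  · have := hP.coeff_ne_zero n
    simp only [coeff_sub, coeff_C_mul]
    field_simp
    ring
  · have h1 : f.coeff m = 0 :=
      coeff_eq_zero_of_degree_lt (hf.trans_lt (by exact_mod_cast hm))
    have h2 : (P n).coeff m = 0 :=
      coeff_eq_zero_of_degree_lt ((hP.1 n).le.trans_lt (by exact_mod_cast hm))
    simp [h1, h2]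

/-- Leading terms of `f` are peeled off one at a time as multiples of some `P m` with m < n, so only
off-diagonal values of `u` occur. -/
theorem IsOPS.apply_mul_of_degree_lt {u : Module.Dual ℂ ℂ[X]} {P : ℕ → ℂ[X]} (hP : IsOPS u P)
    {n : ℕ} {f : ℂ[X]} (hf : f.degree < n) : u (f * P n) = 0 := by
  obtain ⟨h, -, hh⟩ := hP.2
  have key : ∀ m ≤ n, ∀ f : ℂ[X], f.degree < m → u (f * P n) = 0 := by
    intro m
    induction m with
    | zero =>
      intro _ f hf
      have : f = 0 := by simpa using hf
      simp [this]
    | succ m ih =>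
      intro hm f hf
      have hf' : f.degree ≤ m := by
        rcases eq_or_ne f 0 with rfl | h0
        · simp
        · rw [degree_eq_natDegree h0] at hf ⊢
          exact_mod_cast Nat.lt_succ_iff.mp (by exact_mod_cast hf)
      have e := ih (by omega) _ (hP.degree_sub_lt hf')
      rw [sub_mul, map_sub, mul_assoc, ← smul_eq_C_mul, map_smul, hh m n,
        if_neg (by omega)] at e
      simpa using e
  exact key n le_rfl f hf

theorem IsOPS.apply_mul_ne_zero {u : Module.Dual ℂ ℂ[X]} {P : ℕ → ℂ[X]} (hP : IsOPS u P)
    {n : ℕ} {f : ℂ[X]} (hf : f.degree = n) : u (f * P n) ≠ 0 := by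
  obtain ⟨h, h0, hh⟩ := hP.2
  have e := hP.apply_mul_of_degree_lt (hP.degree_sub_lt hf.le)
  rw [sub_mul, map_sub, mul_assoc, ← smul_eq_C_mul, map_smul, hh n n, if_pos rfl,
    sub_eq_zero] at e
  rw [e]
  exact mul_ne_zero (div_ne_zero (coeff_ne_zero_of_eq_degree hf) (hP.coeff_ne_zero n)) (h0 n)

/-- A regular functional is not annihilated by a non-zero polynomial. -/
theorem IsOPS.eq_zero_of_forall_apply_mul {u : Module.Dual ℂ ℂ[X]} {P : ℕ → ℂ[X]}
    (hP : IsOPS u P) {f : ℂ[X]} (hf : ∀ k ≤ f.natDegree, u (f * P k) = 0) : f = 0 := by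
  by_contra h0
  exact hP.apply_mul_ne_zero (degree_eq_natDegree h0) (hf _ le_rfl)

/-- The pairing (f, g) ↦ u(fg) is non-degenerate on polynomials of degree below `n`, so vanishing
can be tested on low degrees only. -/
theorem IsOPS.eq_zero_of_degree_lt {u : Module.Dual ℂ ℂ[X]} {P : ℕ → ℂ[X]}
    (hP : IsOPS u P) {n : ℕ} {f : ℂ[X]} (hd : f.degree < n)
    (hf : ∀ g : ℂ[X], g.degree < n → u (f * g) = 0) : f = 0 := by
  by_contra h0
  refine h0 (hP.eq_zero_of_forall_apply_mul fun k hk => hf _ ?_)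
  rw [hP.1 k]
  rw [degree_eq_natDegree h0] at hd
  exact lt_of_le_of_lt (by exact_mod_cast hk) hd

/-- The difference of two monic members of index n has degree below n and is orthogonal to
everything of degree below n. -/
theorem IsMonicOPS.unique {u : Module.Dual ℂ ℂ[X]} {P Q : ℕ → ℂ[X]} (hP : IsMonicOPS u P)
    (hQ : IsMonicOPS u Q) : P = Q := by
  funext n
  have hlt : (P n - Q n).degree < n := by
    have h := degree_sub_lt_left ((hP.1.1 n).trans (hQ.1.1 n).symm) (hP.2 n).ne_zero
      ((hP.2 n).leadingCoeff.trans (hQ.2 n).leadingCoeff.symm)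
    rwa [hP.1.1 n] at h
  refine sub_eq_zero.mp (hP.1.eq_zero_of_degree_lt hlt fun g hg => ?_)
  rw [mul_comm, mul_sub, map_sub, hP.1.apply_mul_of_degree_lt hg,
    hQ.1.apply_mul_of_degree_lt hg, sub_zero]

/-! ### Polynomials defined by a three-term recurrence -/

/-- The monic polynomials with recurrence coefficients `B n` and `C_{n+1} = Cs n`. -/
noncomputable def ttrr (B Cs : ℕ → ℂ) : ℕ → ℂ[X]
  | 0 => 1
  | 1 => X - C (B 0)
  | n + 2 => (X - C (B (n + 1))) * ttrr B Cs (n + 1) - C (Cs n) * ttrr B Cs n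

theorem satisfiesTTRR_ttrr (B Cs : ℕ → ℂ) : SatisfiesTTRR (ttrr B Cs) B Cs :=
  ⟨by rw [ttrr], by rw [ttrr], fun n => by rw [ttrr]⟩

theorem ttrr_monic_natDegree (B Cs : ℕ → ℂ) :
    ∀ n, (ttrr B Cs n).Monic ∧ (ttrr B Cs n).natDegree = n
  | 0 => by simp [ttrr]
  | 1 => by simp [ttrr, monic_X_sub_C]
  | n + 2 => by
    obtain ⟨h1, h1'⟩ := ttrr_monic_natDegree B Cs (n + 1)
    obtain ⟨h0, h0'⟩ := ttrr_monic_natDegree B Cs n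
    have hm : ((X - C (B (n + 1))) * ttrr B Cs (n + 1)).Monic := (monic_X_sub_C _).mul h1
    have hd : ((X - C (B (n + 1))) * ttrr B Cs (n + 1)).natDegree = n + 2 := by
      rw [(monic_X_sub_C _).natDegree_mul h1, h1', natDegree_X_sub_C]; omega
    have hlt : (C (Cs n) * ttrr B Cs n).degree <
        ((X - C (B (n + 1))) * ttrr B Cs (n + 1)).degree := by
      rw [degree_eq_natDegree hm.ne_zero, hd]
      refine lt_of_le_of_lt ((degree_mul_le _ _).trans (add_le_add degree_C_le degree_le_natDegree)) ?_
      rw [h0', zero_add]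
      exact_mod_cast (by omega : n < n + 2)
    rw [ttrr]
    refine ⟨hm.sub_of_left hlt, natDegree_eq_of_degree_eq_some ?_⟩
    rw [degree_sub_eq_left_of_degree_lt hlt, degree_eq_natDegree hm.ne_zero, hd]

theorem degree_ttrr (B Cs : ℕ → ℂ) (n : ℕ) : (ttrr B Cs n).degree = n := by
  rw [degree_eq_natDegree (ttrr_monic_natDegree B Cs n).1.ne_zero, (ttrr_monic_natDegree B Cs n).2]

theorem X_mul_ttrr_succ (B Cs : ℕ → ℂ) (n : ℕ) :
    X * ttrr B Cs (n + 1) =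
      ttrr B Cs (n + 2) + C (B (n + 1)) * ttrr B Cs (n + 1) + C (Cs n) * ttrr B Cs n := by
  rw [ttrr]; ring

/-- A functional annihilating the polynomials of positive index makes them orthogonal. -/
theorem apply_ttrr_mul_ttrr {u : Module.Dual ℂ ℂ[X]} {B Cs : ℕ → ℂ}
    (h : ∀ n, u (ttrr B Cs (n + 1)) = 0) : ∀ m n, u (ttrr B Cs n * ttrr B Cs m) =
      if n = m then u 1 * ∏ i ∈ Finset.range m, Cs i else 0
  | 0, n => by
    cases n with
    | zero => simp [ttrr]
    | succ n => simpa [ttrr] using h n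
  | 1, n => by
    cases n with
    | zero => simpa [ttrr] using h 0
    | succ n =>
      have e : ttrr B Cs (n + 1) * ttrr B Cs 1 = ttrr B Cs (n + 2)
          + (B (n + 1) - B 0) • ttrr B Cs (n + 1) + Cs n • ttrr B Cs n := by
        simp only [smul_eq_C_mul, C_sub]
        linear_combination ttrr B Cs (n + 1) * (by rw [ttrr] : ttrr B Cs 1 = X - C (B 0))
          + X_mul_ttrr_succ B Cs n
      rw [e, map_add, map_add, map_smul, map_smul, h (n + 1), h n]
      cases n with
      | zero => simp [ttrr, mul_comm]
      | succ n => simp [h]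
  | m + 2, n => by
    have e : ttrr B Cs n * ttrr B Cs (m + 2) = (X * ttrr B Cs n) * ttrr B Cs (m + 1)
        - B (m + 1) • (ttrr B Cs n * ttrr B Cs (m + 1))
        - Cs m • (ttrr B Cs n * ttrr B Cs m) := by
      simp only [smul_eq_C_mul]
      rw [ttrr]
      ring
    cases n with
    | zero =>
      have := h (m + 1)
      simpa [ttrr] using this
    | succ n =>
      rw [e, X_mul_ttrr_succ, add_mul, add_mul, mul_assoc, mul_assoc, ← smul_eq_C_mul,
        ← smul_eq_C_mul]
      simp only [map_add, map_sub, map_smul, apply_ttrr_mul_ttrr h (m + 1),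
        apply_ttrr_mul_ttrr h m, smul_eq_mul]
      -- The index being `n + 1`, the diagonal case is n = m + 1, where the new factor C comes from
      -- the recurrence of `X * ttrr B Cs (n + 1)`. In the cases m = n + 1 and n = m the
      -- contributions of the C's, respectively of the B's, cancel.
      by_cases h1 : n = m + 1
      · subst h1
        simp [Finset.prod_range_succ, show m + 2 ≠ m by omega]
        ring
      by_cases h2 : m = n + 1
      · subst h2
        simp [Finset.prod_range_succ, show n ≠ n + 1 + 1 by omega]
        ring
      by_cases h3 : n = m
      · subst h3
        simp
      · simp [h1, h3, show n + 1 ≠ m by omega]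

theorem isMonicOPS_ttrr {u : Module.Dual ℂ ℂ[X]} {B Cs : ℕ → ℂ}
    (h : ∀ n, u (ttrr B Cs (n + 1)) = 0) (h1 : u 1 ≠ 0) (hC : ∀ n, Cs n ≠ 0) :
    IsMonicOPS u (ttrr B Cs) :=
  ⟨⟨degree_ttrr B Cs, fun n => u 1 * ∏ i ∈ Finset.range n, Cs i,
    fun _ => mul_ne_zero h1 (Finset.prod_ne_zero_iff.mpr fun i _ => hC i), fun n m => by
      rw [apply_ttrr_mul_ttrr h]; split_ifs with e <;> simp [e]⟩,
    fun n => (ttrr_monic_natDegree B Cs n).1⟩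

/-- If C_{n+1} = 0, the polynomial of index n + 1 is orthogonal to itself as well, hence to all
polynomials of degree at most n + 1. A regular functional allows this only for the zero polynomial.
-/
theorem Csucc_ne_zero_of_isOPS {u : Module.Dual ℂ ℂ[X]} {B Cs : ℕ → ℂ}
    (h : ∀ n, u (ttrr B Cs (n + 1)) = 0) {P : ℕ → ℂ[X]} (hP : IsOPS u P) (n : ℕ) :
    Cs n ≠ 0 := by
  intro h0
  have hspan : ∀ k ≤ n + 1, ∀ f : ℂ[X], f.degree ≤ k → u (ttrr B Cs (n + 1) * f) = 0 := by
    intro k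
    induction k with
    | zero =>
      intro _ f hf
      rw [eq_C_of_degree_le_zero hf, mul_comm, ← smul_eq_C_mul, map_smul, h, smul_zero]
    | succ k ih =>
      intro hk f hf
      have hlt : (f - C (f.coeff (k + 1)) * ttrr B Cs (k + 1)).degree ≤ k := by
        rw [degree_le_iff_coeff_zero]
        intro m hm
        have hm : k < m := by exact_mod_cast hm
        rcases (Nat.succ_le_of_lt hm).eq_or_lt with rfl | hm
        · have h1 := (ttrr_monic_natDegree B Cs (k + 1)).1.coeff_natDegree
          rw [(ttrr_monic_natDegree B Cs (k + 1)).2] at h1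
          simp [coeff_C_mul, h1]
        · have h1 : f.coeff m = 0 :=
            coeff_eq_zero_of_degree_lt (hf.trans_lt (by exact_mod_cast hm))
          have h2 : (ttrr B Cs (k + 1)).coeff m = 0 :=
            coeff_eq_zero_of_degree_lt ((degree_ttrr B Cs _).le.trans_lt (by exact_mod_cast hm))
          simp [h1, h2]
      have e := ih (by omega) _ hlt
      rw [mul_sub, mul_left_comm, ← smul_eq_C_mul, map_sub, map_smul,
        apply_ttrr_mul_ttrr h] at e
      have : (if n + 1 = k + 1 then u 1 * ∏ i ∈ Finset.range (k + 1), Cs i else 0) = 0 := by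
        split_ifs with hnk
        · obtain rfl : n = k := by omega
          rw [Finset.prod_range_succ, h0, mul_zero, mul_zero]
        · rfl
      rw [this] at e
      simpa using e
  refine (ttrr_monic_natDegree B Cs (n + 1)).1.ne_zero
    (hP.eq_zero_of_forall_apply_mul fun k hk => hspan k ?_ _ (hP.1 k).le)
  rwa [(ttrr_monic_natDegree B Cs (n + 1)).2] at hk

/-- A non-zero functional annihilating the `ttrr` of positive index does not annihilate `1`. -/
theorem apply_one_ne_zero {u : Module.Dual ℂ ℂ[X]} {B Cs : ℕ → ℂ}
    (h : ∀ n, u (ttrr B Cs (n + 1)) = 0) (hu : u ≠ 0) : u 1 ≠ 0 := by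
  intro h1
  apply hu
  have hall : ∀ n, u (ttrr B Cs n) = 0 := fun n => by
    cases n with
    | zero => rw [ttrr, h1]
    | succ n => exact h n
  have key : ∀ k : ℕ, ∀ f : ℂ[X], f.degree < k → u f = 0 := by
    intro k
    induction k with
    | zero =>
      intro f hf
      have : f = 0 := by simpa using hf
      simp [this]
    | succ k ih =>
      intro f hf
      have hf' : f.degree ≤ k := by
        rcases eq_or_ne f 0 with rfl | h0
        · simp
        · rw [degree_eq_natDegree h0] at hf ⊢
          exact_mod_cast Nat.lt_succ_iff.mp (by exact_mod_cast hf)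
      have hlt : (f - C (f.coeff k) * ttrr B Cs k).degree < k := by
        rw [degree_lt_iff_coeff_zero]
        intro m hm
        rcases hm.eq_or_lt with rfl | hm
        · have h1 := (ttrr_monic_natDegree B Cs k).1.coeff_natDegree
          rw [(ttrr_monic_natDegree B Cs k).2] at h1
          simp [coeff_C_mul, h1]
        · have h1 : f.coeff m = 0 :=
            coeff_eq_zero_of_degree_lt (hf'.trans_lt (by exact_mod_cast hm))
          have h2 : (ttrr B Cs k).coeff m = 0 :=
            coeff_eq_zero_of_degree_lt ((degree_ttrr B Cs _).le.trans_lt (by exact_mod_cast hm))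
          simp [h1, h2]
      have e := ih _ hlt
      rw [map_sub, ← smul_eq_C_mul, map_smul, hall] at e
      simpa using e
  refine LinearMap.ext fun f => key (f.natDegree + 1) f ?_
  exact lt_of_le_of_lt degree_le_natDegree (by exact_mod_cast Nat.lt_succ_self _)

/-- The `ttrr` polynomials depend continuously on the recurrence coefficients. -/
theorem tendsto_ttrr {ι : Type*} {l : Filter ι} {B Cs : ι → ℕ → ℂ} {B₀ C₀ : ℕ → ℂ}
    (hB : ∀ n, Tendsto (fun t => B t n) l (𝓝 (B₀ n)))
    (hC : ∀ n, Tendsto (fun t => Cs t n) l (𝓝 (C₀ n))) :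
    ∀ (n : ℕ) (v : ℂ[X] →ₗ[ℂ] ℂ),
      Tendsto (fun t => v (ttrr (B t) (Cs t) n)) l (𝓝 (v (ttrr B₀ C₀ n)))
  | 0, v => by simpa [ttrr] using tendsto_const_nhds
  | 1, v => by
    have e : ∀ b : ℂ, v (X - C b) = v X - b * v 1 := fun b => by
      rw [map_sub, ← mul_one (C b), ← smul_eq_C_mul, map_smul, smul_eq_mul]
    simp only [ttrr, e]
    exact tendsto_const_nhds.sub ((hB 0).mul tendsto_const_nhds)
  | n + 2, v => by
    have e : ∀ (b c : ℂ) (f g : ℂ[X]), v ((X - C b) * f - C c * g) =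
        (v ∘ₗ LinearMap.mulLeft ℂ X) f - b * v f - c * v g := fun b c f g => by
      rw [sub_mul, map_sub, map_sub, ← smul_eq_C_mul, ← smul_eq_C_mul, map_smul, map_smul]
      rfl
    simp only [ttrr, e]
    exact ((tendsto_ttrr hB hC (n + 1) _).sub ((hB (n + 1)).mul
      (tendsto_ttrr hB hC (n + 1) v))).sub ((hC n).mul (tendsto_ttrr hB hC n v))

/-! ### Algebraic rules for the lattice operators -/

/-- The rules by which the divided difference and averaging operators of a lattice with
`x(s+1/2) + x(s-1/2) = 2 (α x(s) + β)` act on products with `X`. -/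
structure LatticeRules (D S : ℂ[X] →ₗ[ℂ] ℂ[X]) (α β δ : ℂ) : Prop where
  D_one : D 1 = 0
  S_one : S 1 = 1
  D_X_mul : ∀ f, D (X * f) = (C α * X + C β) * D f + S f
  S_X_mul : ∀ f, S (X * f) =
    (C (α ^ 2 - 1) * X ^ 2 + C (2 * β * (α + 1)) * X + C δ) * D f + (C α * X + C β) * S f

/-- αx + β is the mean of the neighbours p, m = x(s ± 1/2), and the quadratic expression is the
square of half their difference. The rules are p f(p) - m f(m) = mean · (f(p) - f(m)) + (p - m) ·
average of f, and its analogue for p f(p) + m f(m). -/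
theorem IsLattice.latticeRules {x : ℂ → ℂ} (hx : IsLattice x) (α β δ : ℂ)
    (h1 : ∀ s, x (s + 1 / 2) + x (s - 1 / 2) = 2 * (α * x s + β))
    (h2 : ∀ s, (x (s + 1 / 2) - x (s - 1 / 2)) ^ 2 =
      4 * ((α ^ 2 - 1) * x s ^ 2 + 2 * β * (α + 1) * x s + δ)) :
    LatticeRules (xDeriv hx) (xAver hx) α β δ := by
  refine ⟨hx.poly_ext fun s hs => ?_, hx.poly_ext fun s hs => ?_,
    fun f => hx.poly_ext fun s hs => ?_, fun f => hx.poly_ext fun s hs => ?_⟩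
  · rw [xDeriv_spec hx _ s hs]; simp
  · rw [xAver_spec hx]; simp
  · simp only [eval_add, eval_mul, eval_C, eval_X]
    rw [xDeriv_spec hx _ s hs, xDeriv_spec hx _ s hs, xAver_spec hx]
    have e1 := h1 s
    have : x (s + 1 / 2) - x (s - 1 / 2) ≠ 0 := sub_ne_zero.mpr hs
    have e3 : α * x s + β = (x (s + 1 / 2) + x (s - 1 / 2)) / 2 := by rw [e1]; ring
    rw [e3]
    simp only [eval_mul, eval_X]
    generalize x (s + 1 / 2) = p at *
    generalize x (s - 1 / 2) = m at *
    field_simp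
    ring
  · simp only [eval_add, eval_mul, eval_C, eval_X, eval_pow]
    rw [xDeriv_spec hx _ s hs, xAver_spec hx, xAver_spec hx]
    have e1 := h1 s
    have e2 := h2 s
    have : x (s + 1 / 2) - x (s - 1 / 2) ≠ 0 := sub_ne_zero.mpr hs
    have e3 : α * x s + β = (x (s + 1 / 2) + x (s - 1 / 2)) / 2 := by rw [e1]; ring
    have e4 : (α ^ 2 - 1) * x s ^ 2 + 2 * β * (α + 1) * x s + δ =
      (x (s + 1 / 2) - x (s - 1 / 2)) ^ 2 / 4 := by rw [e2]; ring
    rw [e3, e4]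
    simp only [eval_mul, eval_X]
    generalize x (s + 1 / 2) = p at *
    generalize x (s - 1 / 2) = m at *
    field_simp
    ring

/-! ### The Pearson operator and its Leibniz rule. -/

/-- The operator `f ↦ φ D f + ψ S f`. -/
noncomputable def pearsonOp (D S : ℂ[X] →ₗ[ℂ] ℂ[X]) (φ ψ : ℂ[X]) : ℂ[X] →ₗ[ℂ] ℂ[X] :=
  LinearMap.mulLeft ℂ φ ∘ₗ D + LinearMap.mulLeft ℂ ψ ∘ₗ S

theorem pearsonOp_apply (D S : ℂ[X] →ₗ[ℂ] ℂ[X]) (φ ψ f : ℂ[X]) :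
    pearsonOp D S φ ψ f = φ * D f + ψ * S f := rfl

theorem GPEquation.apply_pearsonOp {x : ℂ → ℂ} {hx : IsLattice x} {φ ψ : ℂ[X]}
    {u : Module.Dual ℂ ℂ[X]} (h : GPEquation hx φ ψ u) (f : ℂ[X]) :
    u (pearsonOp (xDeriv hx) (xAver hx) φ ψ f) = 0 := by
  have := LinearMap.congr_fun h f
  simp only [dualDeriv, dualAver, polyMul, LinearMap.neg_apply, LinearMap.comp_apply,
    LinearMap.mulLeft_apply] at this
  rw [pearsonOp_apply, map_add, ← this, add_neg_cancel]

namespace LatticeRules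

variable {D S : ℂ[X] →ₗ[ℂ] ℂ[X]} {α β δ : ℂ}

/-- Write U₁ = αX + β, U₂ for the quadratic subtracted and Λ = U₁² - U₂. On a lattice, the
neighbours of y have mean U₁(y) and product Λ(y). As z = x(s) is a neighbour of both points y = x(s
± 1/2), one gets Λ(y) - 2 z U₁(y) + z² = 0 at precisely the points where D and S evaluate. In terms
of the rules alone, this works because Λ collapses to X² - 2βX + β² - δ. -/
theorem quadratic_rule_D (hR : LatticeRules D S α β δ) (m : ℂ[X]) :
    D (((C α * X + C β) ^ 2 - (C (α ^ 2 - 1) * X ^ 2 + C (2 * β * (α + 1)) * X + C δ)) * m) =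
      2 * X * D ((C α * X + C β) * m) - X ^ 2 * D m := by
  have e1 : ((C α * X + C β) ^ 2 - (C (α ^ 2 - 1) * X ^ 2 + C (2 * β * (α + 1)) * X + C δ)) * m
      = X * (X * m) - (2 * β) • (X * m) + (β ^ 2 - δ) • m := by
    simp only [smul_eq_C_mul, C_sub, C_mul, C_add, C_pow, C_1, C_ofNat]; ring
  have e2 : (C α * X + C β) * m = α • (X * m) + β • m := by
    simp only [smul_eq_C_mul]; ring
  rw [e1, e2]
  rw [map_add, map_sub, map_add]
  simp only [map_smul, hR.D_X_mul, hR.S_X_mul]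
  simp only [smul_eq_C_mul, C_sub, C_mul, C_add, C_pow, C_1, C_ofNat]
  ring

theorem quadratic_rule_S (hR : LatticeRules D S α β δ) (m : ℂ[X]) :
    S (((C α * X + C β) ^ 2 - (C (α ^ 2 - 1) * X ^ 2 + C (2 * β * (α + 1)) * X + C δ)) * m) =
      2 * X * S ((C α * X + C β) * m) - X ^ 2 * S m := by
  have e1 : ((C α * X + C β) ^ 2 - (C (α ^ 2 - 1) * X ^ 2 + C (2 * β * (α + 1)) * X + C δ)) * m
      = X * (X * m) - (2 * β) • (X * m) + (β ^ 2 - δ) • m := by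
    simp only [smul_eq_C_mul, C_sub, C_mul, C_add, C_pow, C_1, C_ofNat]; ring
  have e2 : (C α * X + C β) * m = α • (X * m) + β • m := by
    simp only [smul_eq_C_mul]; ring
  rw [e1, e2]
  rw [map_add, map_sub, map_add]
  simp only [map_smul, hR.D_X_mul, hR.S_X_mul]
  simp only [smul_eq_C_mul, C_sub, C_mul, C_add, C_pow, C_1, C_ofNat]
  ring

theorem quadratic_rule (hR : LatticeRules D S α β δ) (φ ψ m : ℂ[X]) :
    pearsonOp D S φ ψ (((C α * X + C β) ^ 2
        - (C (α ^ 2 - 1) * X ^ 2 + C (2 * β * (α + 1)) * X + C δ)) * m) =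
      2 * X * pearsonOp D S φ ψ ((C α * X + C β) * m) - X ^ 2 * pearsonOp D S φ ψ m := by
  simp only [pearsonOp_apply, hR.quadratic_rule_D, hR.quadratic_rule_S]
  ring

/-- A Leibniz rule: multiplication by `g` moved inside `f ↦ φ D f + ψ S f`. -/
theorem pearsonOp_mul (hR : LatticeRules D S α β δ) (φ ψ g k : ℂ[X]) :
    pearsonOp D S φ ψ k * g = pearsonOp D S φ ψ (k * (S g - (C α * X + C β) * D g)) +
      X * pearsonOp D S φ ψ (k * D g) := by
  induction g using Polynomial.induction_on' generalizing k with
  | add g g' hg hg' =>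
    have e : k * (S (g + g') - (C α * X + C β) * D (g + g')) =
      k * (S g - (C α * X + C β) * D g) + k * (S g' - (C α * X + C β) * D g') := by
      simp only [map_add]; ring
    rw [mul_add, hg, hg', e, map_add D, mul_add, map_add, map_add]
    ring
  | monomial n a =>
    rw [← C_mul_X_pow_eq_monomial, ← smul_eq_C_mul]
    suffices h : ∀ k, pearsonOp D S φ ψ k * X ^ n =
        pearsonOp D S φ ψ (k * (S (X ^ n) - (C α * X + C β) * D (X ^ n))) +
          X * pearsonOp D S φ ψ (k * D (X ^ n)) by
      have e : k * (S (a • X ^ n) - (C α * X + C β) * D (a • X ^ n)) =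
          a • (k * (S (X ^ n) - (C α * X + C β) * D (X ^ n))) := by
        rw [map_smul, map_smul, smul_eq_C_mul, smul_eq_C_mul, smul_eq_C_mul]; ring
      rw [e, map_smul D, mul_smul_comm, mul_smul_comm, map_smul, map_smul, mul_smul_comm, h,
        smul_add]
    induction n with
    | zero => intro k; simp [hR.D_one, hR.S_one]
    | succ n ih =>
      intro k
      -- With U₁ = αX + β, the step from X^n to X^{n+1} replaces the pair (S - U₁D, D) by (-ΛD, 2U₁D
      -- + (S - U₁D)), where Λ = U₁² - U₂. Then `quadratic_rule` trades the Λ-term for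
      -- multiplication by X outside the operator.
      have e1 : k * (S (X ^ (n + 1)) - (C α * X + C β) * D (X ^ (n + 1))) =
          -(((C α * X + C β) ^ 2 - (C (α ^ 2 - 1) * X ^ 2 + C (2 * β * (α + 1)) * X + C δ))
            * (k * D (X ^ n))) := by
        rw [pow_succ', hR.D_X_mul, hR.S_X_mul]; ring
      have e2 : k * D (X ^ (n + 1)) = (C α * X + C β) * (k * D (X ^ n)) * 2
          + k * (S (X ^ n) - (C α * X + C β) * D (X ^ n)) := by
        rw [pow_succ', hR.D_X_mul]; ring
      rw [e1, e2, map_neg, hR.quadratic_rule, mul_two, map_add, map_add, pow_succ', mul_left_comm,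
        ih k]
      ring

/-! ### Leading coefficients -/

/-- `γ` and `A` are fixed by the recursion that the top coefficients of `D_X_mul` and `S_X_mul`
impose. Keeping them abstract serves both lattices: hyperbolic expressions in q^{n/2} for one, γ_n =
n and A_n = 1 for the other. -/
theorem natDegree_X_pow (hR : LatticeRules D S α β δ) {γ A : ℕ → ℂ} (hγ0 : γ 0 = 0)
    (hA0 : A 0 = 1) (hγ : ∀ n, γ (n + 1) = α * γ n + A n)
    (hA : ∀ n, A (n + 1) = (α ^ 2 - 1) * γ n + α * A n) (n : ℕ) :
    ((D (X ^ (n + 1))).natDegree ≤ n ∧ (D (X ^ (n + 1))).coeff n = γ (n + 1)) ∧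
      ((S (X ^ (n + 1))).natDegree ≤ n + 1 ∧ (S (X ^ (n + 1))).coeff (n + 1) = A (n + 1)) := by
  have hl : ∀ (f : ℂ[X]) (m : ℕ), f.natDegree ≤ m → ((C α * X + C β) * f).natDegree ≤ m + 1 ∧
      ((C α * X + C β) * f).coeff (m + 1) = α * f.coeff m := by
    intro f m hf
    have hd : (C α * X + C β).natDegree ≤ 1 := by compute_degree
    refine ⟨(natDegree_mul_le_of_le hd hf).trans (by omega), ?_⟩
    rw [add_comm m 1, coeff_mul_add_eq_of_natDegree_le hd hf]
    simp
  have hU : ∀ (f : ℂ[X]) (m : ℕ), f.natDegree ≤ m →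
      ((C (α ^ 2 - 1) * X ^ 2 + C (2 * β * (α + 1)) * X + C δ) * f).natDegree ≤ m + 2 ∧
      ((C (α ^ 2 - 1) * X ^ 2 + C (2 * β * (α + 1)) * X + C δ) * f).coeff (m + 2) =
        (α ^ 2 - 1) * f.coeff m := by
    intro f m hf
    have hd : (C (α ^ 2 - 1) * X ^ 2 + C (2 * β * (α + 1)) * X + C δ).natDegree ≤ 2 := by
      compute_degree
    refine ⟨(natDegree_mul_le_of_le hd hf).trans (by omega), ?_⟩
    rw [add_comm m 2, coeff_mul_add_eq_of_natDegree_le hd hf]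
    generalize α ^ 2 - 1 = κ
    generalize 2 * β * (α + 1) = κ'
    simp
  induction n with
  | zero =>
    have hD1 := hR.D_X_mul 1
    have hS1 := hR.S_X_mul 1
    rw [mul_one, hR.D_one, hR.S_one, mul_zero, zero_add, mul_one] at hS1
    rw [mul_one, hR.D_one, hR.S_one, mul_zero, zero_add] at hD1
    have hd : (C α * X).natDegree ≤ 1 := by compute_degree
    simp [hD1, hS1, hγ, hγ0, hA, hA0, hd]
  | succ n ih =>
    obtain ⟨⟨hd, hdc⟩, hs, hsc⟩ := ih
    obtain ⟨h1, h2⟩ := hl _ _ hd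
    obtain ⟨h3, h4⟩ := hl _ _ hs
    obtain ⟨h5, h6⟩ := hU _ _ hd
    rw [pow_succ' X (n + 1), hR.D_X_mul, hR.S_X_mul]
    refine ⟨⟨(natDegree_add_le _ _).trans (max_le h1 hs), ?_⟩,
      (natDegree_add_le _ _).trans (max_le h5 h3), ?_⟩
    · rw [coeff_add, h2, hsc, hdc, hγ (n + 1)]
    · rw [coeff_add, h6, h4, hdc, hsc, hA (n + 1)]

/-- The operator `φ D + ψ S` raises the degree by one, and `γ_n φ₂ + A_n ψ₁` is its
leading coefficient on `X ^ n`. -/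
theorem pearsonOp_X_pow (hR : LatticeRules D S α β δ) {γ A : ℕ → ℂ} (hγ0 : γ 0 = 0)
    (hA0 : A 0 = 1) (hγ : ∀ n, γ (n + 1) = α * γ n + A n)
    (hA : ∀ n, A (n + 1) = (α ^ 2 - 1) * γ n + α * A n) {φ ψ : ℂ[X]} (hφ : φ.natDegree ≤ 2)
    (hψ : ψ.natDegree ≤ 1) (n : ℕ) :
    (pearsonOp D S φ ψ (X ^ n)).natDegree ≤ n + 1 ∧
      (pearsonOp D S φ ψ (X ^ n)).coeff (n + 1) = γ n * φ.coeff 2 + A n * ψ.coeff 1 := by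
  rw [pearsonOp_apply]
  rcases n with _ | n
  · simpa [hR.D_one, hR.S_one, hγ0, hA0] using hψ
  · obtain ⟨⟨hd, hdc⟩, hs, hsc⟩ := hR.natDegree_X_pow hγ0 hA0 hγ hA n
    refine ⟨(natDegree_add_le _ _).trans (max_le ((natDegree_mul_le_of_le hφ hd).trans (by omega))
      ((natDegree_mul_le_of_le hψ hs).trans (by omega))), ?_⟩
    rw [coeff_add, show n + 1 + 1 = 2 + n by ring, coeff_mul_add_eq_of_natDegree_le hφ hd,
      show 2 + n = 1 + (n + 1) by ring, coeff_mul_add_eq_of_natDegree_le hψ hs, hdc, hsc]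
    ring

end LatticeRules

/-- A linear map on polynomials which changes degrees by a fixed amount has the expected
leading coefficients. -/
theorem natDegree_linearMap_le (T : ℂ[X] →ₗ[ℂ] ℂ[X]) (e : ℕ → ℕ) (he : Monotone e)
    (hT : ∀ n, (T (X ^ n)).natDegree ≤ e n) {f : ℂ[X]} {n : ℕ} (hf : f.natDegree ≤ n) :
    (T f).natDegree ≤ e n := by
  rw [as_sum_range_C_mul_X_pow' f (Nat.lt_succ_of_le hf), map_sum]
  refine natDegree_sum_le_of_forall_le _ _ fun i hi => ?_
  rw [← smul_eq_C_mul, map_smul]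
  exact (natDegree_smul_le _ _).trans ((hT i).trans (he (by simp at hi; omega)))

theorem coeff_linearMap (T : ℂ[X] →ₗ[ℂ] ℂ[X]) {n m : ℕ}
    (hT : ∀ i < n, (T (X ^ i)).coeff m = 0) {f : ℂ[X]} (hf : f.natDegree ≤ n) :
    (T f).coeff m = f.coeff n * (T (X ^ n)).coeff m := by
  conv_lhs => rw [as_sum_range_C_mul_X_pow' f (Nat.lt_succ_of_le hf), map_sum]
  rw [finsetSum_coeff, Finset.sum_range_succ, Finset.sum_eq_zero, zero_add]
  · rw [← smul_eq_C_mul, map_smul, coeff_smul, smul_eq_mul]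
  · intro i hi
    rw [← smul_eq_C_mul, map_smul, coeff_smul, hT i (by simpa using hi), smul_zero]

namespace LatticeRules

variable {D S : ℂ[X] →ₗ[ℂ] ℂ[X]} {α β δ : ℂ}

theorem D_coeff (hR : LatticeRules D S α β δ) {γ A : ℕ → ℂ} (hγ0 : γ 0 = 0)
    (hA0 : A 0 = 1) (hγ : ∀ n, γ (n + 1) = α * γ n + A n)
    (hA : ∀ n, A (n + 1) = (α ^ 2 - 1) * γ n + α * A n) {f : ℂ[X]} {n : ℕ}
    (hf : f.natDegree ≤ n + 1) :
    (D f).natDegree ≤ n ∧ (D f).coeff n = f.coeff (n + 1) * γ (n + 1) := by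
  have key : ∀ i, (D (X ^ i)).natDegree ≤ i - 1 := fun i => by
    rcases i with _ | i
    · simp [hR.D_one]
    · exact (hR.natDegree_X_pow hγ0 hA0 hγ hA i).1.1
  refine ⟨natDegree_linearMap_le D (fun i => i - 1) (fun a b h => by dsimp; omega) key hf, ?_⟩
  rw [coeff_linearMap D (fun i hi => ?_) hf, (hR.natDegree_X_pow hγ0 hA0 hγ hA n).1.2]
  rcases i with _ | i
  · simp [hR.D_one]
  · exact coeff_eq_zero_of_natDegree_lt ((key _).trans_lt (by omega))

theorem pearsonOp_coeff (hR : LatticeRules D S α β δ) {γ A : ℕ → ℂ} (hγ0 : γ 0 = 0)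
    (hA0 : A 0 = 1) (hγ : ∀ n, γ (n + 1) = α * γ n + A n)
    (hA : ∀ n, A (n + 1) = (α ^ 2 - 1) * γ n + α * A n) {φ ψ : ℂ[X]} (hφ : φ.natDegree ≤ 2)
    (hψ : ψ.natDegree ≤ 1) {f : ℂ[X]} {n : ℕ} (hf : f.natDegree ≤ n) :
    (pearsonOp D S φ ψ f).natDegree ≤ n + 1 ∧ (pearsonOp D S φ ψ f).coeff (n + 1) =
      f.coeff n * (γ n * φ.coeff 2 + A n * ψ.coeff 1) := by
  have key := hR.pearsonOp_X_pow hγ0 hA0 hγ hA hφ hψ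
  refine ⟨natDegree_linearMap_le _ (fun i => i + 1) (fun a b h => by dsimp; omega)
    (fun i => (key i).1) hf, ?_⟩
  rw [coeff_linearMap _ (fun i hi => ?_) hf, (key n).2]
  exact coeff_eq_zero_of_natDegree_lt ((key i).1.trans_lt (by omega))

/-- D lowers the degree by exactly one because no γ_{n+1} vanishes, so preimages are built from the
leading term downwards. -/
theorem D_surjective (hR : LatticeRules D S α β δ) {γ A : ℕ → ℂ} (hγ0 : γ 0 = 0)
    (hA0 : A 0 = 1) (hγ : ∀ n, γ (n + 1) = α * γ n + A n)
    (hA : ∀ n, A (n + 1) = (α ^ 2 - 1) * γ n + α * A n) (hγne : ∀ n, γ (n + 1) ≠ 0) :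
    Function.Surjective D := by
  have key : ∀ n : ℕ, ∀ f : ℂ[X], f.degree < n → ∃ h, D h = f := by
    intro n
    induction n with
    | zero =>
      intro f hf
      have : f = 0 := by simpa using hf
      exact ⟨0, by simp [this]⟩
    | succ n ih =>
      intro f hf
      obtain ⟨h1, h2⟩ := (hR.natDegree_X_pow hγ0 hA0 hγ hA n).1
      obtain ⟨h, hh⟩ := ih (f - D ((f.coeff n / γ (n + 1)) • X ^ (n + 1))) (by
        rw [degree_lt_iff_coeff_zero]
        intro m hm
        rw [map_smul, coeff_sub, coeff_smul, smul_eq_mul]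
        rcases hm.eq_or_lt with rfl | hm
        · rw [h2, div_mul_cancel₀ _ (hγne _), sub_self]
        · rw [coeff_eq_zero_of_natDegree_lt (h1.trans_lt hm), mul_zero, sub_zero]
          exact coeff_eq_zero_of_degree_lt (hf.trans_le (by exact_mod_cast hm)))
      exact ⟨h + (f.coeff n / γ (n + 1)) • X ^ (n + 1), by rw [map_add, hh, sub_add_cancel]⟩
  exact fun f => key (f.natDegree + 1) f
    (lt_of_le_of_lt degree_le_natDegree (by exact_mod_cast Nat.lt_succ_self _))

/-! ### Symmetry of the second order operator and admissibility. -/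

/-- The operator `f ↦ φ D² f + ψ S D f` is symmetric for a solution of the functional equation. -/
theorem apply_pearsonOp_mul (hR : LatticeRules D S α β δ) {φ ψ : ℂ[X]}
    {u : Module.Dual ℂ ℂ[X]} (hu : ∀ h, u (pearsonOp D S φ ψ h) = 0) (k g : ℂ[X]) :
    u (pearsonOp D S φ ψ k * g) = u (X * pearsonOp D S φ ψ (k * D g)) := by
  rw [hR.pearsonOp_mul, map_add, hu, zero_add]

/-- A regular solution of the functional equation is admissible. -/
theorem admissible_of_isOPS (hR : LatticeRules D S α β δ) {γ A : ℕ → ℂ} (hγ0 : γ 0 = 0)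
    (hA0 : A 0 = 1) (hγ : ∀ n, γ (n + 1) = α * γ n + A n)
    (hA : ∀ n, A (n + 1) = (α ^ 2 - 1) * γ n + α * A n) (hγne : ∀ n, γ (n + 1) ≠ 0)
    (hα : α ≠ 0) {φ ψ : ℂ[X]} (hφ : φ.natDegree ≤ 2) (hψ : ψ.natDegree ≤ 1)
    {u : Module.Dual ℂ ℂ[X]} (hu : ∀ h, u (pearsonOp D S φ ψ h) = 0) {P : ℕ → ℂ[X]}
    (hP : IsOPS u P) (N : ℕ)
    (hN : γ (N + 1) * φ.coeff 2 + A (N + 1) * ψ.coeff 1 ≠ 0) :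
    γ N * φ.coeff 2 + A N * ψ.coeff 1 ≠ 0 := by
  intro h0
  have hsurj := hR.D_surjective hγ0 hA0 hγ hA hγne
  have hPd : (P (N + 1)).natDegree ≤ N + 1 := (natDegree_eq_of_degree_eq_some (hP.1 _)).le
  obtain ⟨hp, hpc⟩ := hR.D_coeff hγ0 hA0 hγ hA hPd
  have hpne : (D (P (N + 1))).coeff N ≠ 0 := by
    rw [hpc]
    exact mul_ne_zero (hP.coeff_ne_zero _) (hγne N)
  generalize hpdef : D (P (N + 1)) = p at *
  -- The assumption d_N = 0 kills the coefficient of degree N + 1. Against g of degree at most N,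
  -- symmetry moves the operator from P_{N+1} to g, and the resulting polynomial still has degree at
  -- most N, hence is orthogonal to P_{N+1}.
  have hLp : pearsonOp D S φ ψ p = 0 := by
    refine hP.eq_zero_of_degree_lt (n := N + 1) ?_ fun g hg => ?_
    · obtain ⟨h1, h2⟩ := hR.pearsonOp_coeff hγ0 hA0 hγ hA hφ hψ hp
      rw [h0, mul_zero] at h2
      rw [degree_lt_iff_coeff_zero]
      intro m hm
      rcases hm.eq_or_lt with rfl | hm
      · exact h2
      · exact coeff_eq_zero_of_natDegree_lt (h1.trans_lt hm)
    · rw [hR.apply_pearsonOp_mul hu, mul_comm p, ← hpdef, ← hR.apply_pearsonOp_mul hu]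
      refine hP.apply_mul_of_degree_lt ?_
      rcases N with _ | N
      · have hg0 : g.degree ≤ 0 := by
          rw [degree_le_iff_coeff_zero]
          intro m hm
          exact coeff_eq_zero_of_degree_lt (hg.trans_le (by exact_mod_cast hm))
        rw [eq_C_of_degree_le_zero hg0, ← mul_one (C _), ← smul_eq_C_mul, map_smul, hR.D_one]
        simp
      · have hg0 : g.natDegree ≤ N + 1 := by
          rcases eq_or_ne g 0 with rfl | hg0
          · simp
          · rw [degree_eq_natDegree hg0] at hg
            have : g.natDegree < N + 1 + 1 := by exact_mod_cast hg
            omega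
        have h1 := (hR.D_coeff hγ0 hA0 hγ hA hg0).1
        have h2 := (hR.pearsonOp_coeff hγ0 hA0 hγ hA hφ hψ h1).1
        exact lt_of_le_of_lt degree_le_natDegree (by exact_mod_cast Nat.lt_succ_of_le h2)
  -- Every `h` is some `D g`, so the symmetry formula spreads the vanishing at `p` to all products
  -- `p * h`.
  have hX : ∀ h, u (X * pearsonOp D S φ ψ (p * h)) = 0 := by
    intro h
    obtain ⟨g, rfl⟩ := hsurj h
    rw [← hR.apply_pearsonOp_mul hu, hLp, zero_mul, map_zero]
  -- Here `h` is taken to be (αX + β) · D P_k. The factor αX + β raises the degree of `p` by one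
  -- because α ≠ 0, so the top coefficient of this vanishing polynomial is a non-zero multiple of
  -- d_{N+1}: a contradiction.
  have hz : pearsonOp D S φ ψ ((C α * X + C β) * p) = 0 := by
    refine hP.eq_zero_of_forall_apply_mul fun k _ => ?_
    rw [hR.apply_pearsonOp_mul hu, mul_comm (C α * X + C β), mul_assoc, hX]
  have hd1 : (C α * X + C β).natDegree ≤ 1 := by compute_degree
  have hd2 : ((C α * X + C β) * p).natDegree ≤ N + 1 :=
    (natDegree_mul_le_of_le hd1 hp).trans (by omega)
  have h2 := (hR.pearsonOp_coeff hγ0 hA0 hγ hA hφ hψ hd2).2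
  rw [hz, coeff_zero, add_comm N 1, coeff_mul_add_eq_of_natDegree_le hd1 hp, add_comm 1 N] at h2
  refine mul_ne_zero (mul_ne_zero ?_ hpne) hN h2.symm
  simpa using hα

end LatticeRules

/-! ### Passage to the limit, and regularity read off from the recurrence. -/

/-- Approximate eigenfunctions of `f ↦ φ D² f + ψ S D f` with non-zero limit eigenvalue are
annihilated, in the limit, by a solution of the functional equation. -/
theorem apply_ttrr_eq_zero_of_tendsto {D S : ℂ[X] →ₗ[ℂ] ℂ[X]} {u : Module.Dual ℂ ℂ[X]}
    {l : Filter ℂ} [l.NeBot] {φ ψ : ℂ → ℂ[X]} {φ₀ ψ₀ : ℂ[X]}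
    (hφ : ∀ t, (φ t).natDegree ≤ 2) (hφ₀ : φ₀.natDegree ≤ 2)
    (hψ : ∀ t, (ψ t).natDegree ≤ 1) (hψ₀ : ψ₀.natDegree ≤ 1)
    (tφ : ∀ i, Tendsto (fun t => (φ t).coeff i) l (𝓝 (φ₀.coeff i)))
    (tψ : ∀ i, Tendsto (fun t => (ψ t).coeff i) l (𝓝 (ψ₀.coeff i)))
    {B Cs : ℂ → ℕ → ℂ} {B₀ C₀ : ℕ → ℂ}
    (hB : ∀ n, Tendsto (fun t => B t n) l (𝓝 (B₀ n)))
    (hC : ∀ n, Tendsto (fun t => Cs t n) l (𝓝 (C₀ n)))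
    (hu : ∀ h, u (pearsonOp D S φ₀ ψ₀ h) = 0) {n : ℕ} {lam : ℂ → ℂ} {lam₀ : ℂ} (hlam₀ : lam₀ ≠ 0)
    (tlam : Tendsto lam l (𝓝 lam₀))
    (heig : ∀ᶠ t in l, pearsonOp D S (φ t) (ψ t) (D (ttrr (B t) (Cs t) n)) =
      C (lam t) * ttrr (B t) (Cs t) n) :
    u (ttrr B₀ C₀ n) = 0 := by
  -- The parameters enter the operator only through five coefficients, each multiplying a fixed
  -- linear functional of `f`, and `tendsto_ttrr` applies to each of these.
  have e : ∀ φ ψ f : ℂ[X], φ.natDegree ≤ 2 → ψ.natDegree ≤ 1 →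
      u (pearsonOp D S φ ψ (D f)) =
      φ.coeff 2 * (u ∘ₗ LinearMap.mulLeft ℂ (X ^ 2) ∘ₗ D ∘ₗ D) f
      + φ.coeff 1 * (u ∘ₗ LinearMap.mulLeft ℂ X ∘ₗ D ∘ₗ D) f
      + φ.coeff 0 * (u ∘ₗ D ∘ₗ D) f
      + ψ.coeff 1 * (u ∘ₗ LinearMap.mulLeft ℂ X ∘ₗ S ∘ₗ D) f
      + ψ.coeff 0 * (u ∘ₗ S ∘ₗ D) f := by
    intro φ ψ f h2 h1
    rw [pearsonOp_apply]
    conv_lhs => rw [eq_X_add_C_of_natDegree_le_one h1,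
      eq_quadratic_of_degree_le_two (natDegree_le_iff_degree_le.mp h2)]
    simp only [add_mul, ← smul_eq_C_mul, smul_mul_assoc, map_add, map_smul, smul_eq_mul,
      LinearMap.comp_apply, LinearMap.mulLeft_apply]
    ring
  have t1 : Tendsto (fun t => u (pearsonOp D S (φ t) (ψ t) (D (ttrr (B t) (Cs t) n)))) l
      (𝓝 (u (pearsonOp D S φ₀ ψ₀ (D (ttrr B₀ C₀ n))))) := by
    rw [e _ _ _ hφ₀ hψ₀]
    simp only [e _ _ _ (hφ _) (hψ _)]
    have tt := tendsto_ttrr hB hC n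
    exact (((((tφ 2).mul (tt _)).add ((tφ 1).mul (tt _))).add ((tφ 0).mul (tt _))).add
      ((tψ 1).mul (tt _))).add ((tψ 0).mul (tt _))
  have t2 : Tendsto (fun t => u (C (lam t) * ttrr (B t) (Cs t) n)) l
      (𝓝 (lam₀ * u (ttrr B₀ C₀ n))) := by
    simp only [← smul_eq_C_mul, map_smul, smul_eq_mul]
    exact tlam.mul (tendsto_ttrr hB hC n u)
  have h := tendsto_nhds_unique (t1.congr' (heig.mono fun t ht => congrArg u ht)) t2
  rw [hu] at h
  exact (mul_eq_zero.mp h.symm).resolve_left hlam₀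

/-- The squared norms are u(1) C_1 ⋯ C_n, and u(1) ≠ 0 because otherwise `u` would vanish on a
basis. -/
theorem isRegularFunctional_iff_of_ttrr {u : Module.Dual ℂ ℂ[X]} {B Cs : ℕ → ℂ}
    (h : ∀ n, u (ttrr B Cs (n + 1)) = 0) (hu : u ≠ 0) :
    IsRegularFunctional u ↔ ∀ n, Cs n ≠ 0 :=
  ⟨fun ⟨_, hP⟩ => Csucc_ne_zero_of_isOPS h hP,
    fun hC => ⟨_, (isMonicOPS_ttrr h (apply_one_ne_zero h hu) hC).1⟩⟩

theorem IsMonicOPS.eq_ttrr {u : Module.Dual ℂ ℂ[X]} {B Cs : ℕ → ℂ}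
    (h : ∀ n, u (ttrr B Cs (n + 1)) = 0) (hu : u ≠ 0) {P : ℕ → ℂ[X]} (hP : IsMonicOPS u P) :
    P = ttrr B Cs :=
  hP.unique (isMonicOPS_ttrr h (apply_one_ne_zero h hu) (Csucc_ne_zero_of_isOPS h hP.1))

/-! ### Shifted factorials -/

theorem qPoch_zero (x q : ℂ) : qPoch x q 0 = 1 := by simp [qPoch]

theorem qPoch_succ (x q : ℂ) (n : ℕ) : qPoch x q (n + 1) = qPoch x q n * (1 - x * q ^ n) := by
  simp [qPoch, Finset.prod_range_succ]

theorem qPoch_succ' (x q : ℂ) (n : ℕ) : qPoch x q (n + 1) = (1 - x) * qPoch (x * q) q n := by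
  simp only [qPoch, Finset.prod_range_succ', pow_zero, mul_one]
  rw [mul_comm]
  congr 1
  exact Finset.prod_congr rfl fun i _ => by rw [pow_succ']; ring

theorem qPoch_ne_zero {x q : ℂ} {n : ℕ} (h : ∀ j < n, 1 - x * q ^ j ≠ 0) : qPoch x q n ≠ 0 :=
  Finset.prod_ne_zero_iff.mpr fun j hj => h j (by simpa using hj)

/-! ### The Askey-Wilson basis -/

/-- `∏_{j<k} (1 - 2 a q^j X + a² q^{2j})` with `X = (z - c₃) / (2 r)`. -/
noncomputable def awShiftedBasis (q r c₃ a : ℂ) (k : ℕ) : ℂ[X] :=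
  ∏ j ∈ Finset.range k, (C (1 + a ^ 2 * q ^ (2 * j)) - C (a * q ^ j / r) * (X - C c₃))

theorem awShiftedBasis_succ (q r c₃ a : ℂ) (k : ℕ) : awShiftedBasis q r c₃ a (k + 1) =
    awShiftedBasis q r c₃ a k * (C (1 + a ^ 2 * q ^ (2 * k)) - C (a * q ^ k / r) * (X - C c₃)) :=
  Finset.prod_range_succ _ _

/-- Each factor splits as (1 - a w q^j)(1 - a q^j / w) at z = c₃ + r(w + 1/w). For this reason the
identities are checked in the variable w. -/
theorem eval_awShiftedBasis {q r c₃ a w : ℂ} (hr : r ≠ 0) (hw : w ≠ 0) (k : ℕ) :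
    (awShiftedBasis q r c₃ a k).eval (c₃ + r * (w + 1 / w)) =
      qPoch (a * w) q k * qPoch (a / w) q k := by
  simp only [awShiftedBasis, qPoch, eval_prod, ← Finset.prod_mul_distrib]
  refine Finset.prod_congr rfl fun j _ => ?_
  simp only [eval_sub, eval_mul, eval_C, eval_X]
  field_simp
  ring

/-- Divided difference and averaging operators of the lattice `c₃ + r (w + 1/w)`, with
`w ↦ w t` as the half-step. -/
structure IsAWOps (D S : ℂ[X] →ₗ[ℂ] ℂ[X]) (q t r c₃ : ℂ) : Prop where
  t_sq : t ^ 2 = q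
  t_ne : t ≠ 0
  r_ne : r ≠ 0
  q_pow : ∀ n, q ^ (n + 1) ≠ 1
  D_eval : ∀ (f : ℂ[X]) (w : ℂ), w ≠ 0 → w ^ 2 ≠ 1 → (D f).eval (c₃ + r * (w + 1 / w)) =
    (f.eval (c₃ + r * (w * t + 1 / (w * t))) - f.eval (c₃ + r * (w / t + 1 / (w / t)))) /
      (r * (t - 1 / t) * (w - 1 / w))
  S_eval : ∀ (f : ℂ[X]) (w : ℂ), w ≠ 0 → (S f).eval (c₃ + r * (w + 1 / w)) =
    (f.eval (c₃ + r * (w * t + 1 / (w * t))) + f.eval (c₃ + r * (w / t + 1 / (w / t)))) / 2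
  poly_ext : ∀ f g : ℂ[X], (∀ w, w ≠ 0 → w ^ 2 ≠ 1 →
    f.eval (c₃ + r * (w + 1 / w)) = g.eval (c₃ + r * (w + 1 / w))) → f = g

namespace IsAWOps

variable {D S : ℂ[X] →ₗ[ℂ] ℂ[X]} {q t r c₃ : ℂ}

theorem q_ne (h : IsAWOps D S q t r c₃) : q ≠ 0 := h.t_sq ▸ pow_ne_zero 2 h.t_ne

theorem q_sub_one (h : IsAWOps D S q t r c₃) : q - 1 ≠ 0 :=
  sub_ne_zero.mpr (by simpa using h.q_pow 0)

theorem t_sub (h : IsAWOps D S q t r c₃) : t - 1 / t ≠ 0 := by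
  have h1 := h.q_sub_one
  have h2 := h.t_ne
  rw [← h.t_sq] at h1
  have e : t - 1 / t = (t ^ 2 - 1) / t := by field_simp
  rw [e]
  exact div_ne_zero h1 h2

/-- The values at w t and w / t share the factor (atw; q)_k (at/w; q)_k, the basis product for the
parameter a t. The remaining outer factors have a difference proportional to w - 1/w, which cancels
the denominator. -/
theorem D_basis (h : IsAWOps D S q t r c₃) (a : ℂ) (k : ℕ) :
    D (awShiftedBasis q r c₃ a (k + 1)) =
      C (a * (1 - q ^ (k + 1)) / (r * (q - 1))) * awShiftedBasis q r c₃ (a * t) k := by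
  refine h.poly_ext _ _ fun w hw hw2 => ?_
  have ht := h.t_ne
  have hr := h.r_ne
  have hw3 : w ^ 2 - 1 ≠ 0 := sub_ne_zero.mpr hw2
  have hq1 := h.q_sub_one
  have ht2 : t ^ 2 - 1 ≠ 0 := by rw [h.t_sq]; exact hq1
  rw [h.D_eval _ _ hw hw2, eval_awShiftedBasis hr (mul_ne_zero hw ht),
    eval_awShiftedBasis hr (div_ne_zero hw ht), eval_mul, eval_C, eval_awShiftedBasis hr hw]
  rw [qPoch_succ (a * (w * t)), qPoch_succ' (a / (w * t)), qPoch_succ' (a * (w / t)),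
    qPoch_succ (a / (w / t)), show a / (w * t) * q = a * t / w by rw [← h.t_sq]; field_simp,
    show a * (w / t) * q = a * t * w by rw [← h.t_sq]; field_simp,
    show a * (w * t) = a * t * w by ring, show a / (w / t) = a * t / w by field_simp]
  generalize qPoch (a * t * w) q k = U
  generalize qPoch (a * t / w) q k = V
  rw [pow_succ]
  generalize q ^ k = K
  have e1 : (1 - a * t * w * K) * (1 - a / (w * t)) - (1 - a * (w / t)) * (1 - a * t / w * K) =
      (w - 1 / w) * (a / t) * (1 - K * t ^ 2) := by
    field_simp; ring
  have e2 : U * (1 - a * t * w * K) * ((1 - a / (w * t)) * V) -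
      (1 - a * (w / t)) * U * (V * (1 - a * t / w * K)) =
      (w - 1 / w) * (a / t) * (1 - K * t ^ 2) * (U * V) := by
    linear_combination U * V * e1
  rw [e2, ← h.t_sq]
  have hw4 : w - 1 / w ≠ 0 := by
    rw [show w - 1 / w = (w ^ 2 - 1) / w by field_simp]
    exact div_ne_zero hw3 hw
  generalize w - 1 / w = W at *
  field_simp

/-- The constant `4 (1 - q^k) / ((q - 1) (t - 1/t) q^{k-1})` for `k = n + 1`. -/
noncomputable def eigenConst (q t : ℂ) (n : ℕ) : ℂ :=
  4 * (1 - q ^ (n + 1)) / ((q - 1) * (t - 1 / t) * q ^ n)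

/-- Let Π(w) = (1 - aw)(1 - bw)(1 - cw)(1 - dw) and κ = t - 1/t. On the lattice φ is 2r²(w⁻²Π(w) +
w²Π(1/w)) and ψ is (4r/κ)(w⁻²Π(w) - w²Π(1/w))/(w - 1/w). So the operator sends f to (4r/κ)(w⁻²Π(w)
f(wt) - w²Π(1/w) f(w/t))/(w - 1/w), where f is read as a function of w. The factors 1 - aw and 1 -
a/w complete the products based at a t to products based at a. -/
theorem pearsonOp_basis (h : IsAWOps D S q t r c₃) {φ ψ : ℂ[X]} {a b c d : ℂ} (ha : a ≠ 0)
    (hφ : φ = awPhi r c₃ a b c d) (hψ : ∀ z, ψ.eval z = 4 / (t - 1 / t) *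
      ((a * b * c * d - 1) * (z - c₃)
        + r * (a + b + c + d - a * b * c - a * b * d - a * c * d - b * c * d))) (k : ℕ) :
    pearsonOp D S φ ψ (awShiftedBasis q r c₃ (a * t) k) =
      C (4 * r / ((t - 1 / t) * a * q ^ k)) *
        (C (1 - a * b * c * d * q ^ k) * awShiftedBasis q r c₃ a (k + 1)
          - C ((1 - a * b * q ^ k) * (1 - a * c * q ^ k) * (1 - a * d * q ^ k))
            * awShiftedBasis q r c₃ a k) := by
  refine h.poly_ext _ _ fun w hw hw2 => ?_
  have ht := h.t_ne
  have hr := h.r_ne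
  have hq := h.q_ne
  have hw3 : w ^ 2 - 1 ≠ 0 := sub_ne_zero.mpr hw2
  have hw4 : w - 1 / w ≠ 0 := by
    rw [show w - 1 / w = (w ^ 2 - 1) / w by field_simp]
    exact div_ne_zero hw3 hw
  have hκ := h.t_sub
  rw [pearsonOp_apply, eval_add, eval_mul, eval_mul, h.D_eval _ _ hw hw2, h.S_eval _ _ hw,
    eval_awShiftedBasis hr (mul_ne_zero hw ht), eval_awShiftedBasis hr (div_ne_zero hw ht), hψ]
  simp only [eval_mul, eval_C, eval_sub, eval_awShiftedBasis hr hw]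
  rw [show a * t * (w * t) = a * w * q by rw [← h.t_sq]; ring,
    show a * t / (w * t) = a / w by field_simp, show a * t * (w / t) = a * w by field_simp,
    show a * t / (w / t) = a / w * q by rw [← h.t_sq]; field_simp]
  have hA : φ.eval (c₃ + r * (w + 1 / w)) = (w - 1 / w) * (2 * r ^ 2) *
      (2 * w⁻¹ ^ 2 * ((1 - a * w) * (1 - b * w) * (1 - c * w) * (1 - d * w)) / (w - 1 / w)
      - ((a * b * c * d - 1) * (w + 1 / w)
        + (a + b + c + d - a * b * c - a * b * d - a * c * d - b * c * d))) := by
    have g : ∀ A s : ℂ, (w - 1 / w) * (2 * r ^ 2) * (A / (w - 1 / w) - s) =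
        2 * r ^ 2 * (A - (w - 1 / w) * s) := fun A s => by
      generalize w - 1 / w = W at *
      field_simp
    subst hφ
    rw [g]
    simp only [awPhi, eval_add, eval_sub, eval_mul, eval_C, eval_X, eval_pow]
    field_simp
    ring
  have hU : qPoch (a * w * q) q k * (1 - a * w) = qPoch (a * w) q k * (1 - a * w * q ^ k) := by
    rw [mul_comm, ← qPoch_succ', qPoch_succ]
  have hV : qPoch (a / w * q) q k * (1 - a / w) = qPoch (a / w) q k * (1 - a / w * q ^ k) := by
    rw [mul_comm, ← qPoch_succ', qPoch_succ]
  rw [hA, qPoch_succ, qPoch_succ]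
  generalize qPoch (a * w * q) q k = U' at *
  generalize qPoch (a / w * q) q k = V' at *
  generalize qPoch (a * w) q k = U at *
  generalize qPoch (a / w) q k = V at *
  have hK : q ^ k ≠ 0 := pow_ne_zero _ hq
  generalize q ^ k = K at *
  generalize t - 1 / t = κ at *
  have e : ∀ φ₁ s X Y : ℂ, (w - 1 / w) * (2 * r ^ 2) * (φ₁ / (w - 1 / w) - s) *
      ((X - Y) / (r * κ * (w - 1 / w))) + 4 / κ * (r * s) * ((X + Y) / 2) =
      2 * r / κ * (φ₁ / (w - 1 / w) * X - (φ₁ / (w - 1 / w) - 2 * s) * Y) := by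
    intro φ₁ s X Y
    generalize w - 1 / w = W at *
    field_simp
    ring
  have e' : 4 / κ * ((a * b * c * d - 1) * (c₃ + r * (w + 1 / w) - c₃)
        + r * (a + b + c + d - a * b * c - a * b * d - a * c * d - b * c * d)) =
      4 / κ * (r * ((a * b * c * d - 1) * (w + 1 / w)
        + (a + b + c + d - a * b * c - a * b * d - a * c * d - b * c * d))) := by ring
  rw [e', e]
  have e3 : 2 * w⁻¹ ^ 2 * ((1 - a * w) * (1 - b * w) * (1 - c * w) * (1 - d * w)) / (w - 1 / w)
      - 2 * ((a * b * c * d - 1) * (w + 1 / w)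
        + (a + b + c + d - a * b * c - a * b * d - a * c * d - b * c * d)) =
      2 * w ^ 2 * ((1 - a / w) * (1 - b / w) * (1 - c / w) * (1 - d / w)) / (w - 1 / w) := by
    rw [div_sub' hw4]
    congr 1
    field_simp
    ring
  rw [e3]
  have e4 : 2 * w⁻¹ ^ 2 * ((1 - a * w) * (1 - b * w) * (1 - c * w) * (1 - d * w)) / (w - 1 / w)
        * (U' * V)
      - 2 * w ^ 2 * ((1 - a / w) * (1 - b / w) * (1 - c / w) * (1 - d / w)) / (w - 1 / w)
        * (U * V') = 2 * (w⁻¹ ^ 2 * ((1 - a * w * K) * (1 - b * w) * (1 - c * w) * (1 - d * w))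
      - w ^ 2 * ((1 - a / w * K) * (1 - b / w) * (1 - c / w) * (1 - d / w))) / (w - 1 / w)
        * (U * V) := by
    rw [div_mul_eq_mul_div, div_mul_eq_mul_div, div_mul_eq_mul_div, ← sub_div]
    congr 1
    linear_combination 2 * w⁻¹ ^ 2 * ((1 - b * w) * (1 - c * w) * (1 - d * w)) * V * hU -
      2 * w ^ 2 * ((1 - b / w) * (1 - c / w) * (1 - d / w)) * U * hV
  rw [e4]
  -- The left side is antisymmetric under w ↦ 1/w, hence divisible by w - 1/w. The quotient is
  -- symmetric, and it is expressed through the k-th factor of the basis. Solving for it divides by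
  -- a q^k, which is where a ≠ 0 enters.
  have e5 : (w⁻¹ ^ 2 * ((1 - a * w * K) * (1 - b * w) * (1 - c * w) * (1 - d * w))
      - w ^ 2 * ((1 - a / w * K) * (1 - b / w) * (1 - c / w) * (1 - d / w))) * (a * K) =
      ((1 - a * b * c * d * K) * ((1 - a * w * K) * (1 - a / w * K))
        - (1 - a * b * K) * (1 - a * c * K) * (1 - a * d * K)) * (w - 1 / w) := by
    field_simp
    ring
  rw [← eq_div_iff (mul_ne_zero ha hK)] at e5
  rw [e5]
  generalize w - 1 / w = W at *
  field_simp
  ring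

end IsAWOps

/-! ### The basic hypergeometric series of the Askey-Wilson polynomials -/

/-- The coefficients of the series `₄φ₃` of the Askey-Wilson polynomials. -/
noncomputable def awCoef (q a b c d : ℂ) (n k : ℕ) : ℂ :=
  qPoch (q ^ (-(n : ℤ))) q k * qPoch (a * b * c * d * q ^ ((n : ℤ) - 1)) q k * q ^ k
    / (qPoch (a * b) q k * qPoch (a * c) q k * qPoch (a * d) q k * qPoch q q k)

/-- The series `₄φ₃` of the Askey-Wilson polynomials in the variable `z`. -/
noncomputable def awSeries (q r c₃ a b c d : ℂ) (n : ℕ) : ℂ[X] :=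
  ∑ k ∈ Finset.range (n + 1), C (awCoef q a b c d n k) * awShiftedBasis q r c₃ a k

/-- The product `(1 - ab q^k) (1 - ac q^k) (1 - ad q^k)`. -/
def awF (q a b c d : ℂ) (k : ℕ) : ℂ :=
  (1 - a * b * q ^ k) * (1 - a * c * q ^ k) * (1 - a * d * q ^ k)

theorem awCoef_zero (q a b c d : ℂ) (n : ℕ) : awCoef q a b c d n 0 = 1 := by
  simp [awCoef, qPoch_zero]

theorem awCoef_eq_zero {q : ℂ} (hq : q ≠ 0) (a b c d : ℂ) {n k : ℕ} (h : n < k) :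
    awCoef q a b c d n k = 0 := by
  have : qPoch (q ^ (-(n : ℤ))) q k = 0 := by
    refine Finset.prod_eq_zero (Finset.mem_range.mpr h) ?_
    rw [zpow_neg, zpow_natCast, inv_mul_cancel₀ (pow_ne_zero _ hq), sub_self]
  rw [awCoef, this]
  simp

theorem awCoef_succ {q a b c d : ℂ} {n k : ℕ} (hF : awF q a b c d k ≠ 0)
    (hq : 1 - q ^ (k + 1) ≠ 0) :
    awCoef q a b c d n (k + 1) * (awF q a b c d k * (1 - q ^ (k + 1))) =
      awCoef q a b c d n k * ((1 - q ^ (-(n : ℤ)) * q ^ k) *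
        (1 - a * b * c * d * q ^ ((n : ℤ) - 1) * q ^ k) * q) := by
  simp only [awCoef, qPoch_succ]
  have e : qPoch (a * b) q k * (1 - a * b * q ^ k) * (qPoch (a * c) q k * (1 - a * c * q ^ k)) *
      (qPoch (a * d) q k * (1 - a * d * q ^ k)) * (qPoch q q k * (1 - q * q ^ k)) =
      (qPoch (a * b) q k * qPoch (a * c) q k * qPoch (a * d) q k * qPoch q q k) *
        (awF q a b c d k * (1 - q ^ (k + 1))) := by
    rw [awF]; ring
  rw [e, ← div_div, div_mul_cancel₀ _ (mul_ne_zero hF hq)]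
  ring

theorem awSeries_eq_sum {q : ℂ} (hq : q ≠ 0) (r c₃ a b c d : ℂ) {n M : ℕ} (h : n + 1 ≤ M) :
    awSeries q r c₃ a b c d n =
      ∑ k ∈ Finset.range M, C (awCoef q a b c d n k) * awShiftedBasis q r c₃ a k := by
  refine Finset.sum_subset (Finset.range_subset_range.mpr h) fun k _ hk => ?_
  rw [awCoef_eq_zero hq _ _ _ _ (by simpa using hk), C_0, zero_mul]

namespace IsAWOps

variable {D S : ℂ[X] →ₗ[ℂ] ℂ[X]} {q t r c₃ : ℂ}

theorem D_one (h : IsAWOps D S q t r c₃) : D 1 = 0 :=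
  h.poly_ext _ _ fun w hw hw2 => by rw [h.D_eval _ _ hw hw2]; simp

theorem one_sub_q_pow (h : IsAWOps D S q t r c₃) (n : ℕ) : 1 - q ^ (n + 1) ≠ 0 :=
  sub_ne_zero.mpr (h.q_pow n).symm

/-- The Askey-Wilson series is an eigenfunction of the second order operator. -/
theorem pearsonOp_awSeries (h : IsAWOps D S q t r c₃) {φ ψ : ℂ[X]} {a b c d : ℂ} (ha : a ≠ 0)
    (hφ : φ = awPhi r c₃ a b c d) (hψ : ∀ z, ψ.eval z = 4 / (t - 1 / t) *
      ((a * b * c * d - 1) * (z - c₃)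
        + r * (a + b + c + d - a * b * c - a * b * d - a * c * d - b * c * d))) (n : ℕ)
    (hF : ∀ k ≤ n, awF q a b c d k ≠ 0) :
    pearsonOp D S φ ψ (D (awSeries q r c₃ a b c d (n + 1))) =
      C (eigenConst q t n * (1 - a * b * c * d * q ^ n)) * awSeries q r c₃ a b c d (n + 1) := by
  have hq := h.q_ne
  have hκ := h.t_sub
  have hq1 := h.q_sub_one
  set y := awCoef q a b c d (n + 1) with hy
  set Φ := awShiftedBasis q r c₃ a with hΦ
  -- `lam + σ (k + 1)` is the diagonal entry of the triangular operator at index k + 1, and the term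
  -- ratio of the series makes the subdiagonal contribution equal to -σ_k y_k. The σ-terms thus
  -- telescope: σ_{n+1} = 0 closes the sum at the top, and -σ_0 = `lam` supplies the missing term k
  -- = 0.
  set σ : ℕ → ℂ := fun k => 4 * q / ((q - 1) * (t - 1 / t) * q ^ k) *
    ((1 - q ^ k / q ^ (n + 1)) * (1 - a * b * c * d * q ^ n * q ^ k)) with hσ
  set lam := eigenConst q t n * (1 - a * b * c * d * q ^ n) with hlam
  have hlσ : lam = -σ 0 := by
    have := pow_ne_zero n hq
    simp only [hlam, hσ, eigenConst, pow_succ, pow_zero]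
    generalize t - 1 / t = κ at *
    field_simp
    ring
  have hσn : σ (n + 1) = 0 := by
    simp only [hσ]
    rw [div_self (pow_ne_zero _ hq)]
    ring
  have hysucc : ∀ k ≤ n, y (k + 1) * (awF q a b c d k * (1 - q ^ (k + 1))) =
      y k * ((1 - q ^ k / q ^ (n + 1)) * (1 - a * b * c * d * q ^ n * q ^ k) * q) := by
    intro k hk
    rw [hy, awCoef_succ (hF k hk) (h.one_sub_q_pow k), zpow_neg, zpow_natCast,
      show ((n + 1 : ℕ) : ℤ) - 1 = n by push_cast; ring, zpow_natCast]
    ring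
  have e1 : ∀ k ≤ n, y (k + 1) * (eigenConst q t k * awF q a b c d k) = σ k * y k := by
    intro k hk
    have h1 := hysucc k hk
    have h2 := pow_ne_zero k hq
    simp only [hσ, eigenConst]
    generalize t - 1 / t = κ at *
    have e : y (k + 1) * (4 * (1 - q ^ (k + 1)) / ((q - 1) * κ * q ^ k) * awF q a b c d k) =
      4 / ((q - 1) * κ * q ^ k) * (y (k + 1) * (awF q a b c d k * (1 - q ^ (k + 1)))) := by ring
    rw [e, h1]
    ring
  have e2 : ∀ k, eigenConst q t k * (1 - a * b * c * d * q ^ k) = lam + σ (k + 1) := by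
    intro k
    have h1 := pow_ne_zero n hq
    have h2 := pow_ne_zero k hq
    simp only [hlam, hσ, eigenConst, pow_succ]
    generalize t - 1 / t = κ at *
    generalize q ^ k = K at *
    generalize q ^ n = N at *
    field_simp
    ring
  have hterm : ∀ k, pearsonOp D S φ ψ (D (Φ (k + 1))) =
      C (eigenConst q t k) * (C (1 - a * b * c * d * q ^ k) * Φ (k + 1)
        - C (awF q a b c d k) * Φ k) := by
    intro k
    rw [hΦ, h.D_basis, ← smul_eq_C_mul, map_smul, h.pearsonOp_basis ha hφ hψ, smul_eq_C_mul,
      ← mul_assoc, ← C_mul, awF]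
    congr 2
    have h1 := h.r_ne
    have h2 := pow_ne_zero k hq
    rw [eigenConst]
    generalize t - 1 / t = κ at *
    field_simp
  have hsum : pearsonOp D S φ ψ (D (awSeries q r c₃ a b c d (n + 1))) =
      ∑ k ∈ Finset.range (n + 1), (C (lam * y (k + 1)) * Φ (k + 1)
        + (C (σ (k + 1) * y (k + 1)) * Φ (k + 1) - C (σ k * y k) * Φ k)) := by
    rw [awSeries, Finset.sum_range_succ', ← hy, ← hΦ]
    have h0 : Φ 0 = 1 := by simp [hΦ, awShiftedBasis]
    rw [h0, ← smul_eq_C_mul, map_add, map_smul, h.D_one, smul_zero, add_zero, map_sum, map_sum]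
    refine Finset.sum_congr rfl fun k hk => ?_
    have hk : k ≤ n := by simpa [Nat.lt_succ_iff] using hk
    rw [← smul_eq_C_mul, map_smul, map_smul, hterm, smul_eq_C_mul, ← e1 k hk,
      ← sub_eq_of_eq_add' (e2 k)]
    simp only [C_mul, C_sub]
    ring
  rw [hsum, Finset.sum_add_distrib, Finset.sum_range_sub (fun k => C (σ k * y k) * Φ k), hσn,
    awSeries, Finset.sum_range_succ' _ (n + 1), ← hy, ← hΦ, mul_add, Finset.mul_sum, hlσ]
  simp only [C_mul, C_neg, C_0, zero_mul, mul_assoc]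
  ring

end IsAWOps

/-! ### The recurrence relation of the Askey-Wilson series -/

/-- The coefficient `A_n` of the recurrence relation of the Askey-Wilson series. -/
noncomputable def awA (q a b c d : ℂ) (n : ℕ) : ℂ :=
  awF q a b c d n * awRatio q (a * b * c * d) n / (1 - a * b * c * d * q ^ (2 * n))

/-- The coefficient `C_n` of the recurrence relation of the Askey-Wilson series. -/
noncomputable def awC (q a b c d : ℂ) (n : ℕ) : ℂ :=
  a ^ 2 * (1 - q ^ n) * (1 - b * c * q ^ ((n : ℤ) - 1)) * (1 - b * d * q ^ ((n : ℤ) - 1))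
        * (1 - c * d * q ^ ((n : ℤ) - 1))
        / ((1 - a * b * c * d * q ^ (2 * (n : ℤ) - 1))
          * (1 - a * b * c * d * q ^ (2 * (n : ℤ) - 2)))

theorem awA_succ (q a b c d : ℂ) (n : ℕ) : awA q a b c d (n + 1) =
    awF q a b c d (n + 1) * (1 - a * b * c * d * q ^ n) /
      ((1 - a * b * c * d * q ^ (2 * n + 1)) * (1 - a * b * c * d * q ^ (2 * n + 2))) := by
  rw [awA, awRatio, if_neg n.succ_ne_zero, show ((n + 1 : ℕ) : ℤ) - 1 = (n : ℕ) by push_cast; ring,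
    show 2 * ((n + 1 : ℕ) : ℤ) - 1 = ((2 * n + 1 : ℕ) : ℤ) by push_cast; ring, zpow_natCast,
    zpow_natCast, ← mul_div_assoc, div_div, mul_add 2 n 1, mul_one]

theorem awC_succ (q a b c d : ℂ) (n : ℕ) : awC q a b c d (n + 1) =
    a ^ 2 * (1 - q ^ (n + 1)) * (1 - b * c * q ^ n) * (1 - b * d * q ^ n) * (1 - c * d * q ^ n) /
      ((1 - a * b * c * d * q ^ (2 * n + 1)) * (1 - a * b * c * d * q ^ (2 * n))) := by
  rw [awC, show ((n + 1 : ℕ) : ℤ) - 1 = (n : ℕ) by push_cast; ring,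
    show 2 * ((n + 1 : ℕ) : ℤ) - 1 = ((2 * n + 1 : ℕ) : ℤ) by push_cast; ring,
    show 2 * ((n + 1 : ℕ) : ℤ) - 2 = ((2 * n : ℕ) : ℤ) by push_cast; ring, zpow_natCast,
    zpow_natCast, zpow_natCast]

/-- The rational identity behind the recurrence relation; `N = q^n` and `L = q^k`. -/
theorem aw_core_identity (q a b c d N L : ℂ) :
    N * (1 - a * b * c * d * N ^ 2 * q) *
        ((1 - a * b * L) * (1 - a * c * L) * (1 - a * d * L)) * q
      - (N * q - L) * (1 - a * b * c * d * N * L) * (1 - a ^ 2 * L * q)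
        * (1 - a * b * c * d * N ^ 2 * q) =
      L * ((1 - a * b * (N * q)) * (1 - a * c * (N * q)) * (1 - a * d * (N * q)))
        * (1 - a * b * c * d * N * L)
      + a ^ 2 * q * L * (N * q - L)
        * ((1 - b * c * N) * (1 - b * d * N) * (1 - c * d * N)) := by
  ring

theorem aw_step_identity₁ {F p q N L P₂ P₃ : ℂ} (hN : N ≠ 0) (hq : q ≠ 0) (hp0 : 1 - p * N ≠ 0)
    (hP₂ : P₂ ≠ 0) (hP₃ : P₃ ≠ 0) (e₃ : P₃ = 1 - p * (N ^ 2 * q ^ 2)) :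
    F * (1 - p * N) / (P₂ * P₃) *
      ((1 - 1 / (N * q ^ 2)) * ((1 - p * N * L) / (1 - p * N)) * (1 - p * (N * q) * L)
        - (1 - L / (N * q)) * (1 - p * N * L)) =
      -(F * (1 - p * N * L) * (1 - L * q) / (N * q ^ 2 * P₂)) := by
  field_simp
  rw [e₃]
  ring

theorem aw_step_identity₂ {f p q N L P₁ P₂ : ℂ} (hN : N ≠ 0) (hq : q ≠ 0) (hqn : 1 - N * q ≠ 0)
    (hP₁ : P₁ ≠ 0) (hP₂ : P₂ ≠ 0) (e₁ : P₁ = 1 - p * N ^ 2) :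
    f * (1 - N * q) / (P₂ * P₁) *
      ((1 - L / (N * q)) * (1 - p * N * L)
        - ((1 - L / (N * q)) / (1 - 1 / (N * q))) * (1 - L / N) * (1 - p * (N / q))) =
      f * (1 - L / (N * q)) * (1 - L * q) / P₂ := by
  rw [show 1 - 1 / (N * q) = -(1 - N * q) / (N * q) by field_simp; ring]
  field_simp
  rw [e₁]
  ring

/-- Here N = q^n, L = q^k, p = abcd and P_i = 1 - p q^{2n+i-1}. Each of the two differences acquires
a factor 1 - Lq that cancels the one in the denominator (`aw_step_identity₁`, `aw_step_identity₂`).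
What remains is the polynomial identity `hcore`. -/
theorem aw_step_identity {a f F F' p q N L P₁ P₂ P₃ : ℂ} (hN : N ≠ 0) (hq : q ≠ 0) (hL : L ≠ 0)
    (hF : F ≠ 0) (hLq : 1 - L * q ≠ 0) (hqn : 1 - N * q ≠ 0) (hp0 : 1 - p * N ≠ 0)
    (hP₁ : P₁ ≠ 0) (hP₂ : P₂ ≠ 0) (hP₃ : P₃ ≠ 0) (e₁ : P₁ = 1 - p * N ^ 2)
    (e₃ : P₃ = 1 - p * (N ^ 2 * q ^ 2))
    (hcore : N * P₂ * F * q - (N * q - L) * (1 - p * N * L) * (1 - a ^ 2 * L * q) * P₂ =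
      L * F' * (1 - p * N * L) + f * q * L * (N * q - L)) :
    (1 - L / (N * q)) * (1 - p * N * L) * (L * q) / (F * (1 - L * q)) *
        ((1 - 1 / (L * q)) * (1 - a ^ 2 * (L * q))) + 1 =
      -(F' * (1 - p * N) / (P₂ * P₃) *
        ((1 - 1 / (N * q ^ 2)) * ((1 - p * N * L) / (1 - p * N)) * (1 - p * (N * q) * L) * (L * q)
            / (F * (1 - L * q))
          - (1 - L / (N * q)) * (1 - p * N * L) * (L * q) / (F * (1 - L * q))))
      + f * (1 - N * q) / (P₂ * P₁) *
        ((1 - L / (N * q)) * (1 - p * N * L) * (L * q) / (F * (1 - L * q))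
        - ((1 - L / (N * q)) / (1 - 1 / (N * q))) * (1 - L / N) * (1 - p * (N / q)) * (L * q)
            / (F * (1 - L * q))) := by
  have d₁ := aw_step_identity₁ (F := F') (L := L) hN hq hp0 hP₂ hP₃ e₃
  have d₂ := aw_step_identity₂ (f := f) (L := L) hN hq hqn hP₁ hP₂ e₁
  generalize F' * (1 - p * N) / (P₂ * P₃) = A at *
  generalize f * (1 - N * q) / (P₂ * P₁) = C at *
  have e : ∀ A U V G : ℂ, A * (U * (L * q) / G - V * (L * q) / G) = A * (U - V) * (L * q / G) :=
    fun A U V G => by ring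
  rw [e, e, d₁, d₂]
  field_simp
  linear_combination (1 - L * q) * hcore

/-- This compares coefficients of the (k+1)-th basis product in the recurrence. Changing n by one
shifts the arguments of two q-factorials by q, at the cost of one factor each, so all four
coefficients are multiples of the common quantity α β / W. -/
theorem awCoef_recurrence {q a b c d : ℂ} (hq : q ≠ 0) {n k : ℕ} (hF : awF q a b c d k ≠ 0)
    (hqk : 1 - q ^ (k + 1) ≠ 0) (hqn : 1 - q ^ (n + 1) ≠ 0)
    (hp0 : 1 - a * b * c * d * q ^ n ≠ 0) (hp1 : 1 - a * b * c * d * q ^ (2 * n) ≠ 0)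
    (hp2 : 1 - a * b * c * d * q ^ (2 * n + 1) ≠ 0)
    (hp3 : 1 - a * b * c * d * q ^ (2 * n + 2) ≠ 0) :
    awCoef q a b c d (n + 1) (k + 1) * ((1 - 1 / q ^ (k + 1)) * (1 - a ^ 2 * q ^ (k + 1)))
        + awCoef q a b c d (n + 1) k / q ^ k =
      -(awA q a b c d (n + 1) * (awCoef q a b c d (n + 2) (k + 1) - awCoef q a b c d (n + 1) (k + 1)))
      + awC q a b c d (n + 1) *
        (awCoef q a b c d (n + 1) (k + 1) - awCoef q a b c d n (k + 1)) := by
  have hcore := aw_core_identity q a b c d (q ^ n) (q ^ k)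
  have hN : q ^ n ≠ 0 := pow_ne_zero _ hq
  have hL : q ^ k ≠ 0 := pow_ne_zero _ hq
  set α := qPoch (q ^ (-((n + 1 : ℕ) : ℤ))) q k with hα
  set β := qPoch (a * b * c * d * q ^ n) q k with hβ
  set W := qPoch (a * b) q k * qPoch (a * c) q k * qPoch (a * d) q k * qPoch q q k with hW
  have hWs : qPoch (a * b) q (k + 1) * qPoch (a * c) q (k + 1) * qPoch (a * d) q (k + 1)
      * qPoch q q (k + 1) = W * (awF q a b c d k * (1 - q ^ (k + 1))) := by
    simp only [qPoch_succ, hW, awF]; ring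
  have hq2 : 1 - 1 / (q ^ n * q) ≠ 0 := by
    rw [pow_succ] at hqn
    rw [one_sub_div (mul_ne_zero hN hq)]
    refine div_ne_zero ?_ (mul_ne_zero hN hq)
    rw [← neg_ne_zero, neg_sub]; exact hqn
  have z0 : q ^ (-((n + 2 : ℕ) : ℤ)) = 1 / (q ^ n * q ^ 2) := by
    rw [zpow_neg, zpow_natCast, pow_add, one_div]
  have z1 : q ^ (-((n + 1 : ℕ) : ℤ)) = 1 / (q ^ n * q) := by
    rw [zpow_neg, zpow_natCast, pow_succ, one_div]
  have z2 : q ^ (-(n : ℤ)) = 1 / q ^ n := by rw [zpow_neg, zpow_natCast, one_div]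
  have z3 : q ^ (((n + 2 : ℕ) : ℤ) - 1) = q ^ n * q := by
    rw [show ((n + 2 : ℕ) : ℤ) - 1 = (n + 1 : ℕ) by push_cast; ring, zpow_natCast, pow_succ]
  have z4 : q ^ (((n + 1 : ℕ) : ℤ) - 1) = q ^ n := by
    rw [show ((n + 1 : ℕ) : ℤ) - 1 = (n : ℕ) by push_cast; ring, zpow_natCast]
  have z5 : q ^ ((n : ℤ) - 1) = q ^ n / q := by rw [zpow_sub_one₀ hq, zpow_natCast]; rfl
  have hα' : qPoch (1 / q ^ n) q k = α * (1 - q ^ k / (q ^ n * q)) / (1 - 1 / (q ^ n * q)) := by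
    rw [eq_div_iff hq2, hα, z1, mul_comm, show 1 / q ^ n = 1 / (q ^ n * q) * q by field_simp,
      ← qPoch_succ', qPoch_succ]
    ring
  have hβ' : qPoch (a * b * c * d * (q ^ n * q)) q k =
      β * (1 - a * b * c * d * q ^ n * q ^ k) / (1 - a * b * c * d * q ^ n) := by
    rw [eq_div_iff hp0, hβ, mul_comm, ← mul_assoc, ← qPoch_succ', qPoch_succ]
  have y0 : awCoef q a b c d (n + 1) k = α * β * q ^ k / W := by
    rw [awCoef, z4]
  have y1 : awCoef q a b c d (n + 1) (k + 1) = α * β / W * ((1 - q ^ k / (q ^ n * q)) *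
      (1 - a * b * c * d * q ^ n * q ^ k) * (q ^ k * q) /
        (awF q a b c d k * (1 - q ^ (k + 1)))) := by
    rw [awCoef, hWs, z4, qPoch_succ, qPoch_succ, ← hα, ← hβ, div_mul_div_comm, z1, pow_succ]
    ring
  have y2 : awCoef q a b c d (n + 2) (k + 1) = α * β / W * ((1 - 1 / (q ^ n * q ^ 2)) *
      ((1 - a * b * c * d * q ^ n * q ^ k) / (1 - a * b * c * d * q ^ n)) *
      (1 - a * b * c * d * (q ^ n * q) * q ^ k) * (q ^ k * q) /
        (awF q a b c d k * (1 - q ^ (k + 1)))) := by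
    rw [awCoef, hWs, z3, z0, qPoch_succ', show 1 / (q ^ n * q ^ 2) * q = 1 / (q ^ n * q) by
      field_simp, ← z1, ← hα, qPoch_succ, hβ', div_mul_div_comm, pow_succ]
    ring
  have y3 : awCoef q a b c d n (k + 1) = α * β / W * (((1 - q ^ k / (q ^ n * q)) /
      (1 - 1 / (q ^ n * q))) * (1 - q ^ k / q ^ n) * (1 - a * b * c * d * (q ^ n / q)) *
      (q ^ k * q) / (awF q a b c d k * (1 - q ^ (k + 1)))) := by
    rw [awCoef, hWs, z5, z2, qPoch_succ, hα', qPoch_succ',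
      show a * b * c * d * (q ^ n / q) * q = a * b * c * d * q ^ n by field_simp, ← hβ,
      div_mul_div_comm, pow_succ]
    ring
  have m₁ : q ^ (2 * n) = (q ^ n) ^ 2 := by rw [mul_comm 2 n, pow_mul]
  have m₂ : q ^ (2 * n + 1) = (q ^ n) ^ 2 * q := by rw [pow_succ, m₁]
  have m₃ : q ^ (2 * n + 2) = (q ^ n) ^ 2 * q ^ 2 := by rw [pow_add, m₁]
  have hFn : awF q a b c d (n + 1) = (1 - a * b * (q ^ n * q)) * (1 - a * c * (q ^ n * q)) *
    (1 - a * d * (q ^ n * q)) := by rw [awF, pow_succ]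
  have hFk : awF q a b c d k = (1 - a * b * q ^ k) * (1 - a * c * q ^ k) *
    (1 - a * d * q ^ k) := rfl
  rw [← hFn, ← hFk] at hcore
  have hcore' : q ^ n * (1 - a * b * c * d * q ^ (2 * n + 1)) * awF q a b c d k * q -
      (q ^ n * q - q ^ k) * (1 - a * b * c * d * q ^ n * q ^ k) * (1 - a ^ 2 * q ^ k * q) *
        (1 - a * b * c * d * q ^ (2 * n + 1)) =
      q ^ k * awF q a b c d (n + 1) * (1 - a * b * c * d * q ^ n * q ^ k) +
        (a ^ 2 * (1 - b * c * q ^ n) * (1 - b * d * q ^ n) * (1 - c * d * q ^ n)) * q * q ^ k *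
          (q ^ n * q - q ^ k) := by
    rw [m₂]
    linear_combination hcore
  have hid := aw_step_identity (a := a) hN hq hL hF (by rwa [← pow_succ]) (by rwa [← pow_succ]) hp0
    hp1 hp2 hp3 (by rw [m₁]) (by rw [m₃]) hcore'
  rw [y0, y1, y2, y3, awA_succ, awC_succ]
  rw [show α * β * q ^ k / W / q ^ k = α * β / W * 1 by field_simp]
  simp only [pow_succ q k, pow_succ q n] at hid ⊢
  generalize α * β / W = Z at *
  linear_combination Z * hid

/-- The three-term recurrence relation of the Askey-Wilson series. -/
theorem awSeries_recurrence {q r c₃ a b c d : ℂ} (hq : q ≠ 0) (hqn : ∀ n, 1 - q ^ (n + 1) ≠ 0)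
    (hr : r ≠ 0) {n : ℕ} (hF : ∀ k ≤ n + 1, awF q a b c d k ≠ 0)
    (hp : ∀ j ≤ 2 * n + 2, 1 - a * b * c * d * q ^ j ≠ 0) (z : ℂ) :
    (1 + a ^ 2 - a / r * (z - c₃)) * (awSeries q r c₃ a b c d (n + 1)).eval z =
      -(awA q a b c d (n + 1) * (awSeries q r c₃ a b c d (n + 2)).eval z)
      + (awA q a b c d (n + 1) + awC q a b c d (n + 1)) * (awSeries q r c₃ a b c d (n + 1)).eval z
      - awC q a b c d (n + 1) * (awSeries q r c₃ a b c d n).eval z := by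
  set y := awCoef q a b c d with hy
  set Φ : ℕ → ℂ := fun k => (awShiftedBasis q r c₃ a k).eval z with hΦ
  set A := awA q a b c d (n + 1)
  set C' := awC q a b c d (n + 1)
  have hs : ∀ m ≤ n + 2, (awSeries q r c₃ a b c d m).eval z =
      ∑ k ∈ Finset.range (n + 3), y m k * Φ k := by
    intro m hm
    rw [awSeries_eq_sum hq r c₃ a b c d (by omega : m + 1 ≤ n + 3), eval_finsetSum]
    simp [hΦ, hy]
  -- The left factor is the basis factor of index 0. Dividing the basis factor of index k by q^k
  -- gives the same linear part in z, and the constants differ by (1 - q^{-k})(1 - a² q^k).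
  have hE : ∀ k, (1 + a ^ 2 - a / r * (z - c₃)) * Φ k =
      (1 - 1 / q ^ k) * (1 - a ^ 2 * q ^ k) * Φ k + 1 / q ^ k * Φ (k + 1) := by
    intro k
    have := pow_ne_zero k hq
    simp only [hΦ, awShiftedBasis_succ, eval_mul, eval_sub, eval_C, eval_X]
    rw [show q ^ (2 * k) = (q ^ k) ^ 2 by rw [mul_comm 2 k, pow_mul]]
    field_simp
    ring
  rw [hs _ le_rfl, hs _ (by omega : n + 1 ≤ n + 2), hs _ (by omega : n ≤ n + 2), Finset.mul_sum]
  have e1 : ∑ k ∈ Finset.range (n + 3), (1 + a ^ 2 - a / r * (z - c₃)) * (y (n + 1) k * Φ k) =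
      ∑ k ∈ Finset.range (n + 2), (y (n + 1) (k + 1) * ((1 - 1 / q ^ (k + 1)) *
        (1 - a ^ 2 * q ^ (k + 1))) + y (n + 1) k / q ^ k) * Φ (k + 1) := by
    have h1 : ∀ k, (1 + a ^ 2 - a / r * (z - c₃)) * (y (n + 1) k * Φ k) =
        y (n + 1) k * ((1 - 1 / q ^ k) * (1 - a ^ 2 * q ^ k)) * Φ k
          + y (n + 1) k / q ^ k * Φ (k + 1) := fun k => by
      linear_combination y (n + 1) k * hE k
    simp only [h1, Finset.sum_add_distrib, add_mul]
    rw [Finset.sum_range_succ', Finset.sum_range_succ (fun k => y (n + 1) k / q ^ k * Φ (k + 1)),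
      hy, awCoef_eq_zero hq a b c d (by omega : n + 1 < n + 2)]
    simp
  have e2 : -(A * ∑ k ∈ Finset.range (n + 3), y (n + 2) k * Φ k)
      + (A + C') * ∑ k ∈ Finset.range (n + 3), y (n + 1) k * Φ k
      - C' * ∑ k ∈ Finset.range (n + 3), y n k * Φ k =
      ∑ k ∈ Finset.range (n + 3), (-(A * (y (n + 2) k - y (n + 1) k))
        + C' * (y (n + 1) k - y n k)) * Φ k := by
    simp only [Finset.mul_sum, ← Finset.sum_neg_distrib, ← Finset.sum_add_distrib,
      ← Finset.sum_sub_distrib]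
    exact Finset.sum_congr rfl fun k _ => by ring
  rw [e1, e2, Finset.sum_range_succ' _ (n + 2)]
  -- All three series have constant coefficient 1, so the term k = 0 of the differences disappears.
  rw [hy, awCoef_zero, awCoef_zero, awCoef_zero, ← hy]
  simp only [sub_self, mul_zero, neg_zero, add_zero, zero_mul]
  refine Finset.sum_congr rfl fun k hk => ?_
  have hk : k ≤ n + 1 := by simpa [Nat.lt_succ_iff] using hk
  rw [hy, awCoef_recurrence hq (hF k hk) (hqn k) (hqn n) (hp _ (by omega)) (hp _ (by omega))
    (hp _ (by omega)) (hp _ (by omega))]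

/-! ### Normalisation and the recurrence of the monic Askey-Wilson polynomials. -/

/-- The normalization which makes the Askey-Wilson series monic. -/
noncomputable def awNorm (q r a b c d : ℂ) (n : ℕ) : ℂ :=
  (r / a) ^ n * (qPoch (a * b) q n * qPoch (a * c) q n * qPoch (a * d) q n
      / qPoch (a * b * c * d * q ^ ((n : ℤ) - 1)) q n)

theorem awNorm_succ {q r a b c d : ℂ} {n : ℕ}
    (hp : ∀ j ≤ 2 * n, 1 - a * b * c * d * q ^ j ≠ 0) :
    awNorm q r a b c d (n + 1) = awNorm q r a b c d n * (r / a * awA q a b c d n) := by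
  have hF : qPoch (a * b) q (n + 1) * qPoch (a * c) q (n + 1) * qPoch (a * d) q (n + 1) =
      (qPoch (a * b) q n * qPoch (a * c) q n * qPoch (a * d) q n) * awF q a b c d n := by
    simp only [qPoch_succ, awF]; ring
  rw [awNorm, awNorm, hF]
  have z : q ^ (((n + 1 : ℕ) : ℤ) - 1) = q ^ n := by
    rw [show ((n + 1 : ℕ) : ℤ) - 1 = (n : ℕ) by push_cast; ring, zpow_natCast]
  rw [z]
  -- For n = 0 the factor 1 - abcd q^{-1} is absent on both sides, being cancelled in `awRatio`;
  -- nothing is assumed about it.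
  rcases n with _ | n
  · have h0 := hp 0 le_rfl
    simp only [awA, awRatio, qPoch_zero, qPoch_succ, pow_zero, mul_one, mul_zero, if_true] at h0 ⊢
    field_simp
    rw [zero_add, pow_one]
    ring
  · have z : q ^ (((n + 1 : ℕ) : ℤ) - 1) = q ^ n := by
      rw [show ((n + 1 : ℕ) : ℤ) - 1 = (n : ℕ) by push_cast; ring, zpow_natCast]
    rw [z, awA_succ]
    have h1 : qPoch (a * b * c * d * q ^ n) q (n + 1) * (1 - a * b * c * d * q ^ (2 * n + 1)) *
        (1 - a * b * c * d * q ^ (2 * n + 2)) = (1 - a * b * c * d * q ^ n) *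
          qPoch (a * b * c * d * q ^ (n + 1)) q (n + 1 + 1) := by
      rw [pow_succ q n, ← mul_assoc (a * b * c * d), ← qPoch_succ', qPoch_succ _ _ (n + 2),
        qPoch_succ _ _ (n + 1)]
      ring
    have h2 : qPoch (a * b * c * d * q ^ n) q (n + 1) ≠ 0 := by
      refine qPoch_ne_zero fun j hj => ?_
      rw [mul_assoc (a * b * c * d), ← pow_add]
      exact hp _ (by omega)
    have h3 : qPoch (a * b * c * d * q ^ (n + 1)) q (n + 1 + 1) ≠ 0 := by
      refine qPoch_ne_zero fun j hj => ?_
      rw [mul_assoc (a * b * c * d), ← pow_add]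
      exact hp _ (by omega)
    have h4 := hp (2 * n + 1) (by omega)
    have h5 := hp (2 * n + 2) (by omega)
    rw [pow_succ (r / a)]
    generalize (r / a) ^ (n + 1) = R
    generalize r / a = R'
    generalize awF q a b c d (n + 1) = F
    generalize qPoch (a * b) q (n + 1) * qPoch (a * c) q (n + 1) * qPoch (a * d) q (n + 1) = W
    generalize qPoch (a * b * c * d * q ^ (n + 1)) q (n + 1 + 1) = Q' at *
    generalize qPoch (a * b * c * d * q ^ n) q (n + 1) = Q at *
    generalize 1 - a * b * c * d * q ^ (2 * n + 1) = f₁ at *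
    generalize 1 - a * b * c * d * q ^ (2 * n + 2) = f₂ at *
    field_simp
    linear_combination R * R' * W * F * h1

theorem awB_eq {q r c₃ a b c d : ℂ} (ha : a ≠ 0) (n : ℕ) :
    awB q r c₃ a b c d n = c₃ + r / a * (1 + a ^ 2 - awA q a b c d n - awC q a b c d n) := by
  rw [awB, awA, awC, awF]
  generalize ((1 - a * b * c * d * q ^ (2 * (n : ℤ) - 1))
          * (1 - a * b * c * d * q ^ (2 * (n : ℤ) - 2))) = P
  generalize 1 - a * b * c * d * q ^ (2 * n) = P'
  have e : ∀ Y : ℂ, Y / (a * P') = Y / P' / a := fun Y => by rw [mul_comm, div_div]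
  rw [e]
  field_simp
  ring

theorem awCsucc_eq {q r a b c d : ℂ} (ha : a ≠ 0) {n : ℕ}
    (hp : ∀ j ≤ 2 * n + 1, 1 - a * b * c * d * q ^ j ≠ 0) :
    awCsucc q (r ^ 2) a b c d n = (r / a) ^ 2 * awA q a b c d n * awC q a b c d (n + 1) := by
  rw [awCsucc, awC_succ, awA, awF]
  have h1 := hp (2 * n) (by omega)
  have h2 := hp (2 * n + 1) (by omega)
  generalize 1 - a * b * c * d * q ^ (2 * n) = P at *
  generalize 1 - a * b * c * d * q ^ (2 * n + 1) = P' at *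
  field_simp

/-- The monic Askey-Wilson polynomials satisfy the three-term recurrence relation. -/
theorem ttrr_aw_eq {q r c₃ a b c d : ℂ} (hq : q ≠ 0) (hqn : ∀ n, 1 - q ^ (n + 1) ≠ 0)
    (hr : r ≠ 0) (ha : a ≠ 0) : ∀ {n : ℕ}, (∀ k < n, awF q a b c d k ≠ 0) →
    (∀ j < 2 * n, 1 - a * b * c * d * q ^ j ≠ 0) →
    ttrr (awB q r c₃ a b c d) (awCsucc q (r ^ 2) a b c d) n =
      C (awNorm q r a b c d n) * awSeries q r c₃ a b c d n
  | 0, _, _ => by simp [ttrr, awNorm, awSeries, qPoch_zero, awCoef_zero, awShiftedBasis]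
  | 1, hF, hp => by
    have h0 := hp 0 (by omega)
    have hF0 := hF 0 (by omega)
    have hq1 := hqn 0
    have hy := awCoef_succ (n := 1) hF0 hq1
    have hn : awNorm q r a b c d 1 = r / a * awA q a b c d 0 := by
      rw [awNorm_succ (fun j hj => hp j (by omega))]
      simp [awNorm, qPoch_zero]
    have hA : awA q a b c d 0 = awF q a b c d 0 / (1 - a * b * c * d) := by
      simp [awA, awRatio]
    -- This is the recurrence at index 0 in disguise. Since C_0 = 0 there is no polynomial of index
    -- -1, and the linear polynomial is compared directly.
    have hy1 : awA q a b c d 0 * awCoef q a b c d 1 1 = -1 := by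
      rw [awCoef_zero] at hy
      simp only [pow_zero, mul_one, zero_add, pow_one, Nat.cast_one, sub_self, zpow_zero,
        zpow_neg, zpow_one, one_mul] at hy h0 hq1
      rw [hA]
      field_simp
      field_simp at hy
      have : (1 - q) * (awF q a b c d 0 * awCoef q a b c d 1 1 + (1 - a * b * c * d)) = 0 := by
        linear_combination hy
      have := (mul_eq_zero.mp this).resolve_left hq1
      linear_combination this
    refine Polynomial.funext fun z => ?_
    have hC0 : awC q a b c d 0 = 0 := by simp [awC]
    rw [ttrr, awSeries, hn, awB_eq ha, hC0]
    simp only [Finset.sum_range_succ, Finset.sum_range_zero, eval_add, eval_mul, eval_sub, eval_C,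
      eval_X, awCoef_zero, awShiftedBasis, Finset.prod_range_succ, Finset.prod_range_zero]
    simp only [eval_zero, eval_one, pow_zero, mul_zero, mul_one, one_mul, zero_add]
    have e : a / r * (r / a) = 1 := by field_simp
    linear_combination (z - c₃) * (awA q a b c d 0 * awCoef q a b c d 1 1) * e
      + (z - c₃ - r / a * (1 + a ^ 2)) * hy1
  | n + 2, hF, hp => by
    have h1 := ttrr_aw_eq (c₃ := c₃) hq hqn hr ha (n := n + 1) (fun k hk => hF k (by omega))
      (fun j hj => hp j (by omega))
    have h0 := ttrr_aw_eq (c₃ := c₃) hq hqn hr ha (n := n) (fun k hk => hF k (by omega))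
      (fun j hj => hp j (by omega))
    refine Polynomial.funext fun z => ?_
    have hrec := awSeries_recurrence (c₃ := c₃) hq hqn hr (n := n) (fun k hk => hF k (by omega))
      (fun j hj => hp j (by omega)) z
    have k1 := awNorm_succ (r := r) (n := n + 1) (fun j hj => hp j (by omega))
    have k0 := awNorm_succ (r := r) (n := n) (fun j hj => hp j (by omega))
    rw [ttrr, h1, h0, awB_eq ha, awCsucc_eq ha (fun j hj => hp j (by omega))]
    simp only [eval_sub, eval_mul, eval_C, eval_X]
    rw [k1, k0]
    generalize awNorm q r a b c d n = K
    generalize awA q a b c d n = A₀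
    have e : (z - (c₃ + r / a * (1 + a ^ 2 - awA q a b c d (n + 1) - awC q a b c d (n + 1)))) =
      -(r / a) * ((1 + a ^ 2 - a / r * (z - c₃)) - awA q a b c d (n + 1)
        - awC q a b c d (n + 1)) := by field_simp; ring
    rw [e]
    linear_combination (-(r / a)) * (K * (r / a * A₀)) * hrec

theorem awShiftedBasis_eq_comp {q r c₃ a : ℂ} (hr : r ≠ 0) (k : ℕ) (z : ℂ) :
    (awBasis q a k).eval ((z - c₃) / (2 * r)) = (awShiftedBasis q r c₃ a k).eval z := by
  simp only [awBasis, awShiftedBasis, eval_prod]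
  refine Finset.prod_congr rfl fun j _ => ?_
  simp only [eval_add, eval_sub, eval_mul, eval_C, eval_X, eval_one]
  field_simp
  ring

theorem eval_awMonic {q r c₃ a b c d : ℂ} (hr : r ≠ 0) (n : ℕ) (z : ℂ) :
    2 ^ n * r ^ n * (awMonic q a b c d n).eval ((z - c₃) / (2 * r)) =
      (C (awNorm q r a b c d n) * awSeries q r c₃ a b c d n).eval z := by
  simp only [awMonic, awSeries, eval_mul, eval_C, eval_finsetSum, awShiftedBasis_eq_comp hr]
  rw [← mul_assoc]
  congr 1
  rw [awNorm, mul_pow, div_pow]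
  field_simp

/-! ### Continuity in the first parameter -/

theorem ttrr_congr {B B' Cs Cs' : ℕ → ℂ} : ∀ {n : ℕ}, (∀ k < n, B k = B' k) →
    (∀ k < n, Cs k = Cs' k) → ttrr B Cs n = ttrr B' Cs' n
  | 0, _, _ => by simp [ttrr]
  | 1, h, _ => by simp [ttrr, h 0 one_pos]
  | n + 2, h, h' => by
    rw [ttrr, ttrr, h (n + 1) (by omega), h' n (by omega),
      ttrr_congr (fun k hk => h k (by omega)) (fun k hk => h' k (by omega)),
      ttrr_congr (n := n) (fun k hk => h k (by omega)) (fun k hk => h' k (by omega))]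

/-- The coefficient `B_n` in a form which makes sense for `a = 0`. -/
noncomputable def awBreg (q r c₃ a b c d : ℂ) : ℕ → ℂ
  | 0 => c₃ + r * (a + (b + c + d - b * c * d - a * (b * c + b * d + c * d)
      + a ^ 2 * (b * c * d)) / (1 - a * b * c * d))
  | n + 1 => c₃ + r * (a
      + (-(b * c * d * (q ^ n) ^ 2 * q * (1 + q)) + a * (b * c * d) ^ 2 * (q ^ n) ^ 4 * q ^ 3
        + (q ^ n * q * (b + c + d) - a * (q ^ n * q) ^ 2 * (b * c + b * d + c * d)
          + a ^ 2 * (q ^ n * q) ^ 3 * (b * c * d)) * (1 - a * (b * c * d) * q ^ n)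
        + b * c * d * q ^ n)
        / ((1 - a * b * c * d * q ^ (2 * n + 1)) * (1 - a * b * c * d * q ^ (2 * n + 2)))
      - a * (1 - q ^ (n + 1)) * (1 - b * c * q ^ n) * (1 - b * d * q ^ n) * (1 - c * d * q ^ n) /
        ((1 - a * b * c * d * q ^ (2 * n + 1)) * (1 - a * b * c * d * q ^ (2 * n))))

/-- The coefficient A_n equals 1 at a = 0, so 1 - A_n is divisible by a and the apparent pole of B_n
at a = 0 is removable. The numerators in `awBreg` are that quotient written out. -/
theorem awB_eq_awBreg {q r c₃ a b c d : ℂ} (ha : a ≠ 0) {n : ℕ}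
    (hp : ∀ j ≤ 2 * n, 1 - a * b * c * d * q ^ j ≠ 0) :
    awB q r c₃ a b c d n = awBreg q r c₃ a b c d n := by
  rw [awB_eq ha]
  rcases n with _ | n
  · have h0 := hp 0 le_rfl
    simp only [pow_zero, mul_one] at h0
    simp only [awA, awF, awRatio, awC, awBreg, if_true, pow_zero, mul_zero, mul_one, sub_self,
      zero_mul, zero_div, sub_zero]
    generalize hP : 1 - a * b * c * d = P at *
    field_simp
    rw [← hP]
    ring
  · have h1 := hp (2 * n + 1) (by omega)
    have h2 := hp (2 * n + 2) (by omega)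
    rw [awA_succ, awC_succ, awBreg, awF]
    have m₁ : q ^ (2 * n) = (q ^ n) ^ 2 := by rw [mul_comm 2 n, pow_mul]
    have e : ∀ Y P₁ P₂ : ℂ, r / a * (1 + a ^ 2 - Y - a ^ 2 * (1 - q ^ (n + 1)) * (1 - b * c * q ^ n)
        * (1 - b * d * q ^ n) * (1 - c * d * q ^ n) / (P₁ * P₂)) = r * (a + (1 - Y) / a -
        a * (1 - q ^ (n + 1)) * (1 - b * c * q ^ n) * (1 - b * d * q ^ n) * (1 - c * d * q ^ n)
          / (P₁ * P₂)) := by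
      intro Y P₁ P₂
      generalize P₁ * P₂ = P
      field_simp
      ring
    rw [e]
    congr 4
    generalize hP₁ : 1 - a * b * c * d * q ^ (2 * n + 1) = P₁ at *
    generalize hP₂ : 1 - a * b * c * d * q ^ (2 * n + 2) = P₂ at *
    field_simp
    rw [← hP₁, ← hP₂, pow_succ q (2 * n), pow_add q (2 * n), m₁, pow_succ q n]
    ring

theorem continuousAt_awBreg {q r c₃ a b c d : ℂ} {n : ℕ}
    (hp : ∀ j ≤ 2 * n, 1 - a * b * c * d * q ^ j ≠ 0) :
    ContinuousAt (fun s => awBreg q r c₃ s b c d n) a := by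
  rcases n with _ | n
  · have h0 := hp 0 le_rfl
    simp only [pow_zero, mul_one] at h0
    simp only [awBreg]
    fun_prop (disch := assumption)
  · have h1 := hp (2 * n + 1) (by omega)
    have h2 := hp (2 * n + 2) (by omega)
    have h3 := hp (2 * n) (by omega)
    have h4 := mul_ne_zero h1 h2
    have h5 := mul_ne_zero h1 h3
    simp only [awBreg]
    fun_prop (disch := assumption)

theorem continuousAt_awCsucc {q m a b c d : ℂ} {n : ℕ}
    (hp : ∀ j ≤ 2 * n + 1, 1 - a * b * c * d * q ^ j ≠ 0) :
    ContinuousAt (fun s => awCsucc q m s b c d n) a := by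
  have h1 := hp (2 * n) (by omega)
  have h2 := hp (2 * n + 1) (by omega)
  have h3 : (1 - a * b * c * d * q ^ (2 * n)) ^ 2 * (1 - a * b * c * d * q ^ (2 * n + 1)) ≠ 0 :=
    mul_ne_zero (pow_ne_zero _ h1) h2
  have hR : ContinuousAt (fun s => awRatio q (s * b * c * d) n) a := by
    rcases n with _ | n
    · simp only [awRatio, if_true]
      exact continuousAt_const
    · simp only [awRatio, n.succ_ne_zero, if_false]
      have h4 := hp (2 * n + 1) (by omega)
      rw [← zpow_natCast, show ((2 * n + 1 : ℕ) : ℤ) = 2 * ((n + 1 : ℕ) : ℤ) - 1 by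
        push_cast; ring] at h4
      fun_prop (disch := assumption)
  simp only [awCsucc]
  fun_prop (disch := assumption)

/-- The only possible zero is s = 1/m. If it is `a` itself, the punctured neighbourhood omits it. -/
theorem eventually_one_sub_mul_ne_zero (a m : ℂ) : ∀ᶠ s in 𝓝[≠] a, 1 - s * m ≠ 0 := by
  by_cases h : a = 1 / m
  · filter_upwards [self_mem_nhdsWithin] with s hs h0
    have hm : m ≠ 0 := by rintro rfl; simp at h0
    apply hs
    rw [Set.mem_singleton_iff, h, eq_div_iff hm]
    linear_combination -h0
  · refine (isOpen_ne.eventually_mem h).filter_mono nhdsWithin_le_nhds |>.mono fun s hs h0 => ?_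
    have hm : m ≠ 0 := by rintro rfl; simp at h0
    apply hs
    rw [eq_div_iff hm]
    linear_combination -h0

theorem eventually_forall_lt {l : Filter ℂ} {P : ℕ → ℂ → Prop} (h : ∀ j, ∀ᶠ s in l, P j s)
    (n : ℕ) : ∀ᶠ s in l, ∀ j < n, P j s := by
  have := (Finset.range n).eventually_all.mpr fun j _ => h j
  simpa using this

/-- Near every value of the first parameter, the generic conditions hold. -/
theorem eventually_aw_generic (q a b c d : ℂ) (n : ℕ) : ∀ᶠ s in 𝓝[≠] a, s ≠ 0 ∧
    (∀ j < n, awF q s b c d j ≠ 0) ∧ ∀ j < 2 * n, 1 - s * b * c * d * q ^ j ≠ 0 := by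
  have h0 : ∀ᶠ s in 𝓝[≠] a, s ≠ 0 := by
    by_cases h : a = 0
    · subst h; exact self_mem_nhdsWithin
    · exact (isOpen_ne.eventually_mem h).filter_mono nhdsWithin_le_nhds
  have h1 := eventually_forall_lt (l := 𝓝[≠] a) (P := fun j s => awF q s b c d j ≠ 0)
    (fun j => by
      filter_upwards [eventually_one_sub_mul_ne_zero a (b * q ^ j),
        eventually_one_sub_mul_ne_zero a (c * q ^ j),
        eventually_one_sub_mul_ne_zero a (d * q ^ j)] with s hb hc hd
      rw [awF]
      simp only [mul_assoc] at hb hc hd ⊢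
      exact mul_ne_zero hb (mul_ne_zero hc hd)) n
  have h2 := eventually_forall_lt (l := 𝓝[≠] a)
    (P := fun j s => 1 - s * b * c * d * q ^ j ≠ 0) (fun j => by
      filter_upwards [eventually_one_sub_mul_ne_zero a (b * c * d * q ^ j)] with s hs
      simpa only [mul_assoc] using hs) (2 * n)
  filter_upwards [h0, h1, h2] with s hs0 hs1 hs2 using ⟨hs0, hs1, hs2⟩

theorem ttrr_awBreg_eq {q r c₃ a b c d : ℂ} (hq : q ≠ 0) (hqn : ∀ n, 1 - q ^ (n + 1) ≠ 0)
    (hr : r ≠ 0) (ha : a ≠ 0) {n : ℕ} (hF : ∀ k < n, awF q a b c d k ≠ 0)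
    (hp : ∀ j < 2 * n, 1 - a * b * c * d * q ^ j ≠ 0) :
    ttrr (awBreg q r c₃ a b c d) (awCsucc q (r ^ 2) a b c d) n =
      C (awNorm q r a b c d n) * awSeries q r c₃ a b c d n := by
  rw [← ttrr_aw_eq hq hqn hr ha hF hp]
  exact ttrr_congr (fun k hk => (awB_eq_awBreg ha fun j hj => hp j (by omega)).symm)
    fun _ _ => rfl

/-! ### The Askey-Wilson functional equation -/

theorem natDegree_awPhi (r c₃ a b c d : ℂ) : (awPhi r c₃ a b c d).natDegree ≤ 2 := by
  rw [awPhi]; compute_degree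

theorem natDegree_awPsi (q : ℝ) (r c₃ a b c d : ℂ) : (awPsi q r c₃ a b c d).natDegree ≤ 1 := by
  rw [awPsi]; compute_degree

theorem awPhi_coeff_two (r c₃ a b c d : ℂ) :
    (awPhi r c₃ a b c d).coeff 2 = 2 * (1 + a * b * c * d) := by
  have e : ((X - C c₃) ^ 2 : ℂ[X]).coeff 2 = 1 := by
    have h := ((monic_X_sub_C c₃).pow 2).coeff_natDegree
    rwa [(monic_X_sub_C c₃).natDegree_pow, natDegree_X_sub_C] at h
  rw [awPhi, coeff_add, coeff_sub, coeff_C_mul, coeff_C_mul, e, coeff_C]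
  simp [coeff_X]

theorem awPsi_coeff_one (q : ℝ) (r c₃ a b c d : ℂ) : (awPsi q r c₃ a b c d).coeff 1 =
    4 * ((q ^ (1 / 2 : ℝ) : ℝ) : ℂ) / ((q : ℂ) - 1) * (a * b * c * d - 1) := by
  rw [awPsi, coeff_C_mul, coeff_add, coeff_C_mul, coeff_C]
  simp

theorem coeff_C_eq_mul_coeff_one (e : ℂ) (i : ℕ) : (C e).coeff i = e * (1 : ℂ[X]).coeff i := by
  rw [← coeff_C_mul, mul_one]

theorem tendsto_awPhi_coeff (r c₃ a b c d : ℂ) (i : ℕ) :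
    Tendsto (fun s => (awPhi r c₃ s b c d).coeff i) (𝓝[≠] a)
      (𝓝 ((awPhi r c₃ a b c d).coeff i)) := by
  have e : ∀ s, (awPhi r c₃ s b c d).coeff i =
      2 * (1 + s * b * c * d) * ((X - C c₃) ^ 2 : ℂ[X]).coeff i
      - 2 * r * (s + b + c + d + s * b * c + s * b * d + s * c * d + b * c * d)
        * (X - C c₃ : ℂ[X]).coeff i
      + 4 * r ^ 2 * (s * b + s * c + s * d + b * c + b * d + c * d - s * b * c * d - 1)
        * (1 : ℂ[X]).coeff i := fun s => by
    rw [awPhi, coeff_add, coeff_sub, coeff_C_mul, coeff_C_mul, coeff_C_eq_mul_coeff_one]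
  simp only [e]
  generalize ((X - C c₃) ^ 2 : ℂ[X]).coeff i = x₁
  generalize (X - C c₃ : ℂ[X]).coeff i = x₂
  generalize (1 : ℂ[X]).coeff i = x₃
  exact (Continuous.tendsto (by fun_prop) a).mono_left nhdsWithin_le_nhds

theorem tendsto_awPsi_coeff (q : ℝ) (r c₃ a b c d : ℂ) (i : ℕ) :
    Tendsto (fun s => (awPsi q r c₃ s b c d).coeff i) (𝓝[≠] a)
      (𝓝 ((awPsi q r c₃ a b c d).coeff i)) := by
  have e : ∀ s, (awPsi q r c₃ s b c d).coeff i =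
      4 * ((q ^ (1 / 2 : ℝ) : ℝ) : ℂ) / ((q : ℂ) - 1) *
      ((s * b * c * d - 1) * (X - C c₃ : ℂ[X]).coeff i
      + r * (s + b + c + d - s * b * c - s * b * d - s * c * d - b * c * d)
        * (1 : ℂ[X]).coeff i) := fun s => by
    rw [awPsi, coeff_C_mul, coeff_add, coeff_C_mul, coeff_C_eq_mul_coeff_one (r * _)]
  simp only [e]
  generalize (X - C c₃ : ℂ[X]).coeff i = x₂
  generalize (1 : ℂ[X]).coeff i = x₃
  generalize 4 * ((q ^ (1 / 2 : ℝ) : ℝ) : ℂ) / ((q : ℂ) - 1) = x₁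
  exact (Continuous.tendsto (by fun_prop) a).mono_left nhdsWithin_le_nhds

/-- The complex number `q^{1/2}`. -/
noncomputable def qHalf (q : ℝ) : ℂ := ((q ^ (1 / 2 : ℝ) : ℝ) : ℂ)

theorem qHalf_sq {q : ℝ} (hq : 0 < q) : qHalf q ^ 2 = (q : ℂ) := by
  rw [qHalf, ← Complex.ofReal_pow, ← Real.rpow_natCast, ← Real.rpow_mul hq.le]
  norm_num

theorem qHalf_ne_zero {q : ℝ} (hq : 0 < q) : qHalf q ≠ 0 :=
  Complex.ofReal_ne_zero.mpr (Real.rpow_pos_of_pos hq _).ne'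

theorem q_pow_succ_ne_one {q : ℝ} (hq : 0 < q) (hq1 : q ≠ 1) (n : ℕ) : (q : ℂ) ^ (n + 1) ≠ 1 := by
  intro h
  have h' : q ^ (n + 1) = 1 := by exact_mod_cast h
  exact hq1 ((pow_eq_one_iff_of_nonneg hq.le n.succ_ne_zero).mp h')

theorem qHalf_sq_sub_one {q : ℝ} (hq : 0 < q) (hq1 : q ≠ 1) : qHalf q ^ 2 - 1 ≠ 0 := by
  rw [qHalf_sq hq]
  exact sub_ne_zero.mpr (by simpa using q_pow_succ_ne_one hq hq1 0)

theorem qHalf_const {q : ℝ} (hq : 0 < q) (hq1 : q ≠ 1) :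
    4 * ((q ^ (1 / 2 : ℝ) : ℝ) : ℂ) / ((q : ℂ) - 1) = 4 / (qHalf q - 1 / qHalf q) := by
  have h1 := qHalf_ne_zero hq
  have h2 := qHalf_sq_sub_one hq hq1
  rw [← qHalf_sq hq, show ((q ^ (1 / 2 : ℝ) : ℝ) : ℂ) = qHalf q from rfl]
  rw [show qHalf q - 1 / qHalf q = (qHalf q ^ 2 - 1) / qHalf q by field_simp]
  field_simp

theorem eval_awPsi {q : ℝ} (hq : 0 < q) (hq1 : q ≠ 1) (r c₃ a b c d z : ℂ) :
    (awPsi q r c₃ a b c d).eval z = 4 / (qHalf q - 1 / qHalf q) *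
      ((a * b * c * d - 1) * (z - c₃)
        + r * (a + b + c + d - a * b * c - a * b * d - a * c * d - b * c * d)) := by
  rw [awPsi, qHalf_const hq hq1]
  simp only [eval_add, eval_sub, eval_mul, eval_C, eval_X]

/-- D and S do not depend on a, and the denominators of the series involve only ab, ac and ad, so
moving a alone reaches generic parameters. The limit covers both a = 0 and values with ab q^k = 1,
where the series itself breaks down. -/
theorem apply_ttrr_awBreg_eq_zero {D S : ℂ[X] →ₗ[ℂ] ℂ[X]} {q : ℝ} {r c₃ a b c d : ℂ} (hq : 0 < q)
    (hq1 : q ≠ 1) (h : IsAWOps D S q (qHalf q) r c₃) {u : Module.Dual ℂ ℂ[X]}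
    (hu : ∀ f, u (pearsonOp D S (awPhi r c₃ a b c d) (awPsi q r c₃ a b c d) f) = 0)
    (hp : ∀ j : ℕ, 1 - a * b * c * d * (q : ℂ) ^ j ≠ 0) (n : ℕ) :
    u (ttrr (awBreg q r c₃ a b c d) (awCsucc q (r ^ 2) a b c d) (n + 1)) = 0 := by
  refine apply_ttrr_eq_zero_of_tendsto (l := 𝓝[≠] a)
    (φ := fun s => awPhi r c₃ s b c d) (ψ := fun s => awPsi q r c₃ s b c d)
    (B := fun s => awBreg q r c₃ s b c d) (Cs := fun s => awCsucc q (r ^ 2) s b c d)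
    (lam := fun s => IsAWOps.eigenConst q (qHalf q) n * (1 - s * b * c * d * (q : ℂ) ^ n))
    (lam₀ := IsAWOps.eigenConst q (qHalf q) n * (1 - a * b * c * d * (q : ℂ) ^ n))
    (fun s => natDegree_awPhi _ _ _ _ _ _) (natDegree_awPhi _ _ _ _ _ _)
    (fun s => natDegree_awPsi _ _ _ _ _ _ _) (natDegree_awPsi _ _ _ _ _ _ _)
    (tendsto_awPhi_coeff _ _ _ _ _ _) (tendsto_awPsi_coeff _ _ _ _ _ _ _)
    (fun k => (continuousAt_awBreg fun j _ => hp j).tendsto.mono_left nhdsWithin_le_nhds)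
    (fun k => (continuousAt_awCsucc fun j _ => hp j).tendsto.mono_left nhdsWithin_le_nhds)
    hu ?_ ?_ ?_
  · refine mul_ne_zero ?_ (hp n)
    rw [IsAWOps.eigenConst]
    exact div_ne_zero (mul_ne_zero (by norm_num) (h.one_sub_q_pow n))
      (mul_ne_zero (mul_ne_zero h.q_sub_one h.t_sub) (pow_ne_zero _ h.q_ne))
  · exact (Continuous.tendsto (by fun_prop) a).mono_left nhdsWithin_le_nhds
  · filter_upwards [eventually_aw_generic q a b c d (n + 1)] with s hs
    obtain ⟨hs0, hsF, hsp⟩ := hs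
    rw [ttrr_awBreg_eq h.q_ne h.one_sub_q_pow h.r_ne hs0 hsF hsp, ← smul_eq_C_mul (p := awSeries _ _ _ _ _ _ _ _),
      map_smul, map_smul, h.pearsonOp_awSeries hs0 rfl (eval_awPsi hq hq1 r c₃ s b c d) n
        (fun k hk => hsF k (by omega)), mul_smul_comm]

/-! ### The `q`-quadratic lattice -/

theorem q_cpow_half {q : ℝ} (hq : 0 < q) : (q : ℂ) ^ (1 / 2 : ℂ) = qHalf q := by
  rw [qHalf, Complex.ofReal_cpow hq.le]
  norm_num

theorem q_cpow_add_half {q : ℝ} (hq : 0 < q) (s : ℂ) :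
    (q : ℂ) ^ (s + 1 / 2) = (q : ℂ) ^ s * qHalf q := by
  rw [Complex.cpow_add _ _ (by exact_mod_cast hq.ne'), q_cpow_half hq]

theorem q_cpow_sub_half {q : ℝ} (hq : 0 < q) (s : ℂ) :
    (q : ℂ) ^ (s - 1 / 2) = (q : ℂ) ^ s / qHalf q := by
  rw [Complex.cpow_sub _ _ (by exact_mod_cast hq.ne'), q_cpow_half hq]

theorem q_cpow_ne_zero {q : ℝ} (hq : 0 < q) (s : ℂ) : (q : ℂ) ^ s ≠ 0 := by
  rw [Complex.cpow_def_of_ne_zero (by exact_mod_cast hq.ne')]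
  exact Complex.exp_ne_zero _

/-- Since log q ≠ 0, s ↦ q^s reaches every non-zero w, so w may be treated as a free variable. -/
theorem exists_q_cpow_eq {q : ℝ} (hq : 0 < q) (hq1 : q ≠ 1) {w : ℂ} (hw : w ≠ 0) :
    ∃ s : ℂ, (q : ℂ) ^ s = w := by
  have hl : Complex.log (q : ℂ) ≠ 0 := by
    rw [← Complex.ofReal_log hq.le]
    exact Complex.ofReal_ne_zero.mpr (Real.log_ne_zero_of_pos_of_ne_one hq hq1)
  refine ⟨Complex.log w / Complex.log q, ?_⟩
  rw [Complex.cpow_def_of_ne_zero (by exact_mod_cast hq.ne'), mul_div_cancel₀ _ hl,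
    Complex.exp_log hw]

/-- The substitution is w = (c₂/r) q^s: then x(s) = c₃ + r(w + 1/w), half a step multiplies w by
q^{1/2}, and the divided difference degenerates exactly at w² = 1. -/
theorem isAWOps_qLattice {q : ℝ} {c₁ c₂ c₃ r : ℂ} (hq : 0 < q) (hq1 : q ≠ 1)
    (hx : IsLattice (qLattice q c₁ c₂ c₃)) (hr : r ^ 2 = c₁ * c₂) (hr0 : r ≠ 0) :
    IsAWOps (xDeriv hx) (xAver hx) q (qHalf q) r c₃ := by
  have hc2 : c₂ ≠ 0 := by
    rintro rfl
    exact hr0 (pow_eq_zero_iff two_ne_zero |>.mp (by rw [hr, mul_zero]))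
  have ht := qHalf_ne_zero hq
  have ht2 := qHalf_sq_sub_one hq hq1
  have hxv : ∀ s, qLattice q c₁ c₂ c₃ s =
      c₃ + r * (c₂ / r * (q : ℂ) ^ s + 1 / (c₂ / r * (q : ℂ) ^ s)) := by
    intro s
    have := q_cpow_ne_zero hq s
    have e : c₁ = r ^ 2 / c₂ := by rw [hr]; field_simp
    rw [qLattice, Complex.cpow_neg, e]
    field_simp
    ring
  have hs : ∀ w, w ≠ 0 → ∃ s : ℂ, w = c₂ / r * (q : ℂ) ^ s := by
    intro w hw
    obtain ⟨s, hs⟩ := exists_q_cpow_eq hq hq1 (mul_ne_zero hw (div_ne_zero hr0 hc2))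
    exact ⟨s, by rw [hs]; field_simp⟩
  have hplus : ∀ s, qLattice q c₁ c₂ c₃ (s + 1 / 2) = c₃ + r * (c₂ / r * (q : ℂ) ^ s * qHalf q
      + 1 / (c₂ / r * (q : ℂ) ^ s * qHalf q)) := by
    intro s; rw [hxv, q_cpow_add_half hq, mul_assoc]
  have hminus : ∀ s, qLattice q c₁ c₂ c₃ (s - 1 / 2) = c₃ + r * (c₂ / r * (q : ℂ) ^ s / qHalf q
      + 1 / (c₂ / r * (q : ℂ) ^ s / qHalf q)) := by
    intro s; rw [hxv, q_cpow_sub_half hq, mul_div_assoc]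
  have hdiff : ∀ s, qLattice q c₁ c₂ c₃ (s + 1 / 2) - qLattice q c₁ c₂ c₃ (s - 1 / 2) =
      r * (qHalf q - 1 / qHalf q) *
        (c₂ / r * (q : ℂ) ^ s - 1 / (c₂ / r * (q : ℂ) ^ s)) := by
    intro s
    rw [hplus, hminus]
    have := mul_ne_zero (div_ne_zero hc2 hr0) (q_cpow_ne_zero hq s)
    generalize c₂ / r * (q : ℂ) ^ s = w at *
    field_simp
    ring
  have hκ : qHalf q - 1 / qHalf q ≠ 0 := by
    rw [show qHalf q - 1 / qHalf q = (qHalf q ^ 2 - 1) / qHalf q by field_simp]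
    exact div_ne_zero ht2 ht
  have hne : ∀ s, qLattice q c₁ c₂ c₃ (s + 1 / 2) ≠ qLattice q c₁ c₂ c₃ (s - 1 / 2) ↔
      (c₂ / r * (q : ℂ) ^ s) ^ 2 ≠ 1 := by
    intro s
    rw [← sub_ne_zero, hdiff]
    have := mul_ne_zero (div_ne_zero hc2 hr0) (q_cpow_ne_zero hq s)
    generalize c₂ / r * (q : ℂ) ^ s = w at *
    rw [show w - 1 / w = (w ^ 2 - 1) / w by field_simp, mul_ne_zero_iff, div_ne_zero_iff,
      sub_ne_zero]
    exact ⟨fun h => h.2.1, fun h => ⟨mul_ne_zero hr0 hκ, h, this⟩⟩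
  refine ⟨qHalf_sq hq, ht, hr0, q_pow_succ_ne_one hq hq1, ?_, ?_, ?_⟩
  · intro f w hw hw2
    obtain ⟨s, rfl⟩ := hs w hw
    rw [← hxv, xDeriv_spec hx f s ((hne s).mpr hw2), hdiff, hplus, hminus]
  · intro f w hw
    obtain ⟨s, rfl⟩ := hs w hw
    rw [← hxv, xAver_spec hx f s, hplus, hminus]
  · intro f g hfg
    refine hx.poly_ext fun s hs => ?_
    rw [hxv]
    exact hfg _ (mul_ne_zero (div_ne_zero hc2 hr0) (q_cpow_ne_zero hq s)) ((hne s).mp hs)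

/-- No condition r ≠ 0 appears, so the rules are available for excluding r = 0. -/
theorem latticeRules_qLattice {q : ℝ} {c₁ c₂ c₃ r : ℂ} (hq : 0 < q)
    (hx : IsLattice (qLattice q c₁ c₂ c₃)) (hr : r ^ 2 = c₁ * c₂) :
    LatticeRules (xDeriv hx) (xAver hx) ((qHalf q + 1 / qHalf q) / 2)
      ((1 - (qHalf q + 1 / qHalf q) / 2) * c₃)
      ((((qHalf q + 1 / qHalf q) / 2) ^ 2 - 1) * (c₃ ^ 2 - 4 * r ^ 2)) := by
  have ht := qHalf_ne_zero hq
  refine hx.latticeRules _ _ _ ?_ ?_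
  · intro s
    simp only [qLattice, Complex.cpow_neg, q_cpow_add_half hq, q_cpow_sub_half hq]
    have := q_cpow_ne_zero hq s
    field_simp
    ring
  · intro s
    rw [hr]
    simp only [qLattice, Complex.cpow_neg, q_cpow_add_half hq, q_cpow_sub_half hq]
    have := q_cpow_ne_zero hq s
    field_simp
    ring

/-! ### The admissibility numbers and the necessary conditions for regularity. -/

/-- The numbers `γ_n` in terms of `t = q^{1/2}`. -/
noncomputable def halfGamma (t : ℂ) (n : ℕ) : ℂ := (t ^ n - 1 / t ^ n) / (t - 1 / t)

/-- The numbers `α_n` in terms of `t = q^{1/2}`. -/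
noncomputable def halfAlpha (t : ℂ) (n : ℕ) : ℂ := (t ^ n + 1 / t ^ n) / 2

theorem halfGamma_succ {t : ℂ} (ht : t ≠ 0) (hκ : t - 1 / t ≠ 0) (n : ℕ) :
    halfGamma t (n + 1) = (t + 1 / t) / 2 * halfGamma t n + halfAlpha t n := by
  have hn := pow_ne_zero n ht
  rw [halfGamma, halfGamma, halfAlpha, pow_succ, ← mul_div_assoc, div_add' _ _ _ hκ]
  congr 1
  field_simp
  ring

theorem halfAlpha_succ {t : ℂ} (ht : t ≠ 0) (hκ : t - 1 / t ≠ 0) (n : ℕ) :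
    halfAlpha t (n + 1) =
      (((t + 1 / t) / 2) ^ 2 - 1) * halfGamma t n + (t + 1 / t) / 2 * halfAlpha t n := by
  have hn := pow_ne_zero n ht
  have e : ((t + 1 / t) / 2) ^ 2 - 1 = ((t - 1 / t) / 2) ^ 2 := by field_simp; ring
  have e2 : (t - 1 / t) * halfGamma t n = t ^ n - 1 / t ^ n := by
    rw [halfGamma, mul_div_cancel₀ _ hκ]
  have e3 : ((t - 1 / t) / 2) ^ 2 * halfGamma t n =
      (t - 1 / t) / 4 * ((t - 1 / t) * halfGamma t n) := by ring
  rw [e, e3, e2, halfAlpha, halfAlpha, pow_succ]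
  field_simp
  ring

theorem halfGamma_ne_zero {t : ℂ} (ht : t ≠ 0) (hκ : t - 1 / t ≠ 0)
    (h : ∀ n, (t ^ 2) ^ (n + 1) ≠ 1) (n : ℕ) : halfGamma t (n + 1) ≠ 0 := by
  rw [halfGamma]
  refine div_ne_zero ?_ hκ
  have hn := pow_ne_zero (n + 1) ht
  rw [show t ^ (n + 1) - 1 / t ^ (n + 1) = ((t ^ 2) ^ (n + 1) - 1) / t ^ (n + 1) by
    rw [pow_right_comm]; field_simp]
  exact div_ne_zero (sub_ne_zero.mpr (h n)) hn

/-- With p = abcd the left side is d_n for the Askey-Wilson φ and ψ; the factorisation shows that it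
vanishes only when p q^n = 1. -/
theorem halfAdm_eq {t p : ℂ} (ht : t ≠ 0) (hκ : t - 1 / t ≠ 0) (n : ℕ) :
    halfGamma t n * (2 * (1 + p)) + halfAlpha t n * (4 / (t - 1 / t) * (p - 1)) =
      -(4 / (t - 1 / t)) * (1 / t ^ n) * (1 - p * (t ^ 2) ^ n) := by
  have hn := pow_ne_zero n ht
  rw [halfGamma, halfAlpha, pow_right_comm]
  generalize t ^ n = T at *
  generalize t - 1 / t = κ at *
  field_simp
  ring

theorem qHalf_sub_ne_zero {q : ℝ} (hq : 0 < q) (hq1 : q ≠ 1) : qHalf q - 1 / qHalf q ≠ 0 := by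
  have ht := qHalf_ne_zero hq
  rw [show qHalf q - 1 / qHalf q = (qHalf q ^ 2 - 1) / qHalf q by field_simp]
  exact div_ne_zero (qHalf_sq_sub_one hq hq1) ht

theorem qHalf_add_ne_zero {q : ℝ} (hq : 0 < q) : (qHalf q + 1 / qHalf q) / 2 ≠ 0 := by
  have h : (0 : ℝ) < q ^ (1 / 2 : ℝ) := Real.rpow_pos_of_pos hq _
  have e : (qHalf q + 1 / qHalf q) / 2 =
      (((q ^ (1 / 2 : ℝ) + 1 / q ^ (1 / 2 : ℝ)) / 2 : ℝ) : ℂ) := by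
    rw [qHalf]; push_cast; ring
  rw [e]
  exact Complex.ofReal_ne_zero.mpr (by positivity)

theorem qHalf_pow {q : ℝ} (hq : 0 < q) (n : ℕ) :
    ((q ^ ((n : ℝ) / 2) : ℝ) : ℂ) = qHalf q ^ n := by
  rw [qHalf, ← Complex.ofReal_pow, ← Real.rpow_natCast, ← Real.rpow_mul hq.le]
  congr 2
  ring

theorem qHalf_pow_neg {q : ℝ} (hq : 0 < q) (n : ℕ) :
    ((q ^ (-(n : ℝ) / 2) : ℝ) : ℂ) = 1 / qHalf q ^ n := by
  rw [neg_div, Real.rpow_neg hq.le, Complex.ofReal_inv, qHalf_pow hq, one_div]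

theorem qHalf_sub {q : ℝ} (hq : 0 < q) :
    ((q ^ (1 / 2 : ℝ) - q ^ (-1 / 2 : ℝ) : ℝ) : ℂ) = qHalf q - 1 / qHalf q := by
  rw [neg_div, Real.rpow_neg hq.le, qHalf]
  push_cast
  ring

theorem admCoeff_aw {q : ℝ} (hq : 0 < q) (hq1 : q ≠ 1) (r c₃ a b c d : ℂ) (n : ℕ) :
    admCoeff q (awPhi r c₃ a b c d) (awPsi q r c₃ a b c d) n =
      -(4 / ((q ^ (1 / 2 : ℝ) - q ^ (-1 / 2 : ℝ) : ℝ) : ℂ)) * ((q ^ (-(n : ℝ) / 2) : ℝ) : ℂ)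
          * (1 - a * b * c * d * (q : ℂ) ^ n) := by
  have hg : (latGamma q n : ℂ) = halfGamma (qHalf q) n := by
    rw [latGamma, Complex.ofReal_div, qHalf_sub hq, Complex.ofReal_sub, qHalf_pow hq,
      qHalf_pow_neg hq, halfGamma]
  have hα : (latAlpha q n : ℂ) = halfAlpha (qHalf q) n := by
    rw [latAlpha, Complex.ofReal_div, Complex.ofReal_add, qHalf_pow hq,
      qHalf_pow_neg hq, halfAlpha, Complex.ofReal_ofNat]
  rw [admCoeff, awPhi_coeff_two, awPsi_coeff_one, qHalf_const hq hq1, hg, hα,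
    halfAdm_eq (qHalf_ne_zero hq) (qHalf_sub_ne_zero hq hq1), qHalf_sub hq, qHalf_pow_neg hq,
    qHalf_sq hq]

/-- A regular solution of the Askey-Wilson equation has `abcd q^n ≠ 1`. -/
theorem aw_admissible {q : ℝ} {c₁ c₂ c₃ r a b c d : ℂ} (hq : 0 < q) (hq1 : q ≠ 1)
    (hx : IsLattice (qLattice q c₁ c₂ c₃)) (hr : r ^ 2 = c₁ * c₂) {u : Module.Dual ℂ ℂ[X]}
    (hGP : GPEquation hx (awPhi r c₃ a b c d) (awPsi q r c₃ a b c d) u) {P : ℕ → ℂ[X]}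
    (hP : IsOPS u P) (n : ℕ) : 1 - a * b * c * d * (q : ℂ) ^ n ≠ 0 := by
  have ht := qHalf_ne_zero hq
  have hκ := qHalf_sub_ne_zero hq hq1
  intro h0
  refine (latticeRules_qLattice hq hx hr).admissible_of_isOPS (γ := halfGamma (qHalf q))
    (A := halfAlpha (qHalf q)) (by simp [halfGamma]) (by simp [halfAlpha])
    (halfGamma_succ ht hκ) (halfAlpha_succ ht hκ)
    (halfGamma_ne_zero ht hκ (by rw [qHalf_sq hq]; exact q_pow_succ_ne_one hq hq1))
    (qHalf_add_ne_zero hq) (natDegree_awPhi _ _ _ _ _ _) (natDegree_awPsi _ _ _ _ _ _ _)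
    hGP.apply_pearsonOp hP n ?_ ?_
  · rw [awPhi_coeff_two, awPsi_coeff_one, qHalf_const hq hq1, halfAdm_eq ht hκ, qHalf_sq hq]
    refine mul_ne_zero (mul_ne_zero (neg_ne_zero.mpr (div_ne_zero (by norm_num) hκ))
      (one_div_ne_zero (pow_ne_zero _ ht))) ?_
    -- Two consecutive d_n cannot both vanish: abcd q^n = abcd q^{n+1} = 1 forces q = 1.
    intro h1
    have hq' : (q : ℂ) ≠ 1 := by simpa using q_pow_succ_ne_one hq hq1 0
    apply hq'
    rw [pow_succ] at h1
    linear_combination (q : ℂ) * h0 - h1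
  · rw [awPhi_coeff_two, awPsi_coeff_one, qHalf_const hq hq1, halfAdm_eq ht hκ, qHalf_sq hq, h0,
      mul_zero]

/-- A regular solution of the Askey-Wilson equation has `c₁ c₂ ≠ 0`. -/
theorem aw_sqrt_ne_zero {q : ℝ} {c₁ c₂ c₃ r a b c d : ℂ} (hq : 0 < q) (hq1 : q ≠ 1)
    (hx : IsLattice (qLattice q c₁ c₂ c₃)) (hr : r ^ 2 = c₁ * c₂) {u : Module.Dual ℂ ℂ[X]}
    (hGP : GPEquation hx (awPhi r c₃ a b c d) (awPsi q r c₃ a b c d) u) {P : ℕ → ℂ[X]}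
    (hP : IsOPS u P) : r ≠ 0 := by
  rintro rfl
  have hR := latticeRules_qLattice hq hx hr
  have ht := qHalf_ne_zero hq
  have hκ := qHalf_sub_ne_zero hq hq1
  set α := (qHalf q + 1 / qHalf q) / 2 with hα
  set D := xDeriv hx
  set S := xAver hx
  have hDY : ∀ f, D ((X - C c₃) * f) = C α * (X - C c₃) * D f + S f := by
    intro f
    rw [sub_mul, ← smul_eq_C_mul, map_sub, map_smul, hR.D_X_mul, smul_eq_C_mul]
    simp only [C_mul, C_sub, C_1]
    ring
  have hSY : ∀ f, S ((X - C c₃) * f) =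
      C (α ^ 2 - 1) * (X - C c₃) ^ 2 * D f + C α * (X - C c₃) * S f := by
    intro f
    rw [sub_mul, ← smul_eq_C_mul, map_sub, map_smul, hR.S_X_mul, smul_eq_C_mul]
    simp only [C_mul, C_sub, C_add, C_1, C_pow, C_ofNat, C_0]
    ring
  -- For r = 0 the lattice is c₃ plus a single exponential, so powers of X - c₃ are eigenvectors of
  -- S and of (X - c₃)D. The extra factor X - c₃ avoids the exponent n - 1 at n = 0.
  have key : ∀ n, (X - C c₃) * D ((X - C c₃) ^ n) = C (halfGamma (qHalf q) n) * (X - C c₃) ^ n ∧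
      S ((X - C c₃) ^ n) = C (halfAlpha (qHalf q) n) * (X - C c₃) ^ n := by
    intro n
    induction n with
    | zero => simp [hR.D_one, hR.S_one, halfGamma, halfAlpha]
    | succ n ih =>
      obtain ⟨h1, h2⟩ := ih
      rw [pow_succ', hDY, hSY, halfGamma_succ ht hκ, halfAlpha_succ ht hκ, ← hα]
      simp only [C_add, C_mul]
      refine ⟨?_, ?_⟩
      · linear_combination C α * (X - C c₃) * h1 + (X - C c₃) * h2
      · linear_combination C (α ^ 2 - 1) * (X - C c₃) * h1 + C α * (X - C c₃) * h2
  -- The Pearson operator maps (X - c₃)^n to d_n (X - c₃)^{n+1}, and admissibility gives d_n ≠ 0.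
  have hpow : ∀ n, u ((X - C c₃) ^ (n + 1)) = 0 := by
    intro n
    have h := hGP.apply_pearsonOp ((X - C c₃) ^ n)
    obtain ⟨h1, h2⟩ := key n
    have e : pearsonOp D S (awPhi 0 c₃ a b c d) (awPsi q 0 c₃ a b c d) ((X - C c₃) ^ n) =
        (halfGamma (qHalf q) n * (2 * (1 + a * b * c * d)) + halfAlpha (qHalf q) n *
          (4 / (qHalf q - 1 / qHalf q) * (a * b * c * d - 1))) • (X - C c₃) ^ (n + 1) := by
      rw [pearsonOp_apply, h2, awPhi, awPsi, qHalf_const hq hq1, smul_eq_C_mul]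
      simp only [mul_zero, zero_mul, C_0, sub_zero, add_zero, C_mul, C_add, zero_pow two_ne_zero]
      linear_combination (C 2 * (C 1 + C a * C b * C c * C d)) * (X - C c₃) * h1
    rw [e, map_smul, halfAdm_eq ht hκ, qHalf_sq hq] at h
    refine (smul_eq_zero.mp h).resolve_left ?_
    exact mul_ne_zero (mul_ne_zero (neg_ne_zero.mpr (div_ne_zero (by norm_num) hκ))
      (one_div_ne_zero (pow_ne_zero _ ht))) (aw_admissible hq hq1 hx hr hGP hP n)
  have hcomp : ∀ g : ℂ[X], u ((X - C c₃) * g.comp (X - C c₃)) = 0 := by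
    intro g
    induction g using Polynomial.induction_on' with
    | add f g hf hg => rw [add_comp, mul_add, map_add, hf, hg, add_zero]
    | monomial n e =>
      rw [monomial_comp, mul_left_comm, ← smul_eq_C_mul, map_smul, ← pow_succ', hpow, smul_zero]
  -- So `u` kills every multiple of X - c₃. For a regular functional this would make X - c₃ the zero
  -- polynomial.
  refine X_sub_C_ne_zero c₃ (hP.eq_zero_of_forall_apply_mul fun k _ => ?_)
  have := hcomp ((P k).comp (X + C c₃))
  rwa [comp_assoc, add_comp, X_comp, C_comp, sub_add_cancel, comp_X] at this

/-! ### Askey-Wilson polynomials -/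

theorem awCsucc_ne_zero_iff {q m a b c d : ℂ} (hqn : ∀ n, 1 - q ^ (n + 1) ≠ 0)
    (hp : ∀ j, 1 - a * b * c * d * q ^ j ≠ 0) (n : ℕ) :
    awCsucc q m a b c d n ≠ 0 ↔ m * (1 - a * b * c * d * q ^ n) * (1 - a * b * q ^ n)
          * (1 - a * c * q ^ n) * (1 - a * d * q ^ n) * (1 - b * c * q ^ n)
          * (1 - b * d * q ^ n) * (1 - c * d * q ^ n) ≠ 0 := by
  have hR : awRatio q (a * b * c * d) n ≠ 0 := by
    rcases n with _ | n
    · simp [awRatio]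
    · rw [awRatio, if_neg n.succ_ne_zero,
        show ((n + 1 : ℕ) : ℤ) - 1 = (n : ℕ) by push_cast; ring,
        show 2 * ((n + 1 : ℕ) : ℤ) - 1 = ((2 * n + 1 : ℕ) : ℤ) by push_cast; ring, zpow_natCast,
        zpow_natCast]
      exact div_ne_zero (hp _) (hp _)
  simp only [awCsucc, ne_eq, div_eq_zero_iff, mul_eq_zero, pow_eq_zero_iff two_ne_zero, hR, hqn, hp,
    or_false]
  tauto

/-- The Askey-Wilson case for a fixed regular-admissible functional. -/
theorem aw_polynomials {q : ℝ} {c₁ c₂ c₃ r a b c d : ℂ} (hq : 0 < q) (hq1 : q ≠ 1)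
    (hx : IsLattice (qLattice q c₁ c₂ c₃)) (hr : r ^ 2 = c₁ * c₂) {u : Module.Dual ℂ ℂ[X]}
    (hu : u ≠ 0) (hGP : GPEquation hx (awPhi r c₃ a b c d) (awPsi q r c₃ a b c d) u)
    {P : ℕ → ℂ[X]} (hP : IsMonicOPS u P) :
    (∃ B : ℕ → ℂ, SatisfiesTTRR P B (awCsucc q (c₁ * c₂) a b c d) ∧
        (a ≠ 0 → ∀ n, B n = awB q r c₃ a b c d n) ∧
        (a = 0 → ∀ n, Tendsto (fun t : ℂ => awB q r c₃ t b c d n) (𝓝[≠] 0) (𝓝 (B n)))) ∧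
      (a ≠ 0 → ∀ (n : ℕ) (z : ℂ), (P n).eval z =
        2 ^ n * r ^ n * (awMonic q a b c d n).eval ((z - c₃) / (2 * r))) ∧
      (a = 0 → ∀ (n : ℕ) (z : ℂ),
        Tendsto (fun t : ℂ =>
            2 ^ n * r ^ n * (awMonic q t b c d n).eval ((z - c₃) / (2 * r)))
          (𝓝[≠] 0) (𝓝 ((P n).eval z))) := by
  have hr0 := aw_sqrt_ne_zero hq hq1 hx hr hGP hP.1
  have hp := aw_admissible hq hq1 hx hr hGP hP.1
  have h := isAWOps_qLattice hq hq1 hx hr hr0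
  have hann := apply_ttrr_awBreg_eq_zero hq hq1 h hGP.apply_pearsonOp hp
  have hPeq := hP.eq_ttrr hann hu
  have hC := (isRegularFunctional_iff_of_ttrr hann hu).mp ⟨P, hP.1⟩
  have hcond := fun n => (awCsucc_ne_zero_iff h.one_sub_q_pow hp n).mp (hC n)
  rw [← hr]
  subst hPeq
  refine ⟨⟨awBreg q r c₃ a b c d, satisfiesTTRR_ttrr _ _,
    fun ha n => (awB_eq_awBreg ha fun j _ => hp j).symm, ?_⟩, ?_, ?_⟩
  -- For a = 0 the coefficient is `awBreg` at 0. It is the limit of `awB` because the two agree at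
  -- small non-zero parameters.
  · rintro rfl n
    have ht : Tendsto (fun s => awBreg q r c₃ s b c d n) (𝓝[≠] 0)
        (𝓝 (awBreg q r c₃ 0 b c d n)) :=
      (continuousAt_awBreg fun j _ => hp j).tendsto.mono_left nhdsWithin_le_nhds
    refine ht.congr' ?_
    filter_upwards [eventually_aw_generic q 0 b c d (n + 1)] with s hs
    exact (awB_eq_awBreg hs.1 fun j hj => hs.2.2 j (by omega)).symm
  · intro ha n z
    rw [eval_awMonic hr0, ttrr_awBreg_eq h.q_ne h.one_sub_q_pow hr0 ha (fun k _ => ?_)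
      fun j _ => hp j]
    have := hcond k
    simp only [ne_eq, mul_eq_zero, not_or] at this
    exact mul_ne_zero (mul_ne_zero this.1.1.1.1.1.2 this.1.1.1.1.2) this.1.1.1.2
  · rintro rfl n z
    have ht := tendsto_ttrr (l := 𝓝[≠] (0 : ℂ))
      (B := fun s => awBreg q r c₃ s b c d) (Cs := fun s => awCsucc q (r ^ 2) s b c d)
      (fun k => (continuousAt_awBreg fun j _ => hp j).tendsto.mono_left nhdsWithin_le_nhds)
      (fun k => (continuousAt_awCsucc fun j _ => hp j).tendsto.mono_left nhdsWithin_le_nhds)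
      n (leval z)
    refine ht.congr' ?_
    filter_upwards [eventually_aw_generic q 0 b c d n] with s hs
    rw [eval_awMonic hr0, ← ttrr_awBreg_eq h.q_ne h.one_sub_q_pow hr0 hs.1 hs.2.1 hs.2.2]
    rfl

/-- The conditions r ≠ 0 and abcd q^j ≠ 1, under which the recurrence is available, follow from
either side: from regularity by the two necessity results, from the product condition by looking at
its factors. -/
theorem aw_regular_iff {q : ℝ} {c₁ c₂ c₃ r a b c d : ℂ} (hq : 0 < q) (hq1 : q ≠ 1)
    (hx : IsLattice (qLattice q c₁ c₂ c₃)) (hr : r ^ 2 = c₁ * c₂) {u : Module.Dual ℂ ℂ[X]}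
    (hu : u ≠ 0) (hGP : GPEquation hx (awPhi r c₃ a b c d) (awPsi q r c₃ a b c d) u) :
    IsRegularFunctional u ↔
      ∀ n : ℕ, c₁ * c₂ * (1 - a * b * c * d * (q : ℂ) ^ n) * (1 - a * b * (q : ℂ) ^ n)
          * (1 - a * c * (q : ℂ) ^ n) * (1 - a * d * (q : ℂ) ^ n) * (1 - b * c * (q : ℂ) ^ n)
          * (1 - b * d * (q : ℂ) ^ n) * (1 - c * d * (q : ℂ) ^ n) ≠ 0 := by
  have main : r ≠ 0 → (∀ j : ℕ, 1 - a * b * c * d * (q : ℂ) ^ j ≠ 0) → (IsRegularFunctional u ↔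
      ∀ n : ℕ, c₁ * c₂ * (1 - a * b * c * d * (q : ℂ) ^ n) * (1 - a * b * (q : ℂ) ^ n)
          * (1 - a * c * (q : ℂ) ^ n) * (1 - a * d * (q : ℂ) ^ n) * (1 - b * c * (q : ℂ) ^ n)
          * (1 - b * d * (q : ℂ) ^ n) * (1 - c * d * (q : ℂ) ^ n) ≠ 0) := by
    intro hr0 hp
    have h := isAWOps_qLattice hq hq1 hx hr hr0
    rw [isRegularFunctional_iff_of_ttrr
      (apply_ttrr_awBreg_eq_zero hq hq1 h hGP.apply_pearsonOp hp) hu, hr]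
    exact forall_congr' fun n => awCsucc_ne_zero_iff h.one_sub_q_pow hp n
  constructor
  · rintro ⟨P, hP⟩
    exact (main (aw_sqrt_ne_zero hq hq1 hx hr hGP hP) (aw_admissible hq hq1 hx hr hGP hP)).mp ⟨P, hP⟩
  · intro hall
    refine (main ?_ fun j => ?_).mpr hall
    · rintro rfl
      apply hall 0
      rw [← hr]
      ring
    · have := hall j
      simp only [ne_eq, mul_eq_zero, not_or] at this
      exact this.1.1.1.1.1.1.2

/-! ### The quadratic lattice -/

theorem poch_zero (x : ℂ) : poch x 0 = 1 := by simp [poch]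

theorem poch_succ (x : ℂ) (n : ℕ) : poch x (n + 1) = poch x n * (x + n) := by
  rw [poch, ascPochhammer_succ_eval, poch]

theorem poch_succ' (x : ℂ) (n : ℕ) : poch x (n + 1) = x * poch (x + 1) n := by
  simp [poch, ascPochhammer_succ_left, eval_comp]

theorem poch_ne_zero {x : ℂ} {n : ℕ} (h : ∀ j < n, x + j ≠ 0) : poch x n ≠ 0 := by
  induction n with
  | zero => simp [poch_zero]
  | succ n ih =>
    rw [poch_succ]
    exact mul_ne_zero (ih fun j hj => h j (by omega)) (h n (by omega))

/-- `∏_{j<k} ((j + e) (j + e + σ) - X)`. -/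
noncomputable def quadBasis (σ e : ℂ) (k : ℕ) : ℂ[X] :=
  ∏ j ∈ Finset.range k, (C (((j : ℂ) + e) * (j + e + σ)) - X)

theorem quadBasis_succ (σ e : ℂ) (k : ℕ) :
    quadBasis σ e (k + 1) = quadBasis σ e k * (C (((k : ℂ) + e) * (k + e + σ)) - X) :=
  Finset.prod_range_succ _ _

theorem racahBasis_eq (a b : ℂ) (k : ℕ) : racahBasis a b k = quadBasis (a + b + 1) 0 k := by
  refine Finset.prod_congr rfl fun j _ => ?_
  congr 2
  ring

theorem eval_quadBasis (σ e s : ℂ) (k : ℕ) :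
    (quadBasis σ e k).eval (s * (s + σ)) = poch (e - s) k * poch (e + s + σ) k := by
  induction k with
  | zero => simp [quadBasis, poch_zero]
  | succ k ih =>
    rw [quadBasis_succ, eval_mul, ih, poch_succ, poch_succ, eval_sub, eval_C, eval_X]
    ring

/-- Divided difference and averaging operators of the lattice `s (s + σ)`. -/
structure IsQuadOps (D S : ℂ[X] →ₗ[ℂ] ℂ[X]) (σ : ℂ) : Prop where
  D_eval : ∀ (f : ℂ[X]) (s : ℂ), 2 * s + σ ≠ 0 → (D f).eval (s * (s + σ)) =
    (f.eval ((s + 1 / 2) * (s + 1 / 2 + σ)) - f.eval ((s - 1 / 2) * (s - 1 / 2 + σ))) / (2 * s + σ)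
  S_eval : ∀ (f : ℂ[X]) (s : ℂ), (S f).eval (s * (s + σ)) =
    (f.eval ((s + 1 / 2) * (s + 1 / 2 + σ)) + f.eval ((s - 1 / 2) * (s - 1 / 2 + σ))) / 2
  poly_ext : ∀ f g : ℂ[X], (∀ s, 2 * s + σ ≠ 0 →
    f.eval (s * (s + σ)) = g.eval (s * (s + σ))) → f = g

theorem isQuadOps_racah (a b : ℂ) :
    IsQuadOps (xDeriv (isLattice_racah a b)) (xAver (isLattice_racah a b)) (a + b + 1) := by
  have hx : ∀ s, racahLattice a b s = s * (s + (a + b + 1)) := fun s => by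
    rw [racahLattice]; ring
  have hd : ∀ s, racahLattice a b (s + 1 / 2) - racahLattice a b (s - 1 / 2) =
      2 * s + (a + b + 1) := fun s => by rw [hx, hx]; ring
  have hne : ∀ s, racahLattice a b (s + 1 / 2) ≠ racahLattice a b (s - 1 / 2) ↔
      2 * s + (a + b + 1) ≠ 0 := fun s => by rw [← hd, sub_ne_zero]
  refine ⟨fun f s hs => ?_, fun f s => ?_, fun f g h => ?_⟩
  · have := xDeriv_spec (isLattice_racah a b) f s ((hne s).mpr hs)
    rwa [hd, hx, hx, hx] at this
  · have := xAver_spec (isLattice_racah a b) f s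
    rwa [hx, hx, hx] at this
  · refine (isLattice_racah a b).poly_ext fun s hs => ?_
    rw [hx]
    exact h s ((hne s).mp hs)

/-- The neighbours of x have mean x + 1/4, and their squared difference is (2s + σ)² = 4x + σ², with
σ = a + b + 1. -/
theorem latticeRules_racah (a b : ℂ) :
    LatticeRules (xDeriv (isLattice_racah a b)) (xAver (isLattice_racah a b)) 1 (1 / 4)
      ((a + b + 1) ^ 2 / 4) := by
  refine (isLattice_racah a b).latticeRules _ _ _ ?_ ?_
  · intro s
    simp only [racahLattice]
    ring
  · intro s
    simp only [racahLattice]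
    ring

/-! ### The Racah series as an eigenfunction. -/

/-- The product `(d + 1 + k) (c + b + 1 + k) (a + 1 + k)`. -/
noncomputable def racahF (a b c d : ℂ) (k : ℕ) : ℂ := (d + 1 + k) * (c + b + 1 + k) * (a + 1 + k)

/-- The coefficients of the series `₄F₃` of the Racah polynomials. -/
noncomputable def racahCoef (a b c d : ℂ) (n k : ℕ) : ℂ :=
  poch (-(n : ℂ)) k * poch (n + d + c + 1) k
    / (poch (d + 1) k * poch (c + b + 1) k * poch (a + 1) k * (k.factorial : ℂ))

/-- The series `₄F₃` of the Racah polynomials. -/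
noncomputable def racahSeries (a b c d : ℂ) (n : ℕ) : ℂ[X] :=
  ∑ k ∈ Finset.range (n + 1), C (racahCoef a b c d n k) * quadBasis (a + b + 1) 0 k

theorem racahCoef_zero (a b c d : ℂ) (n : ℕ) : racahCoef a b c d n 0 = 1 := by
  simp [racahCoef, poch_zero]

theorem poch_neg_eq_zero {n k : ℕ} (h : n < k) : poch (-(n : ℂ)) k = 0 := by
  induction k with
  | zero => omega
  | succ k ih =>
    rw [poch_succ]
    rcases (Nat.lt_succ_iff.mp h).eq_or_lt with rfl | h
    · simp
    · rw [ih h, zero_mul]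

theorem racahCoef_eq_zero (a b c d : ℂ) {n k : ℕ} (h : n < k) : racahCoef a b c d n k = 0 := by
  rw [racahCoef, poch_neg_eq_zero h]
  simp

theorem racahCoef_denom_succ (a b c d : ℂ) (k : ℕ) :
    poch (d + 1) (k + 1) * poch (c + b + 1) (k + 1) * poch (a + 1) (k + 1)
      * ((k + 1).factorial : ℂ) =
    (poch (d + 1) k * poch (c + b + 1) k * poch (a + 1) k * (k.factorial : ℂ)) *
      (racahF a b c d k * (k + 1)) := by
  simp only [poch_succ, racahF, Nat.factorial_succ]
  push_cast
  ring

theorem racahCoef_succ {a b c d : ℂ} {n k : ℕ} (hF : racahF a b c d k ≠ 0) :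
    racahCoef a b c d n (k + 1) * (racahF a b c d k * (k + 1)) =
      racahCoef a b c d n k * ((k - n) * (n + d + c + 1 + k)) := by
  have hk : (k + 1 : ℂ) ≠ 0 := Nat.cast_add_one_ne_zero k
  rw [racahCoef, racahCoef_denom_succ, ← div_div, div_mul_cancel₀ _ (mul_ne_zero hF hk),
    poch_succ, poch_succ, racahCoef]
  ring

theorem racahSeries_eq_sum (a b c d : ℂ) {n M : ℕ} (h : n + 1 ≤ M) :
    racahSeries a b c d n =
      ∑ k ∈ Finset.range M, C (racahCoef a b c d n k) * quadBasis (a + b + 1) 0 k := by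
  refine Finset.sum_subset (Finset.range_subset_range.mpr h) fun k _ hk => ?_
  rw [racahCoef_eq_zero _ _ _ _ (by simpa using hk), C_0, zero_mul]

namespace IsQuadOps

variable {D S : ℂ[X] →ₗ[ℂ] ℂ[X]} {σ : ℂ}

theorem D_one (h : IsQuadOps D S σ) : D 1 = 0 :=
  h.poly_ext _ _ fun s hs => by rw [h.D_eval _ _ hs]; simp

/-- The values at s ± 1/2 share the product centred at 1/2. The remaining outer factors differ by
-(k + 1)(2s + σ). -/
theorem D_basis (h : IsQuadOps D S σ) (k : ℕ) :
    D (quadBasis σ 0 (k + 1)) = C (-((k : ℂ) + 1)) * quadBasis σ (1 / 2) k := by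
  refine h.poly_ext _ _ fun s hs => ?_
  rw [h.D_eval _ _ hs, eval_quadBasis, eval_quadBasis, eval_mul, eval_C, eval_quadBasis]
  rw [poch_succ' (0 - (s + 1 / 2)), poch_succ (0 + (s + 1 / 2) + σ), poch_succ (0 - (s - 1 / 2)),
    poch_succ' (0 + (s - 1 / 2) + σ), show 0 - (s + 1 / 2) + 1 = 1 / 2 - s by ring,
    show 0 + (s + 1 / 2) + σ = 1 / 2 + s + σ by ring, show 0 - (s - 1 / 2) = 1 / 2 - s by ring,
    show 0 + (s - 1 / 2) + σ + 1 = 1 / 2 + s + σ by ring, div_eq_iff hs]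
  ring

/-- Let Θ(s) = (s + σ)(s + a + 1)(s + d + 1)(s + b + c + 1) and Θ*(s) = Θ(-σ - s), the reflection
that fixes the lattice. On the lattice φ is Θ + Θ* and ψ is 2(Θ - Θ*)/(2s + σ). So the operator
sends f to 2(Θ f(s + 1/2) - Θ* f(s - 1/2))/(2s + σ), and the factors s + σ and -s complete the
products centred at 1/2 to those centred at 0. -/
theorem pearsonOp_basis {a b c d : ℂ} (h : IsQuadOps D S (a + b + 1)) (k : ℕ) :
    pearsonOp D S (racahPhi a b c d) (racahPsi a b c d) (quadBasis (a + b + 1) (1 / 2) k) =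
      C (2 * racahF a b c d k) * quadBasis (a + b + 1) 0 k
        - C (2 * (k + d + c + 2)) * quadBasis (a + b + 1) 0 (k + 1) := by
  refine h.poly_ext _ _ fun s hs => ?_
  rw [pearsonOp_apply, eval_add, eval_mul, eval_mul, h.D_eval _ _ hs, h.S_eval, eval_quadBasis,
    eval_quadBasis]
  simp only [eval_mul, eval_C, eval_sub, eval_quadBasis]
  set σ := a + b + 1 with hσ
  rw [show 1 / 2 - (s + 1 / 2) = 0 - s by ring, show 1 / 2 + (s + 1 / 2) + σ = 0 + s + σ + 1 by ring,
    show 1 / 2 - (s - 1 / 2) = 0 - s + 1 by ring, show 1 / 2 + (s - 1 / 2) + σ = 0 + s + σ by ring]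
  have hU : -s * poch (0 - s + 1) k = poch (0 - s) k * (k - s) := by
    rw [← zero_sub, ← poch_succ', poch_succ]; ring
  have hV : (s + σ) * poch (0 + s + σ + 1) k = poch (0 + s + σ) k * (s + σ + k) := by
    rw [show s + σ = 0 + s + σ by ring, ← poch_succ', poch_succ]
  rw [poch_succ, poch_succ]
  generalize poch (0 - s + 1) k = U' at *
  generalize poch (0 + s + σ + 1) k = V' at *
  generalize poch (0 - s) k = U at *
  generalize poch (0 + s + σ) k = V at *
  have hA : (racahPhi a b c d).eval (s * (s + σ)) =
      2 * (s + σ) * ((s + a + 1) * (s + d + 1) * (s + b + c + 1))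
      - (racahPsi a b c d).eval (s * (s + σ)) * (2 * s + σ) / 2 := by
    simp only [racahPhi, racahPsi, eval_add, eval_mul, eval_C, eval_X, eval_pow, hσ]
    ring
  have hB : (racahPsi a b c d).eval (s * (s + σ)) * (2 * s + σ) =
      2 * (s + σ) * ((s + a + 1) * (s + d + 1) * (s + b + c + 1))
      - 2 * (-s) * ((-σ - s + a + 1) * (-σ - s + d + 1) * (-σ - s + b + c + 1)) := by
    simp only [racahPsi, eval_add, eval_mul, eval_C, eval_X, hσ]
    ring
  rw [hA]
  generalize (racahPsi a b c d).eval (s * (s + σ)) = ψ at *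
  have e : (2 * (s + σ) * ((s + a + 1) * (s + d + 1) * (s + b + c + 1)) - ψ * (2 * s + σ) / 2) *
      ((U * V' - U' * V) / (2 * s + σ)) + ψ * ((U * V' + U' * V) / 2) =
      (2 * ((s + a + 1) * (s + d + 1) * (s + b + c + 1)) * U * ((s + σ) * V')
        - (2 * (s + σ) * ((s + a + 1) * (s + d + 1) * (s + b + c + 1)) - ψ * (2 * s + σ))
          * U' * V) / (2 * s + σ) := by
    field_simp
    ring
  rw [e, hB, div_eq_iff hs, hV, racahF]
  have e2 : (2 * (s + σ) * ((s + a + 1) * (s + d + 1) * (s + b + c + 1)) -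
      (2 * (s + σ) * ((s + a + 1) * (s + d + 1) * (s + b + c + 1)) -
        2 * -s * ((-σ - s + a + 1) * (-σ - s + d + 1) * (-σ - s + b + c + 1)))) * U' * V =
      2 * ((-σ - s + a + 1) * (-σ - s + d + 1) * (-σ - s + b + c + 1)) * V * (-s * U') := by ring
  rw [e2, hU, hσ]
  ring

/-- The Racah series is an eigenfunction of the second order operator. -/
theorem pearsonOp_racahSeries {a b c d : ℂ} (h : IsQuadOps D S (a + b + 1)) (n : ℕ)
    (hF : ∀ k ≤ n, racahF a b c d k ≠ 0) :
    pearsonOp D S (racahPhi a b c d) (racahPsi a b c d) (D (racahSeries a b c d (n + 1))) =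
      C (2 * (n + 1) * (n + d + c + 2)) * racahSeries a b c d (n + 1) := by
  set y := racahCoef a b c d (n + 1) with hy
  set Φ := quadBasis (a + b + 1) 0 with hΦ
  -- `lam + σ (k + 1)` = 2(k + 1)(k + d + c + 2) is the diagonal entry at index k + 1, and the term
  -- ratio gives -σ_k y_k below it. The sum telescopes between σ_{n+1} = 0 and -σ_0 = `lam`.
  set σ : ℕ → ℂ := fun k => 2 * ((k - (n + 1)) * (n + d + c + 2 + k)) with hσ
  set lam : ℂ := 2 * (n + 1) * (n + d + c + 2) with hlam
  have hlσ : lam = -σ 0 := by simp [hlam, hσ]; ring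
  have hσn : σ (n + 1) = 0 := by simp [hσ]
  have e1 : ∀ k ≤ n, y (k + 1) * (2 * (racahF a b c d k * (k + 1))) = σ k * y k := by
    intro k hk
    have h1 := racahCoef_succ (n := n + 1) (hF k hk)
    rw [hy, mul_left_comm, h1]
    simp only [hσ]
    push_cast
    ring
  have hterm : ∀ k, pearsonOp D S (racahPhi a b c d) (racahPsi a b c d) (D (Φ (k + 1))) =
      C (lam + σ (k + 1)) * Φ (k + 1) - C (2 * (racahF a b c d k * (k + 1))) * Φ k := by
    intro k
    have e2 : lam + σ (k + 1) = (k + 1) * (2 * (k + d + c + 2)) := by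
      simp only [hlam, hσ]; push_cast; ring
    rw [hΦ, h.D_basis, ← smul_eq_C_mul, map_smul, h.pearsonOp_basis, smul_eq_C_mul, e2]
    simp only [C_mul, C_neg]
    ring
  have hsum : pearsonOp D S (racahPhi a b c d) (racahPsi a b c d)
      (D (racahSeries a b c d (n + 1))) =
      ∑ k ∈ Finset.range (n + 1), (C (lam * y (k + 1)) * Φ (k + 1)
        + (C (σ (k + 1) * y (k + 1)) * Φ (k + 1) - C (σ k * y k) * Φ k)) := by
    rw [racahSeries, Finset.sum_range_succ', ← hy, ← hΦ]
    have h0 : Φ 0 = 1 := by simp [hΦ, quadBasis]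
    rw [h0, ← smul_eq_C_mul, map_add, map_smul, h.D_one, smul_zero, add_zero, map_sum, map_sum]
    refine Finset.sum_congr rfl fun k hk => ?_
    have hk : k ≤ n := by simpa [Nat.lt_succ_iff] using hk
    rw [← smul_eq_C_mul, map_smul, map_smul, hterm, smul_eq_C_mul, ← e1 k hk]
    simp only [C_mul, C_add]
    ring
  rw [hsum, Finset.sum_add_distrib, Finset.sum_range_sub (fun k => C (σ k * y k) * Φ k), hσn,
    racahSeries, Finset.sum_range_succ' _ (n + 1), ← hy, ← hΦ, mul_add, Finset.mul_sum, hlσ]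
  simp only [C_mul, C_neg, C_0, zero_mul, mul_assoc]
  ring

end IsQuadOps

/-! ### The recurrence relation of the Racah series -/

/-- The coefficient `A_n` of the recurrence relation of the Racah series. -/
noncomputable def racahA (a b c d : ℂ) (n : ℕ) : ℂ :=
  racahF a b c d n * racahRatio (d + c) n / (2 * n + d + c + 2)

/-- The coefficient `C_n` of the recurrence relation of the Racah series. -/
noncomputable def racahC (a b c d : ℂ) (n : ℕ) : ℂ :=
  n * (n + c) * (n + d + c - a) * (n + d - b) / ((2 * n + d + c) * (2 * n + d + c + 1))

theorem racahA_succ (a b c d : ℂ) (n : ℕ) : racahA a b c d (n + 1) =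
    racahF a b c d (n + 1) * (n + d + c + 2) / ((2 * n + d + c + 3) * (2 * n + d + c + 4)) := by
  rw [racahA, racahRatio, if_neg n.succ_ne_zero]
  push_cast
  rw [← mul_div_assoc, div_div]
  ring_nf

theorem racahC_succ (a b c d : ℂ) (n : ℕ) : racahC a b c d (n + 1) =
    (n + 1) * (n + 1 + c) * (n + 1 + d + c - a) * (n + 1 + d - b) /
      ((2 * n + d + c + 2) * (2 * n + d + c + 3)) := by
  rw [racahC]
  push_cast
  ring_nf

/-- N and L stand for n and k, while m and τ stand for d + c + 1 and a + b + 1. Each difference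
acquires the factor L + 1, after which only `hcore` is left. -/
theorem racah_step_identity {F F' f m N L τ P₁ P₂ P₃ : ℂ} (hF : F ≠ 0) (hL : L + 1 ≠ 0)
    (hN : N + 1 ≠ 0) (hm : N + 1 + m ≠ 0) (hP₁ : P₁ ≠ 0) (hP₂ : P₂ ≠ 0) (hP₃ : P₃ ≠ 0)
    (e₁ : P₁ = 2 * N + 1 + m) (e₃ : P₃ = 2 * N + 3 + m)
    (hcore : ((L - N - 1) * (N + 1 + m + L) * (L + 1 + τ) - F) * P₂ =
      -F' * (N + 1 + m + L) - f * (L - N - 1)) :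
    (L - N - 1) * (N + 1 + m + L) / (F * (L + 1)) * ((L + 1) * (L + 1 + τ)) - 1 =
      F' * (N + 1 + m) / (P₂ * P₃) *
        ((-N - 2) * ((N + 1 + m + L) / (N + 1 + m)) * (N + 2 + m + L) / (F * (L + 1))
          - (L - N - 1) * (N + 1 + m + L) / (F * (L + 1)))
      - (N + 1) * f / (P₁ * P₂) *
        ((L - N - 1) * (N + 1 + m + L) / (F * (L + 1))
          - (L - N - 1) / (-(N + 1)) * (L - N) * (N + m) / (F * (L + 1))) := by
  have d₁ : F' * (N + 1 + m) / (P₂ * P₃) *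
      ((-N - 2) * ((N + 1 + m + L) / (N + 1 + m)) * (N + 2 + m + L)
        - (L - N - 1) * (N + 1 + m + L)) = -F' * (N + 1 + m + L) * (L + 1) / P₂ := by
    field_simp
    rw [e₃]
    ring
  have d₂ : (N + 1) * f / (P₁ * P₂) * ((L - N - 1) * (N + 1 + m + L)
      - (L - N - 1) / (-(N + 1)) * (L - N) * (N + m)) = f * (L - N - 1) * (L + 1) / P₂ := by
    rw [div_neg]
    field_simp
    rw [e₁]
    ring
  have e : ∀ A U V G : ℂ, A * (U / G - V / G) = A * (U - V) / G := fun A U V G => by ring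
  rw [e, e, d₁, d₂]
  field_simp
  linear_combination hcore

theorem racahCoef_recurrence {a b c d : ℂ} {n k : ℕ} (hF : racahF a b c d k ≠ 0)
    (hm : ∀ j : ℕ, d + c + 2 + j ≠ 0) :
    racahCoef a b c d (n + 1) (k + 1) * ((k + 1) * (k + 1 + (a + b + 1)))
        - racahCoef a b c d (n + 1) k =
      racahA a b c d (n + 1) * (racahCoef a b c d (n + 2) (k + 1) - racahCoef a b c d (n + 1) (k + 1))
      - racahC a b c d (n + 1) *
        (racahCoef a b c d (n + 1) (k + 1) - racahCoef a b c d n (k + 1)) := by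
  have hk : (k + 1 : ℂ) ≠ 0 := Nat.cast_add_one_ne_zero k
  have hn : (n + 1 : ℂ) ≠ 0 := Nat.cast_add_one_ne_zero n
  have hm0 : (n + 1 + (d + c + 1) : ℂ) ≠ 0 := by
    have := hm n; intro h0; apply this; linear_combination h0
  have hm1 : (2 * n + d + c + 2 : ℂ) ≠ 0 := by
    have := hm (2 * n); push_cast at this; intro h0; apply this; linear_combination h0
  have hm2 : (2 * n + d + c + 3 : ℂ) ≠ 0 := by
    have := hm (2 * n + 1); push_cast at this; intro h0; apply this; linear_combination h0
  have hm3 : (2 * n + d + c + 4 : ℂ) ≠ 0 := by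
    have := hm (2 * n + 2); push_cast at this; intro h0; apply this; linear_combination h0
  set α := poch (-((n + 1 : ℕ) : ℂ)) k with hα
  set β := poch (n + 1 + (d + c + 1)) k with hβ
  set W := poch (d + 1) k * poch (c + b + 1) k * poch (a + 1) k * (k.factorial : ℂ) with hW
  have hα' : poch (-(n : ℂ)) k = α * ((k - n - 1) / (-(n + 1))) := by
    rw [← mul_div_assoc, eq_div_iff (neg_ne_zero.mpr hn), hα, mul_comm,
      show (-(n : ℂ)) = -((n + 1 : ℕ) : ℂ) + 1 by push_cast; ring,
      show -((n : ℂ) + 1) = -((n + 1 : ℕ) : ℂ) by push_cast; ring, ← poch_succ', poch_succ]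
    push_cast
    ring
  have hβ' : poch (n + 1 + (d + c + 1) + 1) k =
      β * ((n + 1 + (d + c + 1) + k) / (n + 1 + (d + c + 1))) := by
    rw [← mul_div_assoc, eq_div_iff hm0, hβ, mul_comm, ← poch_succ', poch_succ]
  have y0 : racahCoef a b c d (n + 1) k = α * β / W := by
    rw [racahCoef, ← hW, ← hα, hβ]
    push_cast
    ring_nf
  have y1 : racahCoef a b c d (n + 1) (k + 1) = α * β / W * ((k - n - 1) *
      (n + 1 + (d + c + 1) + k) / (racahF a b c d k * (k + 1))) := by
    rw [racahCoef, racahCoef_denom_succ, ← hW, poch_succ, poch_succ, ← hα,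
      show ((n + 1 : ℕ) : ℂ) + d + c + 1 = n + 1 + (d + c + 1) by push_cast; ring, ← hβ,
      div_mul_div_comm]
    push_cast
    ring
  have y2 : racahCoef a b c d (n + 2) (k + 1) = α * β / W * ((-n - 2) *
      ((n + 1 + (d + c + 1) + k) / (n + 1 + (d + c + 1))) * (n + 2 + (d + c + 1) + k) /
        (racahF a b c d k * (k + 1))) := by
    rw [racahCoef, racahCoef_denom_succ, ← hW, poch_succ' (-((n + 2 : ℕ) : ℂ)), poch_succ,
      show -((n + 2 : ℕ) : ℂ) + 1 = -((n + 1 : ℕ) : ℂ) by push_cast; ring, ← hα,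
      show ((n + 2 : ℕ) : ℂ) + d + c + 1 = n + 1 + (d + c + 1) + 1 by push_cast; ring, hβ',
      div_mul_div_comm]
    push_cast
    ring
  have y3 : racahCoef a b c d n (k + 1) = α * β / W * ((k - n - 1) / (-(n + 1)) * (k - n) *
      (n + (d + c + 1)) / (racahF a b c d k * (k + 1))) := by
    rw [racahCoef, racahCoef_denom_succ, ← hW, poch_succ, hα', poch_succ',
      show (n : ℂ) + d + c + 1 + 1 = n + 1 + (d + c + 1) by ring, ← hβ, div_mul_div_comm]
    ring
  have hid := racah_step_identity (N := n) (L := k) (m := d + c + 1) (τ := a + b + 1)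
    (F' := racahF a b c d (n + 1)) (f := (n + 1 + c) * (n + 1 + d + c - a) * (n + 1 + d - b))
    hF hk hn hm0 hm1 hm2 hm3 (by ring) (by ring) (by
      rw [racahF, racahF]
      push_cast
      ring)
  rw [y0, y1, y2, y3, racahA_succ, racahC_succ]
  rw [show (n : ℂ) + d + c + 2 = n + 1 + (d + c + 1) by ring]
  generalize α * β / W = Z at *
  linear_combination Z * hid

/-- The three-term recurrence relation of the Racah series. -/
theorem racahSeries_recurrence {a b c d : ℂ} {n : ℕ} (hF : ∀ k ≤ n + 1, racahF a b c d k ≠ 0)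
    (hm : ∀ j : ℕ, d + c + 2 + j ≠ 0) (z : ℂ) :
    z * (racahSeries a b c d (n + 1)).eval z =
      racahA a b c d (n + 1) * (racahSeries a b c d (n + 2)).eval z
      - (racahA a b c d (n + 1) + racahC a b c d (n + 1)) * (racahSeries a b c d (n + 1)).eval z
      + racahC a b c d (n + 1) * (racahSeries a b c d n).eval z := by
  set y := racahCoef a b c d with hy
  set Φ : ℕ → ℂ := fun k => (quadBasis (a + b + 1) 0 k).eval z with hΦ
  set A := racahA a b c d (n + 1)
  set C' := racahC a b c d (n + 1)
  have hs : ∀ m ≤ n + 2, (racahSeries a b c d m).eval z =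
      ∑ k ∈ Finset.range (n + 3), y m k * Φ k := by
    intro m hm
    rw [racahSeries_eq_sum a b c d (by omega : m + 1 ≤ n + 3), eval_finsetSum]
    simp [hΦ, hy]
  have hE : ∀ k : ℕ, z * Φ k = k * (k + (a + b + 1)) * Φ k - Φ (k + 1) := by
    intro k
    simp only [hΦ, quadBasis_succ, eval_mul, eval_sub, eval_C, eval_X]
    ring
  rw [hs _ le_rfl, hs _ (by omega : n + 1 ≤ n + 2), hs _ (by omega : n ≤ n + 2), Finset.mul_sum]
  have e1 : ∑ k ∈ Finset.range (n + 3), z * (y (n + 1) k * Φ k) =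
      ∑ k ∈ Finset.range (n + 2), (y (n + 1) (k + 1) * ((k + 1) * (k + 1 + (a + b + 1)))
        - y (n + 1) k) * Φ (k + 1) := by
    have h1 : ∀ k, z * (y (n + 1) k * Φ k) =
        y (n + 1) k * (k * (k + (a + b + 1))) * Φ k - y (n + 1) k * Φ (k + 1) := fun k => by
      linear_combination y (n + 1) k * hE k
    simp only [h1, Finset.sum_sub_distrib, sub_mul]
    rw [Finset.sum_range_succ', Finset.sum_range_succ (fun k => y (n + 1) k * Φ (k + 1)),
      hy, racahCoef_eq_zero a b c d (by omega : n + 1 < n + 2)]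
    simp
  have e2 : A * ∑ k ∈ Finset.range (n + 3), y (n + 2) k * Φ k
      - (A + C') * ∑ k ∈ Finset.range (n + 3), y (n + 1) k * Φ k
      + C' * ∑ k ∈ Finset.range (n + 3), y n k * Φ k =
      ∑ k ∈ Finset.range (n + 3), (A * (y (n + 2) k - y (n + 1) k)
        - C' * (y (n + 1) k - y n k)) * Φ k := by
    simp only [Finset.mul_sum, ← Finset.sum_add_distrib, ← Finset.sum_sub_distrib]
    exact Finset.sum_congr rfl fun k _ => by ring
  rw [e1, e2, Finset.sum_range_succ' _ (n + 2)]
  rw [hy, racahCoef_zero, racahCoef_zero, racahCoef_zero, ← hy]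
  simp only [sub_self, mul_zero, add_zero, zero_mul]
  refine Finset.sum_congr rfl fun k hk => ?_
  have hk : k ≤ n + 1 := by simpa [Nat.lt_succ_iff] using hk
  rw [hy, racahCoef_recurrence (hF k hk) hm]

/-! ### Normalisation and the recurrence of the monic Racah polynomials. -/

/-- The normalization which makes the Racah series monic. -/
noncomputable def racahNorm (a b c d : ℂ) (n : ℕ) : ℂ :=
  poch (d + 1) n * poch (c + b + 1) n * poch (a + 1) n / poch (n + d + c + 1) n

theorem racahNorm_succ {a b c d : ℂ} (hm : ∀ j : ℕ, d + c + 2 + j ≠ 0) (n : ℕ) :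
    racahNorm a b c d (n + 1) = racahNorm a b c d n * racahA a b c d n := by
  have hF : poch (d + 1) (n + 1) * poch (c + b + 1) (n + 1) * poch (a + 1) (n + 1) =
      (poch (d + 1) n * poch (c + b + 1) n * poch (a + 1) n) * racahF a b c d n := by
    simp only [poch_succ, racahF]; ring
  rw [racahNorm, racahNorm, hF]
  rcases n with _ | n
  · simp only [racahA, racahRatio, poch_zero, poch_succ, if_true]
    push_cast
    ring
  · rw [racahA_succ]
    set x : ℂ := n + d + c + 2 with hx
    have hs : ((n + 1 : ℕ) : ℂ) + d + c + 1 = x := by rw [hx]; push_cast; ring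
    have hs' : ((n + 1 + 1 : ℕ) : ℂ) + d + c + 1 = x + 1 := by rw [hx]; push_cast; ring
    rw [hs, hs']
    have h1 : x * poch (x + 1) (n + 1 + 1) =
        poch x (n + 1) * (2 * n + d + c + 3) * (2 * n + d + c + 4) := by
      rw [← poch_succ', poch_succ x (n + 2), poch_succ x (n + 1), hx]
      push_cast
      ring
    have h2 : poch x (n + 1) ≠ 0 := poch_ne_zero fun j _ h0 => hm (n + j) (by
      rw [← h0, hx]; push_cast; ring)
    have h3 : poch (x + 1) (n + 1 + 1) ≠ 0 := poch_ne_zero fun j _ h0 => hm (n + 1 + j) (by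
      rw [← h0, hx]; push_cast; ring)
    have h4 : 2 * (n : ℂ) + d + c + 3 ≠ 0 := fun h0 => hm (2 * n + 1) (by
      rw [← h0]; push_cast; ring)
    have h5 : 2 * (n : ℂ) + d + c + 4 ≠ 0 := fun h0 => hm (2 * n + 2) (by
      rw [← h0]; push_cast; ring)
    generalize racahF a b c d (n + 1) = F
    generalize poch (d + 1) (n + 1) * poch (c + b + 1) (n + 1) * poch (a + 1) (n + 1) = W
    generalize poch (x + 1) (n + 1 + 1) = Q' at *
    generalize poch x (n + 1) = Q at *
    generalize 2 * (n : ℂ) + d + c + 3 = f₁ at *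
    generalize 2 * (n : ℂ) + d + c + 4 = f₂ at *
    clear_value x
    field_simp
    linear_combination (-(W * F)) * h1

theorem racahB_eq (a b c d : ℂ) (n : ℕ) :
    racahB a b c d n = -racahA a b c d n - racahC a b c d n := by
  rw [racahB, racahA, racahC, racahF]
  congr 2
  ring

theorem racahCsucc_eq (a b c d : ℂ) (n : ℕ) :
    racahCsucc a b c d n = racahA a b c d n * racahC a b c d (n + 1) := by
  rw [racahCsucc, racahC_succ, racahA, racahF, div_mul_div_comm, ← mul_assoc (2 * (n : ℂ) + d + c + 2),
    ← pow_two, ← mul_div_assoc]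
  congr 1
  ring

/-- The monic Racah polynomials satisfy the three-term recurrence relation. -/
theorem ttrr_racah_eq {a b c d : ℂ} (hm : ∀ j : ℕ, d + c + 2 + j ≠ 0) :
    ∀ {n : ℕ}, (∀ k < n, racahF a b c d k ≠ 0) →
    ttrr (racahB a b c d) (racahCsucc a b c d) n =
      C (racahNorm a b c d n) * racahSeries a b c d n
  | 0, _ => by simp [ttrr, racahNorm, racahSeries, poch_zero, racahCoef_zero, quadBasis]
  | 1, hF => by
    have hF0 := hF 0 (by omega)
    have hy := racahCoef_succ (n := 1) hF0
    have hn : racahNorm a b c d 1 = racahA a b c d 0 := by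
      rw [racahNorm_succ hm]
      simp [racahNorm, poch_zero]
    have h0 : d + c + 2 ≠ 0 := by simpa using hm 0
    have hA : racahA a b c d 0 = racahF a b c d 0 / (d + c + 2) := by
      simp [racahA, racahRatio]
    have hy1 : racahA a b c d 0 * racahCoef a b c d 1 1 = -1 := by
      rw [racahCoef_zero] at hy
      rw [hA, div_mul_eq_mul_div, div_eq_iff h0]
      push_cast at hy
      linear_combination hy
    refine Polynomial.funext fun z => ?_
    have hC0 : racahC a b c d 0 = 0 := by simp [racahC]
    rw [ttrr, racahSeries, hn, racahB_eq, hC0]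
    simp only [Finset.sum_range_succ, Finset.sum_range_zero, eval_add, eval_mul, eval_sub, eval_C,
      eval_X, racahCoef_zero, quadBasis, Finset.prod_range_succ, Finset.prod_range_zero]
    simp only [eval_zero, eval_one, mul_one, one_mul, zero_add, Nat.cast_zero, zero_mul]
    linear_combination z * hy1
  | n + 2, hF => by
    have h1 := ttrr_racah_eq hm (n := n + 1) (fun k hk => hF k (by omega))
    have h0 := ttrr_racah_eq hm (n := n) (fun k hk => hF k (by omega))
    refine Polynomial.funext fun z => ?_
    have hrec := racahSeries_recurrence (n := n) (fun k hk => hF k (by omega)) hm z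
    rw [ttrr, h1, h0, racahB_eq, racahCsucc_eq]
    simp only [eval_sub, eval_mul, eval_C, eval_X]
    rw [racahNorm_succ hm (n + 1), racahNorm_succ hm n]
    linear_combination (racahNorm a b c d n * racahA a b c d n) * hrec

theorem racahMonic_eq (a b c d : ℂ) (n : ℕ) :
    racahMonic d c a b n = C (racahNorm a b c d n) * racahSeries a b c d n := by
  simp only [racahMonic, racahNorm, racahSeries, racahCoef, racahBasis_eq]

/-! ### The Racah functional equation -/

theorem natDegree_racahPhi (a b c d : ℂ) : (racahPhi a b c d).natDegree ≤ 2 := by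
  rw [racahPhi]; compute_degree

theorem natDegree_racahPsi (a b c d : ℂ) : (racahPsi a b c d).natDegree ≤ 1 := by
  rw [racahPsi]; compute_degree

theorem racahPhi_coeff_two (a b c d : ℂ) : (racahPhi a b c d).coeff 2 = 2 := by
  rw [racahPhi, coeff_add, coeff_add, coeff_C_mul, coeff_C_mul, coeff_C]
  simp [coeff_X]

theorem racahPsi_coeff_one (a b c d : ℂ) : (racahPsi a b c d).coeff 1 = 2 * (d + c + 2) := by
  rw [racahPsi, coeff_add, coeff_C_mul, coeff_C]
  simp

/-- The direction (a + s, b - s, c - s, d + s) preserves a + b and c + d, so the lattice, the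
operators D and S, the eigenvalues and the denominators of the recurrence do not move. Yet a and d
move by s and b + c by -2s, so every factor of `racahF` becomes non-zero near s = 0. -/
theorem tendsto_racahPhi_coeff_add (a b c d : ℂ) (i : ℕ) :
    Tendsto (fun s => (racahPhi (a + s) (b - s) (c - s) (d + s)).coeff i) (𝓝[≠] 0)
      (𝓝 ((racahPhi a b c d).coeff i)) := by
  have e : ∀ a b c d, (racahPhi a b c d).coeff i = 2 * (X ^ 2 : ℂ[X]).coeff i
      + ((a + b + 2 * c + 3) * d + c * (a - b + 3) + 2 * (a + b + a * b + 2)) * (X : ℂ[X]).coeff i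
      + (1 + a) * (1 + d) * (a + b + 1) * (b + c + 1) * (1 : ℂ[X]).coeff i := fun a b c d => by
    rw [racahPhi, coeff_add, coeff_add, coeff_C_mul, coeff_C_mul, coeff_C_eq_mul_coeff_one]
  simp only [e]
  generalize (X ^ 2 : ℂ[X]).coeff i = x₁
  generalize (X : ℂ[X]).coeff i = x₂
  generalize (1 : ℂ[X]).coeff i = x₃
  refine tendsto_nhdsWithin_of_tendsto_nhds (Continuous.tendsto' (by fun_prop) 0 _ ?_)
  simp only [add_zero, sub_zero]

theorem tendsto_racahPsi_coeff_add (a b c d : ℂ) (i : ℕ) :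
    Tendsto (fun s => (racahPsi (a + s) (b - s) (c - s) (d + s)).coeff i) (𝓝[≠] 0)
      (𝓝 ((racahPsi a b c d).coeff i)) := by
  have e : ∀ a b c d, (racahPsi a b c d).coeff i = 2 * (d + c + 2) * (X : ℂ[X]).coeff i
      + 2 * (1 + a) * (1 + d) * (b + c + 1) * (1 : ℂ[X]).coeff i := fun a b c d => by
    rw [racahPsi, coeff_add, coeff_C_mul, coeff_C_eq_mul_coeff_one]
  simp only [e]
  generalize (X : ℂ[X]).coeff i = x₂
  generalize (1 : ℂ[X]).coeff i = x₃
  refine tendsto_nhdsWithin_of_tendsto_nhds (Continuous.tendsto' (by fun_prop) 0 _ ?_)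
  simp only [add_zero, sub_zero]

/-- The denominators depend on d + c only. Written as constant inverses they leave a polynomial in
s, so continuity needs no non-vanishing condition, not even for d + c at n = 0. -/
theorem tendsto_racahB_add (a b c d : ℂ) (n : ℕ) :
    Tendsto (fun s => racahB (a + s) (b - s) (c - s) (d + s) n) (𝓝[≠] 0)
      (𝓝 (racahB a b c d n)) := by
  have e : ∀ s, racahB (a + s) (b - s) (c - s) (d + s) n =
      -((n + (a + s) + 1) * (n + (d + s) + 1) * (n + (b - s) + (c - s) + 1) * racahRatio (d + c) n
        * (2 * n + d + c + 2)⁻¹) - n * (n + (c - s)) * (n + d + c - (a + s))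
        * (n + (d + s) - (b - s)) * ((2 * n + d + c) * (2 * n + d + c + 1))⁻¹ := by
    intro s
    rw [racahB, show d + s + (c - s) = d + c by ring]
    ring_nf
  have h0 := e 0
  rw [add_zero, sub_zero, sub_zero, add_zero] at h0
  refine Tendsto.congr (fun s => (e s).symm)
    (tendsto_nhdsWithin_of_tendsto_nhds (Continuous.tendsto' (by fun_prop) 0 _ ?_))
  rw [h0, add_zero, sub_zero, sub_zero, add_zero]

theorem tendsto_racahCsucc_add (a b c d : ℂ) (n : ℕ) :
    Tendsto (fun s => racahCsucc (a + s) (b - s) (c - s) (d + s) n) (𝓝[≠] 0)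
      (𝓝 (racahCsucc a b c d n)) := by
  have e : ∀ s, racahCsucc (a + s) (b - s) (c - s) (d + s) n =
      (n + 1) * (n + (a + s) + 1) * (n + (c - s) + 1) * (n + (d + s) + 1)
      * (racahRatio (d + c) n * (n + (b - s) + (c - s) + 1) * (n + c + d - (a + s) + 1)
        * (n + (d + s) - (b - s) + 1)
      * ((2 * n + d + c + 2) ^ 2 * (2 * n + d + c + 3))⁻¹) := by
    intro s
    rw [racahCsucc, show d + s + (c - s) = d + c by ring,
      show 2 * (n : ℂ) + (d + s) + (c - s) = 2 * n + d + c by ring, div_eq_mul_inv]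
    generalize ((2 * (n : ℂ) + d + c + 2) ^ 2 * (2 * n + d + c + 3))⁻¹ = x
    ring
  have h0 := e 0
  rw [add_zero, sub_zero, sub_zero, add_zero] at h0
  refine Tendsto.congr (fun s => (e s).symm)
    (tendsto_nhdsWithin_of_tendsto_nhds (Continuous.tendsto' (by fun_prop) 0 _ ?_))
  rw [h0, add_zero, sub_zero, sub_zero, add_zero]

theorem eventually_add_mul_ne_zero (x : ℂ) {m : ℂ} (hm : m ≠ 0) :
    ∀ᶠ s in 𝓝[≠] (0 : ℂ), x + m * s ≠ 0 := by
  by_cases h : x = 0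
  · filter_upwards [self_mem_nhdsWithin] with s hs
    rw [h, zero_add]
    exact mul_ne_zero hm hs
  · have hc : Continuous fun s : ℂ => x + m * s := by fun_prop
    exact (hc.continuousAt.eventually_ne (by simpa using h)).filter_mono nhdsWithin_le_nhds

theorem eventually_racahF_ne_zero (a b c d : ℂ) (n : ℕ) :
    ∀ᶠ s in 𝓝[≠] (0 : ℂ), ∀ k < n, racahF (a + s) (b - s) (c - s) (d + s) k ≠ 0 := by
  refine eventually_forall_lt (fun k => ?_) n
  filter_upwards [eventually_add_mul_ne_zero (d + 1 + k) one_ne_zero,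
    eventually_add_mul_ne_zero (c + b + 1 + k) (by norm_num : (-2 : ℂ) ≠ 0),
    eventually_add_mul_ne_zero (a + 1 + k) one_ne_zero] with s h1 h2 h3
  refine mul_ne_zero (mul_ne_zero ?_ ?_) ?_
  · convert h1 using 1; ring
  · convert h2 using 1; ring
  · convert h3 using 1; ring

theorem apply_ttrr_racah_eq_zero {D S : ℂ[X] →ₗ[ℂ] ℂ[X]} {a b c d : ℂ}
    (h : IsQuadOps D S (a + b + 1)) {u : Module.Dual ℂ ℂ[X]}
    (hu : ∀ f, u (pearsonOp D S (racahPhi a b c d) (racahPsi a b c d) f) = 0)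
    (hm : ∀ j : ℕ, d + c + 2 + j ≠ 0) (n : ℕ) :
    u (ttrr (racahB a b c d) (racahCsucc a b c d) (n + 1)) = 0 := by
  refine apply_ttrr_eq_zero_of_tendsto (l := 𝓝[≠] 0)
    (φ := fun s => racahPhi (a + s) (b - s) (c - s) (d + s))
    (ψ := fun s => racahPsi (a + s) (b - s) (c - s) (d + s))
    (B := fun s => racahB (a + s) (b - s) (c - s) (d + s))
    (Cs := fun s => racahCsucc (a + s) (b - s) (c - s) (d + s))
    (lam := fun _ => 2 * (n + 1) * (n + d + c + 2)) (lam₀ := 2 * (n + 1) * (n + d + c + 2))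
    (fun s => natDegree_racahPhi _ _ _ _) (natDegree_racahPhi _ _ _ _)
    (fun s => natDegree_racahPsi _ _ _ _) (natDegree_racahPsi _ _ _ _)
    (tendsto_racahPhi_coeff_add a b c d) (tendsto_racahPsi_coeff_add a b c d)
    (tendsto_racahB_add a b c d) (tendsto_racahCsucc_add a b c d) hu ?_ tendsto_const_nhds ?_
  · refine mul_ne_zero (mul_ne_zero two_ne_zero (Nat.cast_add_one_ne_zero n)) fun h0 => hm n ?_
    rw [← h0]
    ring
  · filter_upwards [eventually_racahF_ne_zero a b c d (n + 1)] with s hF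
    have hs : d + s + (c - s) = d + c := by ring
    have h' : IsQuadOps D S ((a + s) + (b - s) + 1) := by
      rwa [show (a + s) + (b - s) + 1 = a + b + 1 by ring]
    rw [ttrr_racah_eq (by rwa [hs]) hF, ← smul_eq_C_mul (p := racahSeries _ _ _ _ _), map_smul,
      map_smul, h'.pearsonOp_racahSeries n (fun k hk => hF k (by omega)), mul_smul_comm,
      show (n : ℂ) + (d + s) + (c - s) + 2 = n + d + c + 2 by ring]

/-- A regular solution of the Racah equation has `d + c + 2 + j ≠ 0`. -/
theorem racah_admissible {a b c d : ℂ} {u : Module.Dual ℂ ℂ[X]}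
    (hGP : GPEquation (isLattice_racah a b) (racahPhi a b c d) (racahPsi a b c d) u)
    {P : ℕ → ℂ[X]} (hP : IsOPS u P) (n : ℕ) : d + c + 2 + n ≠ 0 := by
  intro h0
  -- With γ_n = n and A_n = 1 one has d_n = 2(n + d + c + 2). Consecutive values differ by 2, so
  -- they cannot both vanish.
  refine (latticeRules_racah a b).admissible_of_isOPS (γ := fun n => n) (A := fun _ => 1)
    (by simp) rfl (fun n => by push_cast; ring) (fun n => by ring)
    (fun n => Nat.cast_ne_zero.mpr n.succ_ne_zero) one_ne_zero (natDegree_racahPhi _ _ _ _)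
    (natDegree_racahPsi _ _ _ _) hGP.apply_pearsonOp hP n ?_ ?_
  · rw [racahPhi_coeff_two, racahPsi_coeff_one]
    intro h1
    apply two_ne_zero (α := ℂ)
    push_cast at h1
    linear_combination h1 - 2 * h0
  · rw [racahPhi_coeff_two, racahPsi_coeff_one]
    linear_combination 2 * h0

/-! ### Racah polynomials -/

theorem notMem_negInts_iff (x : ℂ) : x ∉ negInts ↔ ∀ n : ℕ, x + (n + 1) ≠ 0 := by
  simp only [negInts, Set.mem_ofPred_eq, not_exists, eq_neg_iff_add_eq_zero, ne_eq]

theorem racahRatio_ne_zero {s : ℂ} (hm : ∀ j : ℕ, s + 2 + j ≠ 0) (n : ℕ) : racahRatio s n ≠ 0 := by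
  rcases n with _ | n
  · simp [racahRatio]
  · rw [racahRatio, if_neg n.succ_ne_zero]
    refine div_ne_zero (fun h0 => hm n ?_) (fun h0 => hm (2 * n + 1) ?_)
    · rw [← h0]; push_cast; ring
    · rw [← h0]; push_cast; ring

theorem racahCsucc_ne_zero_iff {a b c d : ℂ} (hm : ∀ j : ℕ, d + c + 2 + j ≠ 0) (n : ℕ) :
    racahCsucc a b c d n ≠ 0 ↔ a + (n + 1) ≠ 0 ∧ c + (n + 1) ≠ 0 ∧ d + (n + 1) ≠ 0 ∧
      b + c + (n + 1) ≠ 0 ∧ c + d - a + (n + 1) ≠ 0 ∧ d - b + (n + 1) ≠ 0 := by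
  have hR := racahRatio_ne_zero hm n
  have hn : (n + 1 : ℂ) ≠ 0 := Nat.cast_add_one_ne_zero n
  have h1 : 2 * (n : ℂ) + d + c + 2 ≠ 0 := fun h0 => hm (2 * n) (by rw [← h0]; push_cast; ring)
  have h2 : 2 * (n : ℂ) + d + c + 3 ≠ 0 := fun h0 => hm (2 * n + 1) (by
    rw [← h0]; push_cast; ring)
  rw [racahCsucc, show (n : ℂ) + a + 1 = a + (n + 1) by ring,
    show (n : ℂ) + c + 1 = c + (n + 1) by ring, show (n : ℂ) + d + 1 = d + (n + 1) by ring,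
    show (n : ℂ) + b + c + 1 = b + c + (n + 1) by ring,
    show (n : ℂ) + c + d - a + 1 = c + d - a + (n + 1) by ring,
    show (n : ℂ) + d - b + 1 = d - b + (n + 1) by ring]
  simp only [ne_eq, div_eq_zero_iff, mul_eq_zero, pow_eq_zero_iff two_ne_zero, hR, hn, h1, h2,
    false_or, or_false]
  tauto

theorem racah_regular_iff {a b c d : ℂ} {u : Module.Dual ℂ ℂ[X]} (hu : u ≠ 0)
    (hGP : GPEquation (isLattice_racah a b) (racahPhi a b c d) (racahPsi a b c d) u) :
    IsRegularFunctional u ↔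
      ({a, c, d, d + c + 1, b + c, c + d - a, d - b} : Set ℂ) ∩ negInts = ∅ := by
  have hset : ({a, c, d, d + c + 1, b + c, c + d - a, d - b} : Set ℂ) ∩ negInts = ∅ ↔
      (∀ j : ℕ, d + c + 2 + j ≠ 0) ∧ ∀ n : ℕ, a + (n + 1) ≠ 0 ∧ c + (n + 1) ≠ 0 ∧
        d + (n + 1) ≠ 0 ∧ b + c + (n + 1) ≠ 0 ∧ c + d - a + (n + 1) ≠ 0 ∧
          d - b + (n + 1) ≠ 0 := by
    -- Admissibility starts at d + c + 2, which is why the set contains d + c + 1.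
    have e : ∀ n : ℕ, d + c + 2 + n = d + c + 1 + (n + 1) := fun n => by ring
    rw [← Set.disjoint_iff_inter_eq_empty, Set.disjoint_left]
    simp only [Set.mem_insert_iff, Set.mem_singleton_iff, forall_eq_or_imp, forall_eq,
      notMem_negInts_iff, e, forall_and]
    tauto
  have main : (∀ j : ℕ, d + c + 2 + j ≠ 0) → (IsRegularFunctional u ↔
      ∀ n : ℕ, a + (n + 1) ≠ 0 ∧ c + (n + 1) ≠ 0 ∧ d + (n + 1) ≠ 0 ∧ b + c + (n + 1) ≠ 0 ∧
        c + d - a + (n + 1) ≠ 0 ∧ d - b + (n + 1) ≠ 0) := fun hm => by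
    rw [isRegularFunctional_iff_of_ttrr
      (apply_ttrr_racah_eq_zero (isQuadOps_racah a b) hGP.apply_pearsonOp hm) hu]
    exact forall_congr' fun n => racahCsucc_ne_zero_iff hm n
  rw [hset]
  constructor
  · rintro ⟨P, hP⟩
    have hm := racah_admissible hGP hP
    exact ⟨hm, (main hm).mp ⟨P, hP⟩⟩
  · rintro ⟨hm, hall⟩
    exact (main hm).mpr hall

theorem racah_polynomials {a b c d : ℂ} {u : Module.Dual ℂ ℂ[X]} (hu : u ≠ 0)
    (hGP : GPEquation (isLattice_racah a b) (racahPhi a b c d) (racahPsi a b c d) u)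
    {P : ℕ → ℂ[X]} (hP : IsMonicOPS u P) :
    SatisfiesTTRR P (racahB a b c d) (racahCsucc a b c d) ∧
      ∀ n : ℕ, P n = racahMonic d c a b n := by
  have hm := racah_admissible hGP hP.1
  have hann := apply_ttrr_racah_eq_zero (isQuadOps_racah a b) hGP.apply_pearsonOp hm
  have hPeq := hP.eq_ttrr hann hu
  have hC := (isRegularFunctional_iff_of_ttrr hann hu).mp ⟨P, hP.1⟩
  subst hPeq
  refine ⟨satisfiesTTRR_ttrr _ _, fun n => ?_⟩
  -- Regularity makes every C_{k+1} non-zero, and the factors of `racahF` are among its factors, so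
  -- here the series is defined without any limit.
  rw [racahMonic_eq, ttrr_racah_eq hm fun k _ => ?_]
  obtain ⟨ha, -, hd, hbc, -, -⟩ := (racahCsucc_ne_zero_iff hm k).mp (hC k)
  rw [racahF, show d + 1 + (k : ℂ) = d + (k + 1) by ring,
    show c + b + 1 + (k : ℂ) = b + c + (k + 1) by ring,
    show a + 1 + (k : ℂ) = a + (k + 1) by ring]
  exact mul_ne_zero (mul_ne_zero hd hbc) ha

/-! ### The two families together. -/

theorem mainTheorem6 :
    -- Askey-Wilson polynomials
    (∀ (q : ℝ) (c₁ c₂ c₃ r a b c d : ℂ) (hq : 0 < q) (hq1 : q ≠ 1)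
        (hc : (c₁, c₂) ≠ (0, 0)) (_hr : r ^ 2 = c₁ * c₂)
        (u : Module.Dual ℂ ℂ[X]) (_hu : u ≠ 0)
        (_hGP : GPEquation (IsLattice.exp q c₁ c₂ c₃ hq hq1 hc)
          (awPhi r c₃ a b c d) (awPsi q r c₃ a b c d) u),
      (∀ n : ℕ, admCoeff q (awPhi r c₃ a b c d) (awPsi q r c₃ a b c d) n =
        -(4 / ((q ^ (1 / 2 : ℝ) - q ^ (-1 / 2 : ℝ) : ℝ) : ℂ)) * ((q ^ (-(n : ℝ) / 2) : ℝ) : ℂ)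
          * (1 - a * b * c * d * (q : ℂ) ^ n)) ∧
      (IsRegularFunctional u ↔
        ∀ n : ℕ, c₁ * c₂ * (1 - a * b * c * d * (q : ℂ) ^ n) * (1 - a * b * (q : ℂ) ^ n)
          * (1 - a * c * (q : ℂ) ^ n) * (1 - a * d * (q : ℂ) ^ n) * (1 - b * c * (q : ℂ) ^ n)
          * (1 - b * d * (q : ℂ) ^ n) * (1 - c * d * (q : ℂ) ^ n) ≠ 0) ∧
      (IsRegularFunctional u → ∀ P : ℕ → ℂ[X], IsMonicOPS u P →
        (∃ B : ℕ → ℂ, SatisfiesTTRR P B (awCsucc q (c₁ * c₂) a b c d) ∧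
          (a ≠ 0 → ∀ n, B n = awB q r c₃ a b c d n) ∧
          (a = 0 → ∀ n, Tendsto (fun t : ℂ => awB q r c₃ t b c d n) (𝓝[≠] 0) (𝓝 (B n)))) ∧
        (a ≠ 0 → ∀ (n : ℕ) (z : ℂ), (P n).eval z =
          2 ^ n * r ^ n * (awMonic q a b c d n).eval ((z - c₃) / (2 * r))) ∧
        (a = 0 → ∀ (n : ℕ) (z : ℂ),
          Tendsto (fun t : ℂ =>
              2 ^ n * r ^ n * (awMonic q t b c d n).eval ((z - c₃) / (2 * r)))
            (𝓝[≠] 0) (𝓝 ((P n).eval z))))) ∧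
    -- Racah polynomials
    (∀ (a b c d : ℂ) (u : Module.Dual ℂ ℂ[X]) (_hu : u ≠ 0)
        (_hGP : GPEquation (isLattice_racah a b) (racahPhi a b c d) (racahPsi a b c d) u),
      (IsRegularFunctional u ↔
        ({a, c, d, d + c + 1, b + c, c + d - a, d - b} : Set ℂ) ∩ negInts = ∅) ∧
      (IsRegularFunctional u → ∀ P : ℕ → ℂ[X], IsMonicOPS u P →
        SatisfiesTTRR P (racahB a b c d) (racahCsucc a b c d) ∧
        ∀ n : ℕ, P n = racahMonic d c a b n)) := by
  refine ⟨fun q c₁ c₂ c₃ r a b c d hq hq1 hc hr u hu hGP => ⟨?_, ?_, ?_⟩,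
    fun a b c d u hu hGP => ⟨racah_regular_iff hu hGP, fun _ P hP => racah_polynomials hu hGP hP⟩⟩
  · exact admCoeff_aw hq hq1 r c₃ a b c d
  · exact aw_regular_iff hq hq1 _ hr hu hGP
  · exact fun _ P hP => aw_polynomials hq hq1 _ hr hu hGP hP
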